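/- **Setting.** Fix a constant $\Lambda$ and let $\Omega\subset\mathbb R^2$ be a bounded set with nonempty interior, contained in the closure of its interior, such that any two points $p,q$ of its interior are joined by a path in the interior of length at most $\Lambda|p-q|$ (for example a bounded convex set with nonempty interior, with $\Lambda=1$). A *size function* is a function $\sigma:\Omega\to(0,\infty)$. A set of polygonal elements *obeys* $\sigma$ if for every element $E$ and every $p\in E\cap\Omega$, all sides of $E$ have length at most $\sigma(p)$. The *local feature size* is $\hat\sigma(p)=\inf_{q\in\Omega}(|p-q|+\sigma(q))$. *Bounded-aspect-ratio meshes.* A mesh of aspect ratio at most $\rho$ covering $\Omega$ is a finite set of nondegenerate triangles and simple quadrilaterals whose union contains $\Omega$, any two of which meet only in common vertices and common sides, and in each of which the longest side is at most $\rho$ times the smallest distance from a vertex to a side not incident to it. *Diamond-kite meshes.* Let $T$ be a rhombille tiling of the plane (rhombi with angles $60^\circ,120^\circ$, six or three meeting at each vertex) of side length $s_0$. If the edges of a mesh at a vertex $p$ are exactly six edges of equal length $s$ with $60^\circ$ angles between consecutive ones, a *replacement step* at $p$ takes the regular hexagon spanned by the other ends $a_1,\dots,a_6$ of these edges, removes the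 six edges, and inserts the centers $c_i$ of the triangles $pa_ia_{i+1}$ as new vertices together with the 18 edges $pc_i,\ c_ia_i,\ c_ia_{i+1}$. A mesh obtained from a mesh $M$ by finitely many replacement steps is a *refinement* of $M$. The *diamond-kite mesh for $\sigma$* (starting from $T$) is the coarsest refinement of $T$ that obeys $\sigma$, that is, a refinement $M$ of $T$ that obeys $\sigma$ and such that every refinement of $T$ that obeys $\sigma$ is a refinement of $M$; we assume that it exists. For either kind of mesh, the *total edge length* on $\Omega$ is the sum of the lengths of all edges (each counted once) of the elements that meet $\Omega$. **Theorem.** For all constants $\rho,\Lambda,K$ there is a constant $C$, depending only on $\rho,\Lambda,K$, such that the following holds for all $\Omega$, $\sigma$ and $T$ as above. Suppose that $\hat\sigma(p)\le K s_0$ for all $p\in\Omega$ (the initial tiling is coarse) and that $\sigma(q)\le K\operatorname{diam}\Omega$ for some $q\in\Omega$. Then the total edge length on $\Omega$ of the diamond-kite mesh for $\sigma$ is at most $C$ times the total edge length on $\Omega$ of any mesh of aspect ratio at most $\rho$ that covers $\Omega$ and obeys $\sigma$. -/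

import Mathlib

open scoped NNReal ENNReal

noncomputable section

namespace DiamondKite

/-! ### Polygonal elements in the plane `ℂ` -/

/-- The length of the straight edge with the given pair of endpoints. -/
def edgeLength (e : Sym2 ℂ) : ℝ := Sym2.lift ⟨fun a b => dist a b, dist_comm⟩ e

/-- The closed segment with the given pair of endpoints. -/
def edgeSegment (e : Sym2 ℂ) : Set ℂ := convexHull ℝ {x | x ∈ e}

/-- A mesh element: a polygon, given by its sides and by the closed region that it occupies. -/
@[ext]
structure Cell where
  sides : Set (Sym2 ℂ)
  region : Set ℂ

/-- The vertices of an element. -/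
def Cell.verts (Q : Cell) : Set ℂ := {v | ∃ e ∈ Q.sides, v ∈ e}

/-- The triangle `abc`. -/
def triangle (a b c : ℂ) : Cell where
  sides := {s(a, b), s(b, c), s(c, a)}
  region := convexHull ℝ {a, b, c}

/-- The quadrilateral `abcd`, split into two triangles by its diagonal `ac`. -/
def splitQuad (a b c d : ℂ) : Cell where
  sides := {s(a, b), s(b, c), s(c, d), s(d, a)}
  region := convexHull ℝ {a, b, c} ∪ convexHull ℝ {a, c, d}

/-- The convex quadrilateral `abcd`. -/
def convexQuad (a b c d : ℂ) : Cell where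
  sides := {s(a, b), s(b, c), s(c, d), s(d, a)}
  region := convexHull ℝ {a, b, c, d}

/-- `Q` is a nondegenerate triangle. -/
def Cell.IsTriangle (Q : Cell) : Prop :=
  ∃ a b c : ℂ, AffineIndependent ℝ ![a, b, c] ∧ Q = triangle a b c

/-- `Q` is a simple quadrilateral, convex or not. Every simple quadrilateral has a diagonal `ac`
that runs inside it, and then the other two vertices lie strictly on opposite sides of the line
`ac`; conversely this makes `abcd` a simple polygon. -/
def Cell.IsQuadrilateral (Q : Cell) : Prop :=
  ∃ a b c d : ℂ, a ≠ c ∧ (line[ℝ, a, c]).SOppSide b d ∧ Q = splitQuad a b c d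

/-- The aspect ratio of `Q` is at most `ρ`: no side is longer than `ρ` times the smallest height,
i.e. the smallest distance from a vertex to a side not incident to it. (For a triangle this is
the ratio of the longest side to the shortest altitude.) -/
def Cell.AspectRatioLE (ρ : ℝ) (Q : Cell) : Prop :=
  ∀ e ∈ Q.sides, ∀ v ∈ Q.verts, ∀ f ∈ Q.sides, v ∉ f →
    edgeLength e ≤ ρ * Metric.infDist v (edgeSegment f)

/-! ### Meshes and size functions on a domain `Ω` -/

/-- No element of `M` is oversized: each side of an element is at most `σ p`, for every point
`p` of the domain in that element. -/
def ObeysSize (Ω : Set ℂ) (σ : ℂ → ℝ) (M : Set Cell) : Prop :=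
  ∀ Q ∈ M, ∀ p ∈ Q.region ∩ Ω, ∀ e ∈ Q.sides, edgeLength e ≤ σ p

/-- Edge-to-edge: two different elements meet only in common vertices and common sides. -/
def EdgeToEdge (M : Set Cell) : Prop :=
  ∀ Q ∈ M, ∀ R ∈ M, Q ≠ R → ∀ x ∈ Q.region ∩ R.region,
    x ∈ Q.verts ∩ R.verts ∨ ∃ e ∈ Q.sides ∩ R.sides, x ∈ edgeSegment e

/-- `M` is a (finite, edge-to-edge) mesh covering `Ω` by triangles and quadrilaterals of aspect
ratio at most `ρ`. -/
structure IsBoundedAspectMesh (ρ : ℝ) (Ω : Set ℂ) (M : Set Cell) : Prop where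
  finite : M.Finite
  shape : ∀ Q ∈ M, Q.IsTriangle ∨ Q.IsQuadrilateral
  aspect : ∀ Q ∈ M, Q.AspectRatioLE ρ
  edgeToEdge : EdgeToEdge M
  covers : Ω ⊆ ⋃ Q ∈ M, Q.region

/-- The edges of the elements of `M` that meet `Ω`. -/
def edgesOn (Ω : Set ℂ) (M : Set Cell) : Set (Sym2 ℂ) :=
  {e | ∃ Q ∈ M, (Q.region ∩ Ω).Nonempty ∧ e ∈ Q.sides}

/-- The total length of the edges of the part of the mesh `M` that covers `Ω`;
each edge is counted once. -/
def totalEdgeLength (Ω : Set ℂ) (M : Set Cell) : ℝ≥0∞ :=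
  ∑' e : edgesOn Ω M, ENNReal.ofReal (edgeLength e)

/-- The local feature size `inf_q (dist p q + σ q)`, with `q` ranging over the domain. -/
def localFeatureSize (Ω : Set ℂ) (σ : ℂ → ℝ) (p : ℂ) : ℝ := ⨅ q : Ω, (dist p q + σ q)

/-- `Ω` is a bounded domain, up to boundary points, in which any two interior points `p`, `q` are
joined by an interior path of length at most `Λ * dist p q`. Bounded convex sets with nonempty
interior satisfy this with `Λ = 1`. -/
structure IsQuasiconvexDomain (Λ : ℝ) (Ω : Set ℂ) : Prop where
  bounded : Bornology.IsBounded Ω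
  nonempty : (interior Ω).Nonempty
  subset_closure : Ω ⊆ closure (interior Ω)
  path : ∀ p ∈ interior Ω, ∀ q ∈ interior Ω, ∃ γ : ℝ → ℂ, γ 0 = p ∧ γ 1 = q ∧
    (∀ t ∈ Set.Icc (0 : ℝ) 1, γ t ∈ interior Ω) ∧
    ∀ s ∈ Set.Icc (0 : ℝ) 1, ∀ t ∈ Set.Icc (0 : ℝ) 1,
      dist (γ s) (γ t) ≤ Λ * dist p q * |s - t|

/-! ### Diamond-kite meshes -/

/-- The primitive sixth root of unity `exp (i π / 3)`. -/
def zeta : ℂ := ⟨1 / 2, √3 / 2⟩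

/-- The rhombille tiling of the plane that has a degree-six vertex at `z` and the vector `u` as
one of its edges at `z`. The degree-six vertices `p` form a triangular lattice, the six edges at
`p` are `u ζ ^ i`, and each tile is a rhombus with acute angle at such a `p`. -/
def rhombille (z u : ℂ) : Set Cell :=
  {Q | ∃ (m n : ℤ) (i : ℕ) (p : ℂ), p = z + u * (1 + zeta) * (m + n * zeta) ∧
    Q = convexQuad p (p + u * zeta ^ i) (p + u * zeta ^ i + u * zeta ^ (i + 1))
      (p + u * zeta ^ (i + 1))}

/-- The `i`-th vertex of the regular hexagon with center `p` and first vertex `p + u`. -/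
def hexVertex (p u : ℂ) (i : ℕ) : ℂ := p + u * zeta ^ i

/-- The center of the `i`-th of the six equilateral triangles into which the hexagon is cut by
its radii. -/
def hexInner (p u : ℂ) (i : ℕ) : ℂ := (p + hexVertex p u i + hexVertex p u (i + 1)) / 3

/-- The edges of the mesh `M` at the point `p`. -/
def edgesAt (M : Set Cell) (p : ℂ) : Set (Sym2 ℂ) := {e | ∃ Q ∈ M, e ∈ Q.sides ∧ p ∈ e}

/-- `M'` arises from `M` by the local replacement in the hexagon with center `p` and vertices
`hexVertex p u i`. It may be performed when the edges of `M` at `p` are exactly the six radii of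
the hexagon. The six radii are removed, so that each quadrilateral with two consecutive radii as
sides has its corner at `p` moved to the new vertex `hexInner p u i`, and six
new rhombi appear around `p`. -/
def IsReplacementAt (p u : ℂ) (M M' : Set Cell) : Prop :=
  u ≠ 0 ∧ edgesAt M p = {e | ∃ i : ℕ, e = s(p, hexVertex p u i)} ∧
  M' = {Q | Q ∈ M ∧ p ∉ Q.verts} ∪
    {Q | ∃ (i : ℕ) (x : ℂ), convexQuad p (hexVertex p u i) x (hexVertex p u (i + 1)) ∈ M ∧
      Q = convexQuad (hexInner p u i) (hexVertex p u i) x (hexVertex p u (i + 1))} ∪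
    {Q | ∃ i : ℕ,
      Q = convexQuad p (hexInner p u i) (hexVertex p u (i + 1)) (hexInner p u (i + 1))}

/-- `M'` is a refinement of `M`: it arises by finitely many (perhaps no) replacement steps. -/
def Refines (M M' : Set Cell) : Prop :=
  Relation.ReflTransGen (fun M₁ M₂ => ∃ p u : ℂ, IsReplacementAt p u M₁ M₂) M M'

/-- `M` is the diamond-kite mesh determined by the size function `σ` on `Ω`, starting from the
tiling `T`: the coarsest refinement of `T` that obeys `σ`. -/
structure IsDiamondKiteMeshFor (T : Set Cell) (Ω : Set ℂ) (σ : ℂ → ℝ) (M : Set Cell) : Prop where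
  refines : Refines T M
  obeys : ObeysSize Ω σ M
  coarsest : ∀ M' : Set Cell, Refines T M' → ObeysSize Ω σ M' → Refines M M'

end DiamondKite

end

noncomputable section

namespace DiamondKite

section

/-! ### The Eisenstein lattice -/

/-! The two edge lengths are compared through the local feature size. Write `sl u k = ‖u‖ / √3 ^ k`
for the edge length of level `k`. A cell of level `k` of the diamond-kite mesh has sides of length
`sl u k` or `sl u (k + 1)`, and the local feature size at its points in Ω is comparable to `sl u k`.
In a competing mesh every interior point of Ω lies in an element whose longest side is at most a
constant times the local feature size. So near each diamond-kite cell the competitor has edges of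
total length at least a fixed fraction of `sl u k`, and each competing edge serves only boundedly
many cells. Finer competing elements do no harm, since they only add length.

Combinatorics. The degree-six points available on level `k` form a triangular lattice, the
Eisenstein integers scaled by `(1 + ζ) ^ (-k)`, and these lattices are nested. A refinement is
recorded by the finite set `D` of nodes (level, lattice point) that have been replaced. A node can
be replaced once its predecessors, the nodes of the previous level at its point or one lattice unit
away from it, have been replaced. A replacement step then is the insertion of a ready node
(`replacement_eq`, `exists_ready_of_replacement`), so refinements of the tiling correspond to finite
downward closed sets (`refines_of_down`, `exists_down_of_refines`).

Cells are not too large (`IsCell.sl_le`): a small value `σ y` forces a fine cell at `y`, and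
closedness of `D` forces coarser replacements in growing neighbourhoods of `y`. Cells are not too
small (`IsCell.localFeatureSize_le`): near a fine cell there is a last replacement, and undoing it
must violate `σ`, for otherwise the mesh would not be coarsest.

Competing mesh (`exists_csize_bound`). Follow a short path from `x` to `y` that avoids all vertices.
Boundedly many elements meet at a vertex (`exists_degree_bound`), and elements with a common side
have comparable sizes, so size changes by a bounded factor around a vertex. Leaving the
neighbourhood of a vertex or a side costs a distance comparable to the element size. Hence a large
element at `x` is far from any place where `σ` is small.

Charging. A path leaving the neighbourhood of a cell is covered by competing elements, so their
longest sides add up to at least a fixed part of `sl u k` (`IsCell.ofReal_sl_le`). The charging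
cells of one edge have comparable levels and nearby nodes (`exists_charges_bound`). Exchanging the
order of summation finishes the proof. -/

/-- Eisenstein integers `a + b ζ`, in coordinates. -/
abbrev Eis := ℤ × ℤ

/-- Multiplication by `1 + ζ`. -/
def th (e : Eis) : Eis := (e.1 - e.2, e.1 + 2 * e.2)

/-- Multiplication by `ζ`. -/
def rot (e : Eis) : Eis := (-e.2, e.1 + e.2)

/-- The six units. -/
def IsU (w : Eis) : Prop :=
  (w.1 = 1 ∧ w.2 = 0) ∨ (w.1 = 0 ∧ w.2 = 1) ∨ (w.1 = -1 ∧ w.2 = 1) ∨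
  (w.1 = -1 ∧ w.2 = 0) ∨ (w.1 = 0 ∧ w.2 = -1) ∨ (w.1 = 1 ∧ w.2 = -1)

/-- `e` and `(1 + ζ) f` are equal or differ by a unit. -/
def Pre (e f : Eis) : Prop := th f - e = 0 ∨ IsU (th f - e)

lemma th_fst (e : Eis) : (th e).1 = e.1 - e.2 := rfl
lemma th_snd (e : Eis) : (th e).2 = e.1 + 2 * e.2 := rfl
lemma rot_fst (e : Eis) : (rot e).1 = -e.2 := rfl
lemma rot_snd (e : Eis) : (rot e).2 = e.1 + e.2 := rfl

lemma th_add (e f : Eis) : th (e + f) = th e + th f := by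
  simp only [Prod.ext_iff, th, Prod.fst_add, Prod.snd_add]; omega

lemma th_neg (e : Eis) : th (-e) = -th e := by
  simp only [Prod.ext_iff, th, Prod.fst_neg, Prod.snd_neg]; omega

lemma rot_neg (e : Eis) : rot (-e) = -rot e := by
  ext <;> simp [rot]; ring

lemma th_eq (e : Eis) : th e = e + rot e := by
  simp only [Prod.ext_iff, th, rot, Prod.fst_add, Prod.snd_add]; omega

lemma rot_rot (e : Eis) : rot (rot e) = rot e - e := by
  simp only [Prod.ext_iff, rot, Prod.fst_sub, Prod.snd_sub]; omega

lemma th_injective : Function.Injective th := by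
  intro e f h
  simp only [Prod.ext_iff, th] at h ⊢; omega

lemma IsU.neg {w : Eis} (h : IsU w) : IsU (-w) := by
  simp only [IsU, Prod.fst_neg, Prod.snd_neg] at h ⊢; omega

lemma IsU.rot {w : Eis} (h : IsU w) : IsU (rot w) := by
  simp only [IsU, rot_fst, rot_snd] at h ⊢; omega

lemma IsU.ne_zero {w : Eis} (h : IsU w) : w ≠ 0 := by
  rintro rfl; simp [IsU] at h

lemma th_ne_th_add {w : Eis} (h : IsU w) (e f : Eis) : th f ≠ th e + w := by
  simp only [IsU, th, ne_eq, Prod.ext_iff, Prod.fst_add, Prod.snd_add] at h ⊢; omega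

lemma pre_th_self (e : Eis) : Pre (th e) e := Or.inl (sub_self _)

/-- Distinct multiples of `1 + ζ` are at distance at least `√3`, so they never differ by a unit. A
node at a point that already occurs on the previous level therefore depends on a single node. -/
lemma pre_th_iff {e f : Eis} : Pre (th e) f ↔ f = e := by
  simp only [Pre, IsU, th, Prod.ext_iff, Prod.fst_sub, Prod.snd_sub, Prod.fst_zero, Prod.snd_zero]
  omega

lemma pre_th_add {e w : Eis} (h : IsU w) : Pre (th e + w) e := by
  right; simpa using h.neg

lemma pre_th_add' {e w : Eis} (h : IsU w) : Pre (th e + w) (e + w) := by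
  right
  have : th (e + w) - (th e + w) = DiamondKite.rot w := by rw [th_add, th_eq w]; abel
  rw [this]; exact h.rot

lemma pre_th_add_rot {e w : Eis} (h : IsU w) : Pre (th e + rot w) (e + w) := by
  right
  have : th (e + w) - (th e + DiamondKite.rot w) = w := by rw [th_add, th_eq w]; abel
  rw [this]; exact h

/-- Two neighbouring lattice points always have a common predecessor. -/
lemma exists_common_pre (e : Eis) {w : Eis} (h : IsU w) : ∃ f, Pre e f ∧ Pre (e + w) f := by
  obtain ⟨a, b⟩ := e
  obtain ⟨c, d⟩ := w
  -- `b - a` modulo 3 is the residue modulo `1 + ζ`. The points `e`, `e + w`, `e + rot w` have the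
  -- three different residues, so one of them is some `th f`, and this `f` serves.
  by_cases h0 : (b - a) % 3 = 0
  · have : (a, b) = th (a + (b - a) / 3, (b - a) / 3) := by
      simp only [th, Prod.ext_iff]; omega
    rw [this]
    exact ⟨_, pre_th_self _, pre_th_add h⟩
  by_cases h1 : (b + d - a - c) % 3 = 0
  · have : (a, b) + (c, d) = th (a + c + (b + d - a - c) / 3, (b + d - a - c) / 3) := by
      simp only [th, Prod.ext_iff, Prod.fst_add, Prod.snd_add]; omega
    refine ⟨(a + c + (b + d - a - c) / 3, (b + d - a - c) / 3), ?_, ?_⟩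
    · rw [eq_sub_of_add_eq this, sub_eq_add_neg]; exact pre_th_add h.neg
    · rw [this]; exact pre_th_self _
  · have h2 : (b + c + d - a + d) % 3 = 0 := by
      simp only [IsU] at h; omega
    have : (a, b) + rot (c, d) = th (a - d + (b + c + d - a + d) / 3, (b + c + d - a + d) / 3) := by
      simp only [th, rot, Prod.ext_iff, Prod.fst_add, Prod.snd_add]; omega
    refine ⟨(a - d + (b + c + d - a + d) / 3, (b + c + d - a + d) / 3), ?_, ?_⟩
    · rw [eq_sub_of_add_eq this, sub_eq_add_neg]; exact pre_th_add h.rot.neg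
    · have h3 : (a, b) + (c, d) = th (a - d + (b + c + d - a + d) / 3, (b + c + d - a + d) / 3)
          + -rot (rot (c, d)) := by
        rw [← this, rot_rot]; abel
      rw [h3]; exact pre_th_add h.rot.rot.neg

/-- The common predecessors of the two lattice points `th e + w` and `th e + rot w`. -/
lemma common_pre_side {e w f : Eis} (h : IsU w) (h1 : Pre (th e + w) f)
    (h2 : Pre (th e + rot w) f) : f = e ∨ f = e + w := by
  simp only [Pre, IsU, th, rot, Prod.ext_iff, Prod.fst_sub, Prod.snd_sub, Prod.fst_zero,
    Prod.snd_zero, Prod.fst_add, Prod.snd_add] at h h1 h2 ⊢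
  omega

/-- An edge of the lattice with predecessor `e` either ends at `th e` or is one of the sides
of the hexagon around `th e`. -/
lemma edge_of_common_pre {e f w : Eis} (h : IsU w) (h1 : Pre f e) (h2 : Pre (f + w) e) :
    f = th e ∨ f + w = th e ∨ (∃ v, IsU v ∧ f = th e + v ∧ f + w = th e + rot v) ∨
      (∃ v, IsU v ∧ f + w = th e + v ∧ f = th e + rot v) := by
  rcases h1 with h1 | h1
  · left; exact (sub_eq_zero.1 h1).symm
  rcases h2 with h2 | h2
  · right; left; exact (sub_eq_zero.1 h2).symm
  right; right
  by_cases h3 : rot (f - th e) = f + w - th e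
  · left
    refine ⟨f - th e, ?_, by abel, by rw [h3]; abel⟩
    have := h1.neg; rwa [neg_sub] at this
  · right
    refine ⟨f + w - th e, ?_, by abel, ?_⟩
    · have := h2.neg; rwa [neg_sub] at this
    · simp only [IsU, th, rot, Prod.ext_iff, Prod.fst_sub, Prod.snd_sub,
        Prod.fst_add, Prod.snd_add] at h h1 h2 h3 ⊢
      omega

/-! ### Lattice points in the plane -/

/-- The complex number `a + b ζ`. -/
def emb (e : Eis) : ℂ := e.1 + e.2 * zeta

lemma zeta_sq : zeta ^ 2 = zeta - 1 := by
  have h3 : (√3 : ℝ) * √3 = 3 := Real.mul_self_sqrt (by norm_num)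
  apply Complex.ext
  · simp [zeta, pow_two]; nlinarith
  · simp [zeta, pow_two]; ring

lemma zeta_mul_zeta : zeta * zeta = zeta - 1 := by rw [← pow_two, zeta_sq]

lemma emb_add (e f : Eis) : emb (e + f) = emb e + emb f := by
  simp [emb]; ring

lemma emb_neg (e : Eis) : emb (-e) = -emb e := by
  simp [emb]; ring

lemma emb_sub (e f : Eis) : emb (e - f) = emb e - emb f := by
  rw [sub_eq_add_neg, emb_add, emb_neg]; ring

lemma emb_th (e : Eis) : emb (th e) = (1 + zeta) * emb e := by
  simp only [emb, th]; push_cast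
  linear_combination (-(e.2 : ℂ)) * zeta_mul_zeta

lemma emb_rot (e : Eis) : emb (rot e) = zeta * emb e := by
  simp only [emb, rot]; push_cast
  linear_combination (-(e.2 : ℂ)) * zeta_mul_zeta

lemma emb_normSq (e : Eis) :
    Complex.normSq (emb e) = ((e.1 * e.1 + e.1 * e.2 + e.2 * e.2 : ℤ) : ℝ) := by
  have h3 : (√3 : ℝ) * √3 = 3 := Real.mul_self_sqrt (by norm_num)
  simp [emb, zeta, Complex.normSq_apply]
  nlinarith

lemma emb_injective : Function.Injective emb := by
  intro e f h
  have h0 : Complex.normSq (emb (e - f)) = 0 := by rw [emb_sub, h]; simp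
  rw [emb_normSq] at h0
  have h1 : (e - f).1 * (e - f).1 + (e - f).1 * (e - f).2 + (e - f).2 * (e - f).2 = 0 := by
    exact_mod_cast h0
  have hy : (e - f).2 = 0 := by nlinarith [sq_nonneg (2 * (e - f).1 + (e - f).2), sq_nonneg (e - f).2]
  have hx : (e - f).1 = 0 := by nlinarith
  have : e - f = 0 := Prod.ext hx hy
  exact sub_eq_zero.1 this

lemma one_add_zeta_ne_zero : 1 + zeta ≠ 0 := by
  intro h
  have := congrArg Complex.re h
  simp [zeta] at this; norm_num at this

/-- The lattice point of level `k` with Eisenstein coordinate `e`. -/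
def pt (z u : ℂ) (k : ℕ) (e : Eis) : ℂ := z + u * (1 + zeta) * emb e / (1 + zeta) ^ k

/-- The edge vector of level `k`. -/
def ev (u : ℂ) (k : ℕ) : ℂ := u / (1 + zeta) ^ k

variable {z u : ℂ}

lemma pt_succ_th (k : ℕ) (e : Eis) : pt z u (k + 1) (th e) = pt z u k e := by
  have := one_add_zeta_ne_zero
  simp only [pt, emb_th, pow_succ]; field_simp

lemma pt_succ_add (k : ℕ) (e w : Eis) :
    pt z u (k + 1) (th e + w) = pt z u k e + ev u k * emb w := by
  have := one_add_zeta_ne_zero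
  simp only [pt, ev, emb_add, emb_th, pow_succ]; field_simp; ring

lemma pt_add (k : ℕ) (e w : Eis) :
    pt z u k (e + w) = pt z u k e + ev u k * (1 + zeta) * emb w := by
  simp only [pt, ev, emb_add]; ring

lemma ev_succ (k : ℕ) : ev u k = ev u (k + 1) * (1 + zeta) := by
  have := one_add_zeta_ne_zero
  simp only [ev, pow_succ]; field_simp

lemma ev_ne_zero (hu : u ≠ 0) (k : ℕ) : ev u k ≠ 0 :=
  div_ne_zero hu (pow_ne_zero _ one_add_zeta_ne_zero)

lemma pt_injective (hu : u ≠ 0) (k : ℕ) : Function.Injective (pt z u k) := by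
  intro e f h
  have h1 := one_add_zeta_ne_zero
  simp only [pt] at h
  field_simp at h
  have h2 : (emb e) = emb f := by
    have := add_left_cancel h
    exact mul_left_cancel₀ hu (mul_left_cancel₀ h1 (by linear_combination this))
  exact emb_injective h2

lemma pt_iterate (k n : ℕ) (e : Eis) : pt z u (k + n) (th^[n] e) = pt z u k e := by
  induction n with
  | zero => rfl
  | succ n ih => rw [Function.iterate_succ_apply', ← add_assoc, pt_succ_th, ih]

/-- The lattices are nested, so coincidences of plane points on different levels become equations
between iterates of `th`. -/
lemma eq_iterate_of_pt_eq (hu : u ≠ 0) {j k : ℕ} {e f : Eis} (hjk : j ≤ k)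
    (h : pt z u j e = pt z u k f) : f = th^[k - j] e := by
  apply pt_injective hu k (z := z)
  rw [← h]
  conv_rhs => rw [show k = j + (k - j) by omega, Nat.add_sub_cancel_left]
  rw [pt_iterate]

end

section

variable {z u : ℂ}

/-! ### Meshes given by sets of replaced lattice points -/

/-- `D` contains with each node all the nodes that have to be replaced before it. -/
def Down (D : Set (ℕ × Eis)) : Prop := ∀ k e f, (k + 1, e) ∈ D → Pre e f → (k, f) ∈ D

/-- All common predecessors of the ends of the lattice edge from `e` to `e + w` are replaced. -/
def Active (D : Set (ℕ × Eis)) : ℕ → Eis → Eis → Prop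
  | 0, _, _ => True
  | k + 1, e, w => ∀ f, Pre e f → Pre (e + w) f → (k, f) ∈ D

/-- The node `(k, e)` can be replaced next. -/
def Ready (D : Set (ℕ × Eis)) (k : ℕ) (e : Eis) : Prop :=
  (k, e) ∉ D ∧ ∀ j, k = j + 1 → ∀ f, Pre e f → (j, f) ∈ D

open Classical in
/-- The corner near `pt z u k e` of the level `k` cell in direction `w`. -/
def tip (z u : ℂ) (D : Set (ℕ × Eis)) (k : ℕ) (e w : Eis) : ℂ :=
  if (k, e) ∈ D then pt z u (k + 2) (th (th e) + rot w) else pt z u k e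

/-- The cell of level `k` on the lattice edge from `e` to `e + w`. -/
def cellOf (z u : ℂ) (D : Set (ℕ × Eis)) (k : ℕ) (e w : Eis) : Cell :=
  convexQuad (tip z u D k e w) (pt z u (k + 1) (th e + w)) (tip z u D k (e + w) (-w))
    (pt z u (k + 1) (th e + rot w))

/-- The lattice edge from `e` to `e + w` of level `k` carries a cell of the mesh of `D`. -/
def IsCell (D : Set (ℕ × Eis)) (k : ℕ) (e w : Eis) : Prop :=
  IsU w ∧ Active D k e w ∧ ¬ ((k, e) ∈ D ∧ (k, e + w) ∈ D)

/-- The mesh obtained by the replacements in `D`. -/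
def mesh (z u : ℂ) (D : Set (ℕ × Eis)) : Set Cell :=
  {Q | ∃ k e w, IsCell D k e w ∧ Q = cellOf z u D k e w}

lemma convexQuad_rotate (a b c d : ℂ) : convexQuad a b c d = convexQuad b c d a := by
  ext x
  · simp only [convexQuad, Set.mem_insert_iff, Set.mem_singleton_iff]; tauto
  · have : ({a, b, c, d} : Set ℂ) = {b, c, d, a} := by
      ext x; simp only [Set.mem_insert_iff, Set.mem_singleton_iff]; tauto
    simp only [convexQuad, this]

lemma convexQuad_swap (a b c d : ℂ) : convexQuad a b c d = convexQuad c d a b := by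
  rw [convexQuad_rotate, convexQuad_rotate]

lemma mem_verts_convexQuad {a b c d v : ℂ} :
    v ∈ (convexQuad a b c d).verts ↔ v = a ∨ v = b ∨ v = c ∨ v = d := by
  simp only [Cell.verts, convexQuad, Set.mem_insert_iff, Set.mem_singleton_iff, Set.mem_ofPred_eq]
  constructor
  · rintro ⟨e, rfl | rfl | rfl | rfl, h⟩ <;> simp only [Sym2.mem_iff] at h <;> tauto
  · rintro (rfl | rfl | rfl | rfl)
    · exact ⟨_, Or.inl rfl, by simp⟩
    · exact ⟨_, Or.inl rfl, by simp⟩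
    · exact ⟨_, Or.inr (Or.inl rfl), by simp⟩
    · exact ⟨_, Or.inr (Or.inr (Or.inl rfl)), by simp⟩

lemma mem_sides_convexQuad {a b c d : ℂ} {e : Sym2 ℂ} :
    e ∈ (convexQuad a b c d).sides ↔ e = s(a, b) ∨ e = s(b, c) ∨ e = s(c, d) ∨ e = s(d, a) := by
  simp [convexQuad]

/-- Reversing a lattice edge exchanges the two obtuse corners of its rhombus; this identity and the
next one are that exchange in coordinates. -/
lemma th_add_neg (e w : Eis) : th (e + w) + -w = th e + rot w := by
  rw [th_add, th_eq w]; abel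

lemma th_add_rot_neg (e w : Eis) : th (e + w) + rot (-w) = th e + w := by
  rw [th_add, th_eq w, rot_neg]; abel

lemma cellOf_symm (D : Set (ℕ × Eis)) (k : ℕ) (e w : Eis) :
    cellOf z u D k (e + w) (-w) = cellOf z u D k e w := by
  unfold cellOf
  rw [th_add_neg, th_add_rot_neg, add_neg_cancel_right, neg_neg, convexQuad_swap]

lemma Active.symm {D : Set (ℕ × Eis)} {k : ℕ} {e w : Eis} (h : Active D k e w) :
    Active D k (e + w) (-w) := by
  cases k with
  | zero => trivial
  | succ k =>
    intro f h1 h2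
    rw [add_neg_cancel_right] at h2
    exact h f h2 h1

lemma IsCell.symm {D : Set (ℕ × Eis)} {k : ℕ} {e w : Eis} (h : IsCell D k e w) :
    IsCell D k (e + w) (-w) :=
  ⟨h.1.neg, h.2.1.symm, fun h' => h.2.2 ⟨by simpa using h'.2, h'.1⟩⟩

lemma Active.mono {D D' : Set (ℕ × Eis)} (hDD : D ⊆ D') {k : ℕ} {e w : Eis} (h : Active D k e w) :
    Active D' k e w := by
  cases k with
  | zero => trivial
  | succ k => exact fun f h1 h2 => hDD (h f h1 h2)

lemma Ready.active {D : Set (ℕ × Eis)} {k : ℕ} {e : Eis} (h : Ready D k e) (w : Eis) :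
    Active D k e w := by
  cases k with
  | zero => trivial
  | succ k => exact fun f h1 _ => h.2 k rfl f h1

lemma Ready.isCell {D : Set (ℕ × Eis)} {k : ℕ} {e w : Eis} (h : Ready D k e) (hw : IsU w) :
    IsCell D k e w := ⟨hw, h.active w, fun h' => h.1 h'.1⟩

/-- A node at `th e` has `e` among its predecessors, so a point replaced on a late level was
replaced on every earlier level on which it occurs. -/
lemma Down.of_iterate {D : Set (ℕ × Eis)} (hD : Down D) {k : ℕ} {e : Eis} :
    ∀ n, (k + n, th^[n] e) ∈ D → (k, e) ∈ D := by
  intro n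
  induction n with
  | zero => exact id
  | succ n ih =>
    intro h
    rw [Function.iterate_succ_apply'] at h
    exact ih (hD _ _ _ h (pre_th_self _))

/-- For `n = 0` this is readiness. Otherwise the same point is already replaced on level `k - 1`,
hence on level `m + 1`, and `D` is downward closed. -/
lemma pre_mem_of_ready {D : Set (ℕ × Eis)} (hD : Down D) {k m n : ℕ} {e g f : Eis}
    (hr : Ready D k e) (hk : k = m + 1 + n) (he : e = th^[n] g) (hf : Pre g f) : (m, f) ∈ D := by
  cases n with
  | zero => subst he; exact hr.2 m hk f hf
  | succ n =>
    rw [Function.iterate_succ_apply'] at he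
    have h1 : (m + 1 + n, th^[n] g) ∈ D := hr.2 _ hk _ (he ▸ pre_th_self _)
    exact hD _ _ _ (hD.of_iterate n h1) hf

/-- `th f + w` is not a multiple of `1 + ζ`, so its point first appears on level `j + 1`. -/
lemma canonical_level (hu : u ≠ 0) {j k : ℕ} {f e w : Eis} (hw : IsU w)
    (h : pt z u (j + 1) (th f + w) = pt z u k e) :
    ∃ n, k = j + 1 + n ∧ e = th^[n] (th f + w) := by
  rcases le_or_gt (j + 1) k with hk | hk
  · exact ⟨k - (j + 1), by omega, eq_iterate_of_pt_eq hu hk h⟩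
  · exfalso
    have h1 := eq_iterate_of_pt_eq hu hk.le h.symm
    rw [show j + 1 - k = (j - k) + 1 by omega, Function.iterate_succ_apply'] at h1
    exact th_ne_th_add hw _ _ h1.symm

lemma th_th_add_rot (f w : Eis) : th (th f) + rot w = th (th f + w) + -w := by
  rw [th_add, th_eq w]; abel

lemma th_th_add_rot' (f w : Eis) : th (th f) + rot w = th (th f + rot w) + -rot (rot w) := by
  rw [th_add, th_eq (rot w)]; abel

/-- At a point that is ready for replacement there are only the cells of its own level. -/
lemma vertex_index (hu : u ≠ 0) {D : Set (ℕ × Eis)} (hD : Down D) {k j : ℕ} {e f w : Eis}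
    (hr : Ready D k e) (hc : IsCell D j f w) (hp : pt z u k e ∈ (cellOf z u D j f w).verts) :
    j = k ∧ (f = e ∨ f + w = e) := by
  have htip : ∀ f w, IsCell D j f w → pt z u k e = tip z u D j f w → j = k ∧ f = e := by
    intro f w hc h
    unfold tip at h
    split_ifs at h with hf
    -- A displaced tip is a new point of level `j + 2`. A ready node there needs the node `th f + w`
    -- of level `j + 1`, which in turn needs `f + w`; then both ends of the edge are replaced and
    -- there is no cell.
    · exfalso
      obtain ⟨n, hk, he⟩ := canonical_level hu hc.1.rot h.symm
      have h1 : (j + 1, th f + w) ∈ D := by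
        refine pre_mem_of_ready hD hr hk he ?_
        rw [th_th_add_rot]
        exact pre_th_add hc.1.neg
      exact hc.2.2 ⟨hf, hD _ _ _ h1 (pre_th_add' hc.1)⟩
    · rcases lt_trichotomy j k with hjk | hjk | hjk
      · exfalso
        have h1 := eq_iterate_of_pt_eq hu hjk.le h.symm
        obtain ⟨n, rfl⟩ := Nat.exists_eq_add_of_lt hjk
        rw [show j + n + 1 - j = n + 1 by omega, Function.iterate_succ_apply'] at h1
        have h2 : (j + n, th^[n] f) ∈ D := hr.2 _ rfl _ (h1 ▸ pre_th_self _)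
        exact hf (hD.of_iterate n h2)
      · subst hjk
        exact ⟨rfl, pt_injective hu _ h.symm⟩
      · exfalso
        have h1 := eq_iterate_of_pt_eq hu hjk.le h
        obtain ⟨n, rfl⟩ := Nat.exists_eq_add_of_lt hjk
        rw [show k + n + 1 - k = n + 1 by omega, Function.iterate_succ_apply'] at h1
        subst h1
        have h2 : (k + n, th^[n] e) ∈ D := hc.2.1 _ (pre_th_self _) (pre_th_add hc.1)
        exact hr.1 (hD.of_iterate n h2)
  -- An obtuse corner has both ends of the edge as predecessors, and a cell never has both ends
  -- replaced.
  have hmid : ∀ f w, IsCell D j f w → pt z u k e ≠ pt z u (j + 1) (th f + w) := by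
    intro f w hc h
    obtain ⟨n, hk, he⟩ := canonical_level hu hc.1 h.symm
    exact hc.2.2 ⟨pre_mem_of_ready hD hr hk he (pre_th_add hc.1),
      pre_mem_of_ready hD hr hk he (pre_th_add' hc.1)⟩
  rcases mem_verts_convexQuad.1 hp with h | h | h | h
  · have := htip f w hc h; tauto
  · exact (hmid f w hc h).elim
  · have := htip _ _ hc.symm h; tauto
  · rw [← th_add_neg] at h
    exact (hmid _ _ hc.symm h).elim

lemma tip_eq_of_notMem {D : Set (ℕ × Eis)} {k : ℕ} {e : Eis} (h : (k, e) ∉ D) (w : Eis) :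
    tip z u D k e w = pt z u k e := if_neg h

lemma tip_eq_of_mem {D : Set (ℕ × Eis)} {k : ℕ} {e : Eis} (h : (k, e) ∈ D) (w : Eis) :
    tip z u D k e w = pt z u (k + 2) (th (th e) + rot w) := if_pos h

/-- Each side of a cell issues from one of its two tips. -/
lemma side_rep {D : Set (ℕ × Eis)} {k : ℕ} {e w : Eis} {x : Sym2 ℂ} (hc : IsCell D k e w)
    (hx : x ∈ (cellOf z u D k e w).sides) : ∃ e w, IsCell D k e w ∧
      (x = s(tip z u D k e w, pt z u (k + 1) (th e + w)) ∨
        x = s(tip z u D k e w, pt z u (k + 1) (th e + rot w))) := by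
  rcases mem_sides_convexQuad.1 hx with h | h | h | h
  · exact ⟨e, w, hc, Or.inl h⟩
  · refine ⟨e + w, -w, hc.symm, Or.inr ?_⟩
    rw [th_add_rot_neg, h, Sym2.eq_swap]
  · refine ⟨e + w, -w, hc.symm, Or.inl ?_⟩
    rw [th_add_neg, h]
  · refine ⟨e, w, hc, Or.inr ?_⟩
    rw [h, Sym2.eq_swap]

/-- The edges at a lattice point of level `m` that is new at this level and not replaced. -/
lemma edge_at_new (hu : u ≠ 0) {D : Set (ℕ × Eis)} (hD : Down D) {m : ℕ} {g : Eis} {x : Sym2 ℂ}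
    (hnew : ∀ f, th f ≠ g) (hg : (m + 1, g) ∉ D)
    (hx : x ∈ edgesAt (mesh z u D) (pt z u (m + 1) g)) :
    (∃ w, IsU w ∧ x = s(pt z u (m + 1) g, pt z u (m + 2) (th g + w)) ∧
      ∀ f, th f = g + w → (m, f) ∈ D) ∨
    ∃ w f, IsU w ∧ th f = g + w ∧ x = s(pt z u (m + 1) g, pt z u m f) := by
  obtain ⟨Q, ⟨k, e, w, hc, rfl⟩, hxs, hp⟩ := hx
  obtain ⟨f, w, hc, hx⟩ := side_rep hc hxs
  clear hxs
  have hcanon : ∀ {j f w}, IsU w → pt z u (m + 1) g = pt z u (j + 1) (th f + w) →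
      j = m ∧ g = th f + w := by
    intro j f w hw h
    obtain ⟨n, h1, h2⟩ := canonical_level hu hw h.symm
    cases n with
    | zero => exact ⟨by omega, h2⟩
    | succ n => rw [Function.iterate_succ_apply'] at h2; exact (hnew _ h2.symm).elim
  by_cases hf : (k, f) ∈ D
  · rw [tip_eq_of_mem hf] at hx
    rcases hx with rfl | rfl
    · rcases Sym2.mem_iff.1 hp with h | h
      · right
        obtain ⟨h1, h2⟩ := hcanon (j := k + 1) hc.1.rot h
        subst h1
        refine ⟨w, th f + w, hc.1, ?_, by rw [← h]⟩
        rw [h2, th_add, th_eq w]; abel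
      · left
        obtain ⟨h1, h2⟩ := hcanon hc.1 h
        subst h1 h2
        refine ⟨-w, hc.1.neg, ?_, ?_⟩
        · rw [← th_th_add_rot, Sym2.eq_swap]
        · intro f' hf'
          rw [add_neg_cancel_right] at hf'
          rwa [th_injective hf']
    · rcases Sym2.mem_iff.1 hp with h | h
      · right
        obtain ⟨h1, h2⟩ := hcanon (j := k + 1) hc.1.rot h
        subst h1
        refine ⟨rot (rot w), th f + rot w, hc.1.rot.rot, ?_, by rw [← h]⟩
        rw [h2, th_add, th_eq (rot w)]; abel
      · left
        obtain ⟨h1, h2⟩ := hcanon hc.1.rot h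
        subst h1 h2
        refine ⟨-rot (rot w), hc.1.rot.rot.neg, ?_, ?_⟩
        · rw [← th_th_add_rot', Sym2.eq_swap]
        · intro f' hf'
          rw [rot_rot] at hf'
          exact (th_ne_th_add hc.1 f f' (by rw [hf']; abel)).elim
  · rw [tip_eq_of_notMem hf] at hx
    have hmain : ∀ v, (v = w ∨ v = rot w) → x = s(pt z u k f, pt z u (k + 1) (th f + v)) →
      ((∃ w, IsU w ∧ x = s(pt z u (m + 1) g, pt z u (m + 2) (th g + w)) ∧
      ∀ f, th f = g + w → (m, f) ∈ D) ∨
      ∃ w f, IsU w ∧ th f = g + w ∧ x = s(pt z u (m + 1) g, pt z u m f)) := by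
      intro v hv hx
      have hvU : IsU v := by rcases hv with rfl | rfl; exacts [hc.1, hc.1.rot]
      rw [hx] at hp
      rcases Sym2.mem_iff.1 hp with h | h
      · left
        rcases lt_trichotomy k (m + 1) with hk | hk | hk
        · exfalso
          have h1 := eq_iterate_of_pt_eq hu hk.le h.symm
          rw [show m + 1 - k = (m - k) + 1 by omega, Function.iterate_succ_apply'] at h1
          exact hnew _ h1.symm
        · subst hk
          have := pt_injective hu _ h
          subst this
          refine ⟨v, hvU, hx, fun f' hf' => hc.2.1 f' ?_ ?_⟩
          · right; rw [hf']; simpa using hvU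
          · rcases hv with rfl | rfl
            · left; rw [hf']; abel
            · right
              have : th f' - (g + w) = rot (rot w) := by rw [hf', rot_rot]; abel
              rw [this]; exact hc.1.rot.rot
        · exfalso
          have h1 := eq_iterate_of_pt_eq hu hk.le h
          obtain ⟨n, rfl⟩ := Nat.exists_eq_add_of_lt hk
          rw [show m + 1 + n + 1 - (m + 1) = n + 1 by omega, Function.iterate_succ_apply'] at h1
          subst h1
          have h2 : (m + 1 + n, th^[n] g) ∈ D := hc.2.1 _ (pre_th_self _) (pre_th_add hc.1)
          exact hg (hD.of_iterate n h2)
      · right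
        obtain ⟨h1, h2⟩ := hcanon hvU h
        subst h1 h2
        exact ⟨-v, f, hvU.neg, by abel, by rw [hx, Sym2.eq_swap]⟩
    rcases hx with hx | hx
    · exact hmain w (Or.inl rfl) hx
    · exact hmain (rot w) (Or.inr rfl) hx

/-! ### Replacement steps -/

/-- The powers of `ζ` as Eisenstein integers. -/
def un (i : ℕ) : Eis := rot^[i] (1, 0)

lemma un_succ (i : ℕ) : un (i + 1) = rot (un i) := Function.iterate_succ_apply' _ _ _

lemma isU_un (i : ℕ) : IsU (un i) := by
  induction i with
  | zero => simp [un, IsU]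
  | succ i ih => rw [un_succ]; exact ih.rot

lemma emb_un (i : ℕ) : emb (un i) = zeta ^ i := by
  induction i with
  | zero => simp [un, emb]
  | succ i ih => rw [un_succ, emb_rot, ih, pow_succ']

lemma exists_un {w : Eis} (h : IsU w) (j : ℕ) : ∃ i, un (i + j) = w := by
  have key : ∀ w, IsU w → ∃ i, un i = w := by
    rintro ⟨a, b⟩ h
    simp only [IsU] at h
    rcases h with ⟨rfl, rfl⟩ | ⟨rfl, rfl⟩ | ⟨rfl, rfl⟩ | ⟨rfl, rfl⟩ | ⟨rfl, rfl⟩ | ⟨rfl, rfl⟩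
    exacts [⟨0, rfl⟩, ⟨1, rfl⟩, ⟨2, rfl⟩, ⟨3, rfl⟩, ⟨4, rfl⟩, ⟨5, rfl⟩]
  have hper : ∀ i n, un (i + 6 * n) = un i := by
    intro i n
    induction n with
    | zero => rfl
    | succ n ih =>
      rw [show i + 6 * (n + 1) = (i + 6 * n) + 6 by ring]
      simp only [un_succ, ih]
      ext <;> simp only [rot] <;> ring
  obtain ⟨i, rfl⟩ := key w h
  -- `5 * j` plays the role of `-j`, as the powers have period six.
  exact ⟨i + 5 * j, by rw [show i + 5 * j + j = i + 6 * j by ring, hper]⟩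

/-- The radius vector of a replacement step is determined only up to a power of `ζ`, hence the
offset `j`. -/
lemma hexVertex_eq (k : ℕ) (e : Eis) (i j : ℕ) :
    hexVertex (pt z u k e) (ev u k * zeta ^ j) i = pt z u (k + 1) (th e + un (i + j)) := by
  rw [hexVertex, pt_succ_add, emb_un]; ring

lemma hexInner_eq (k : ℕ) (e : Eis) (i j : ℕ) :
    hexInner (pt z u k e) (ev u k * zeta ^ j) i = pt z u (k + 2) (th (th e) + un (i + j + 1)) := by
  rw [hexInner, hexVertex, hexVertex, pt_succ_add, pt_succ_th, emb_un, ev_succ]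
  linear_combination (ev u (k + 1) * zeta ^ (i + j)) / 3 * zeta_mul_zeta

lemma rot_rot_ne {w : Eis} (h : IsU w) : rot (rot w) ≠ w := by
  simp only [IsU, rot, ne_eq, Prod.ext_iff] at h ⊢; omega

/-- All corners are compared on one common level, `k + 2` if the tip has moved and `k + 1` if not.
Distinct corners are what allows a cell to be recovered from its set of sides. -/
lemma tip_ne {D : Set (ℕ × Eis)} (hu : u ≠ 0) {k : ℕ} {e w : Eis} (hw : IsU w) :
    tip z u D k (e + w) (-w) ≠ pt z u k e ∧
    tip z u D k (e + w) (-w) ≠ pt z u (k + 1) (th e + w) ∧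
    tip z u D k (e + w) (-w) ≠ pt z u (k + 1) (th e + rot w) := by
  have h2 : ∀ e, pt z u k e = pt z u (k + 2) (th (th e)) := fun e => by
    rw [pt_succ_th (k + 1), pt_succ_th]
  unfold tip
  split_ifs
  · rw [h2 e, ← pt_succ_th (k + 1) (th e + w), ← pt_succ_th (k + 1) (th e + rot w)]
    simp only [ne_eq, (pt_injective hu (k + 2)).eq_iff]
    simp only [IsU, rot, th, Prod.ext_iff, Prod.fst_add, Prod.snd_add, Prod.fst_neg,
      Prod.snd_neg] at hw ⊢
    omega
  · rw [← pt_succ_th k, ← pt_succ_th k]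
    simp only [ne_eq, (pt_injective hu (k + 1)).eq_iff]
    simp only [IsU, rot, th, Prod.ext_iff, Prod.fst_add, Prod.snd_add] at hw ⊢
    omega

lemma pt_ne_mid (hu : u ≠ 0) {k : ℕ} {e w : Eis} (hw : IsU w) :
    pt z u k e ≠ pt z u (k + 1) (th e + w) := by
  rw [← pt_succ_th k, ne_eq, (pt_injective hu (k + 1)).eq_iff]
  exact th_ne_th_add hw _ _

/-- The edges at a point that is ready for replacement. -/
lemma edgesAt_ready (hu : u ≠ 0) {D : Set (ℕ × Eis)} (hD : Down D) {k : ℕ} {e : Eis}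
    (hr : Ready D k e) : edgesAt (mesh z u D) (pt z u k e) =
      {x | ∃ w, IsU w ∧ x = s(pt z u k e, pt z u (k + 1) (th e + w))} := by
  ext x
  constructor
  · rintro ⟨Q, ⟨j, f, w, hc, rfl⟩, hxs, hp⟩
    obtain ⟨rfl, hf⟩ := vertex_index hu hD hr hc ⟨x, hxs, hp⟩
    have key : ∀ w, IsCell D j e w → x ∈ (cellOf z u D j e w).sides →
        ∃ w, IsU w ∧ x = s(pt z u j e, pt z u (j + 1) (th e + w)) := by
      intro w hc hxs
      obtain ⟨t1, t2, t3⟩ := tip_ne (z := z) (u := u) (D := D) (k := j) (e := e) hu hc.1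
      have h1 := pt_ne_mid (z := z) hu (k := j) (e := e) hc.1
      have h2 := pt_ne_mid (z := z) hu (k := j) (e := e) hc.1.rot
      rw [cellOf, mem_sides_convexQuad, tip_eq_of_notMem hr.1] at hxs
      rcases hxs with rfl | rfl | rfl | rfl
      · exact ⟨w, hc.1, rfl⟩
      · rcases Sym2.mem_iff.1 hp with h | h
        · exact (h1 h).elim
        · exact (t1 h.symm).elim
      · rcases Sym2.mem_iff.1 hp with h | h
        · exact (t1 h.symm).elim
        · exact (h2 h).elim
      · exact ⟨rot w, hc.1.rot, Sym2.eq_swap⟩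
    rcases hf with rfl | rfl
    · exact key w hc hxs
    · rw [← cellOf_symm] at hxs
      exact key _ hc.symm hxs
  · rintro ⟨w, hw, rfl⟩
    refine ⟨cellOf z u D k e w, ⟨k, e, w, hr.isCell hw, rfl⟩, ?_, by simp⟩
    rw [cellOf, mem_sides_convexQuad, tip_eq_of_notMem hr.1]
    exact Or.inl rfl

end

section

variable {z u : ℂ}

lemma tip_insert_of_ne {D : Set (ℕ × Eis)} {k j : ℕ} {e f : Eis} (h : (j, f) ≠ (k, e)) (w : Eis) :
    tip z u (insert (k, e) D) j f w = tip z u D j f w := by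
  have h' : (j, f) ∈ insert (k, e) D ↔ (j, f) ∈ D := Set.mem_insert_iff.trans (or_iff_right h)
  by_cases hf : (j, f) ∈ D
  · rw [tip_eq_of_mem hf, tip_eq_of_mem (h'.2 hf)]
  · rw [tip_eq_of_notMem hf, tip_eq_of_notMem (mt h'.1 hf)]

lemma cellOf_insert_of_ne {D : Set (ℕ × Eis)} {k j : ℕ} {e f w : Eis} (h : (j, f) ≠ (k, e))
    (h' : (j, f + w) ≠ (k, e)) :
    cellOf z u (insert (k, e) D) j f w = cellOf z u D j f w := by
  unfold cellOf
  rw [tip_insert_of_ne h, tip_insert_of_ne h']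

lemma add_isU_ne {e w : Eis} (hw : IsU w) : e + w ≠ e := by
  intro h; exact hw.ne_zero (by simpa using h)

lemma cellOf_insert_self {D : Set (ℕ × Eis)} {k : ℕ} {e w : Eis} (hw : IsU w) :
    cellOf z u (insert (k, e) D) k e w = convexQuad (pt z u (k + 2) (th (th e) + rot w))
      (pt z u (k + 1) (th e + w)) (tip z u D k (e + w) (-w)) (pt z u (k + 1) (th e + rot w)) := by
  unfold cellOf
  rw [tip_eq_of_mem (Set.mem_insert _ _), tip_insert_of_ne]
  simpa using hw.ne_zero

/-- The cell between two replaced points is a cell of the next level. -/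
lemma cellOf_side {D : Set (ℕ × Eis)} {k : ℕ} {e w : Eis}
    (h1 : (k + 1, th e + w) ∉ D) (h2 : (k + 1, th e + rot w) ∉ D) :
    cellOf z u D (k + 1) (th e + w) (rot (rot w)) =
      convexQuad (pt z u (k + 2) (th (th e) + rot w)) (pt z u (k + 1) (th e + w))
        (pt z u (k + 2) (th (th (e + w)) + rot (-w))) (pt z u (k + 1) (th e + rot w)) := by
  have e1 : th e + w + rot (rot w) = th e + rot w := by rw [rot_rot]; abel
  unfold cellOf
  rw [e1, tip_eq_of_notMem h1, tip_eq_of_notMem h2, convexQuad_rotate (pt z u (k + 2) _)]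
  congr 2
  · ext <;> simp only [th, rot, Prod.fst_add, Prod.snd_add, Prod.fst_neg, Prod.snd_neg] <;> ring
  · ext <;> simp only [th, rot, Prod.fst_add, Prod.snd_add] <;> ring

lemma notMem_of_pre {D : Set (ℕ × Eis)} (hD : Down D) {k : ℕ} {e f : Eis} (h : (k, e) ∉ D)
    (hf : Pre f e) : (k + 1, f) ∉ D := fun h' => h (hD _ _ _ h' hf)

lemma notMem_insert_of_pre {D : Set (ℕ × Eis)} (hD : Down D) {k : ℕ} {e f : Eis} (h : (k, e) ∉ D)
    (hf : Pre f e) : (k + 1, f) ∉ insert (k, e) D := by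
  rintro (h' | h')
  · simp at h'
  · exact notMem_of_pre hD h hf h'

/-- The effect of a replacement step on the mesh of `D`. -/
lemma replacement_eq (hu : u ≠ 0) {D : Set (ℕ × Eis)} (hD : Down D) {k : ℕ} {e : Eis}
    (hr : Ready D k e) (j : ℕ) :
    {Q | Q ∈ mesh z u D ∧ pt z u k e ∉ Q.verts} ∪
    {Q | ∃ (i : ℕ) (x : ℂ), convexQuad (pt z u k e)
        (hexVertex (pt z u k e) (ev u k * zeta ^ j) i) x
        (hexVertex (pt z u k e) (ev u k * zeta ^ j) (i + 1)) ∈ mesh z u D ∧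
      Q = convexQuad (hexInner (pt z u k e) (ev u k * zeta ^ j) i)
        (hexVertex (pt z u k e) (ev u k * zeta ^ j) i) x
        (hexVertex (pt z u k e) (ev u k * zeta ^ j) (i + 1))} ∪
    {Q | ∃ i : ℕ, Q = convexQuad (pt z u k e) (hexInner (pt z u k e) (ev u k * zeta ^ j) i)
      (hexVertex (pt z u k e) (ev u k * zeta ^ j) (i + 1))
      (hexInner (pt z u k e) (ev u k * zeta ^ j) (i + 1))} = mesh z u (insert (k, e) D) := by
  have hi1 : ∀ i : ℕ, un (i + 1 + j) = rot (un (i + j)) := fun i => by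
    rw [← un_succ]; congr 1; omega
  simp only [hexVertex_eq, hexInner_eq, un_succ, hi1]
  -- the cells with a corner at the replaced point
  have hmod : ∀ w, IsU w → convexQuad (pt z u (k + 2) (th (th e) + rot w))
      (pt z u (k + 1) (th e + w)) (tip z u D k (e + w) (-w)) (pt z u (k + 1) (th e + rot w)) ∈
        mesh z u (insert (k, e) D) := by
    intro w hw
    -- If the other end is already replaced, moving this tip turns the kite into a rhombus of level
    -- `k + 1`; otherwise a rhombus becomes a kite of the same level.
    by_cases hew : (k, e + w) ∈ D
    · rw [tip_eq_of_mem hew]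
      have n1 := notMem_insert_of_pre hD hr.1 (pre_th_add (e := e) hw)
      have n2 := notMem_insert_of_pre hD hr.1 (pre_th_add (e := e) hw.rot)
      refine ⟨k + 1, th e + w, rot (rot w), ⟨hw.rot.rot, ?_, fun h => n1 h.1⟩,
        (cellOf_side n1 n2).symm⟩
      intro f h1 h2
      rw [show th e + w + rot (rot w) = th e + rot w by rw [rot_rot]; abel] at h2
      rcases common_pre_side hw h1 h2 with rfl | rfl
      · exact Set.mem_insert _ _
      · exact Set.mem_insert_of_mem _ hew
    · refine ⟨k, e, w, ⟨hw, (hr.active w).mono (Set.subset_insert _ _), ?_⟩,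
        (cellOf_insert_self hw).symm⟩
      rintro ⟨-, h | h⟩
      · exact add_isU_ne hw (congrArg Prod.snd h)
      · exact hew h
  have hnew : ∀ w, IsU w → cellOf z u (insert (k, e) D) (k + 1) (th e) w =
      convexQuad (pt z u k e) (pt z u (k + 2) (th (th e) + w)) (pt z u (k + 1) (th e + w))
        (pt z u (k + 2) (th (th e) + rot w)) := by
    intro w hw
    unfold cellOf
    rw [tip_eq_of_notMem (notMem_insert_of_pre hD hr.1 (pre_th_self e)),
      tip_eq_of_notMem (notMem_insert_of_pre hD hr.1 (pre_th_add hw)), pt_succ_th]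
  apply Set.Subset.antisymm
  · rintro Q ((⟨⟨l, f, w, hc, rfl⟩, hp⟩ | ⟨i, x, hQ, rfl⟩) | ⟨i, rfl⟩)
    · have h1 : ∀ f w, IsCell D l f w → pt z u k e ∉ (cellOf z u D l f w).verts →
          (l, f) ≠ (k, e) := by
        intro f w _ hp h
        obtain ⟨rfl, rfl⟩ := Prod.mk.inj h
        exact hp (mem_verts_convexQuad.2 (Or.inl (tip_eq_of_notMem hr.1 w).symm))
      have h2 := h1 f w hc hp
      have h3 := h1 _ _ hc.symm (by rwa [cellOf_symm])
      refine ⟨l, f, w, ⟨hc.1, hc.2.1.mono (Set.subset_insert _ _), ?_⟩,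
        (cellOf_insert_of_ne h2 h3).symm⟩
      rintro ⟨h | h, h' | h'⟩
      exacts [h2 h, h2 h, h3 h', hc.2.2 ⟨h, h'⟩]
    · obtain ⟨l, f, w, hc, hQ⟩ := hQ
      have hmem : pt z u k e ∈ (cellOf z u D l f w).verts := by
        rw [← hQ]; exact mem_verts_convexQuad.2 (Or.inl rfl)
      obtain ⟨rfl, hf⟩ := vertex_index hu hD hr hc hmem
      obtain ⟨w, hw, hQ⟩ : ∃ w, IsU w ∧ convexQuad (pt z u l e)
          (pt z u (l + 1) (th e + un (i + j))) x (pt z u (l + 1) (th e + rot (un (i + j)))) =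
          cellOf z u D l e w := by
        rcases hf with rfl | rfl
        · exact ⟨w, hc.1, hQ⟩
        · exact ⟨-w, hc.1.neg, by rw [hQ, ← cellOf_symm]⟩
      obtain ⟨t1, t2, t3⟩ := tip_ne (z := z) (u := u) (D := D) (k := l) (e := e) hu hw
      have h1 := pt_ne_mid (z := z) hu (k := l) (e := e) hw
      have h2 := pt_ne_mid (z := z) hu (k := l) (e := e) hw.rot
      have h4 := pt_ne_mid (z := z) hu (k := l) (e := e) (isU_un (i + j))
      have hside := congrArg Cell.sides hQ
      -- The two sides at the replaced point identify the direction of the cell.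
      have hv : ∀ v, IsU v → s(pt z u l e, pt z u (l + 1) (th e + v)) ∈
          (cellOf z u D l e w).sides → v = w ∨ v = rot w := by
        intro v hv hs
        have h3 := pt_ne_mid (z := z) hu (k := l) (e := e) hv
        rw [cellOf, mem_sides_convexQuad, tip_eq_of_notMem hr.1] at hs
        simp only [Sym2.eq_iff] at hs
        have hinj : ∀ v w, pt z u (l + 1) (th e + v) = pt z u (l + 1) (th e + w) → v = w :=
          fun v w h => add_left_cancel (pt_injective hu _ h)
        rcases hs with (⟨-, h⟩ | ⟨h, -⟩) | (⟨h, -⟩ | ⟨h, -⟩) | (⟨h, -⟩ | ⟨h, -⟩) | (⟨h, -⟩ | ⟨-, h⟩)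
        · exact Or.inl (hinj _ _ h)
        · exact (h1 h).elim
        · exact (h1 h).elim
        · exact (t1 h.symm).elim
        · exact (t1 h.symm).elim
        · exact (h2 h).elim
        · exact (h2 h).elim
        · exact Or.inr (hinj _ _ h)
      have hw1 := hv _ (isU_un (i + j)) (by rw [← hQ]; simp [convexQuad])
      have hw2 := hv _ (isU_un (i + j)).rot (by
        rw [← hQ, mem_sides_convexQuad]; right; right; right; exact Sym2.eq_swap)
      -- The other assignment, `un (i + j) = rot w`, would require `rot (rot w)` to be `w` or `rot
      -- w`.
      have hw3 : un (i + j) = w := by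
        rcases hw1 with h | h
        · exact h
        · exfalso
          rw [h] at hw2
          rcases hw2 with h' | h'
          · exact rot_rot_ne hw h'
          · rw [rot_rot] at h'
            exact hw.ne_zero (by simpa using h')
      rw [hw3] at hQ h4 ⊢
      have hx : x = tip z u D l (e + w) (-w) := by
        have hs : s(pt z u (l + 1) (th e + w), tip z u D l (e + w) (-w)) ∈
            (convexQuad (pt z u l e) (pt z u (l + 1) (th e + w)) x
              (pt z u (l + 1) (th e + rot w))).sides := by
          rw [hQ, cellOf, mem_sides_convexQuad]; exact Or.inr (Or.inl rfl)
        rw [mem_sides_convexQuad] at hs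
        simp only [Sym2.eq_iff] at hs
        rcases hs with (⟨h, -⟩ | ⟨-, h⟩) | (⟨-, h⟩ | ⟨-, h⟩) | (⟨-, h⟩ | ⟨-, h⟩) | (⟨-, h⟩ | ⟨h, -⟩)
        · exact (h1 h.symm).elim
        · exact (t1 h).elim
        · exact h.symm
        · exact (t2 h).elim
        · exact (t3 h).elim
        · exact h.symm
        · exact (t1 h).elim
        · exact (h1 h.symm).elim
      rw [hx]
      exact hmod w hw
    · refine ⟨k + 1, th e, rot (un (i + j)), ⟨(isU_un _).rot, ?_, fun h =>
        notMem_insert_of_pre hD hr.1 (pre_th_self e) h.1⟩, (hnew _ (isU_un _).rot).symm⟩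
      intro f h1 _
      rw [pre_th_iff.1 h1]
      exact Set.mem_insert _ _
  · rintro Q ⟨l, f, w, hc, rfl⟩
    have hself : ∀ w, IsU w → (∃ (i : ℕ) (x : ℂ), convexQuad (pt z u k e)
        (pt z u (k + 1) (th e + un (i + j))) x (pt z u (k + 1) (th e + rot (un (i + j))))
          ∈ mesh z u D ∧
        convexQuad (pt z u (k + 2) (th (th e) + rot w))
          (pt z u (k + 1) (th e + w)) (tip z u D k (e + w) (-w)) (pt z u (k + 1) (th e + rot w)) =
        convexQuad (pt z u (k + 2) (th (th e) + rot (un (i + j))))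
          (pt z u (k + 1) (th e + un (i + j))) x (pt z u (k + 1) (th e + rot (un (i + j))))) := by
      intro w hw
      obtain ⟨i, hi⟩ := exists_un hw j
      refine ⟨i, tip z u D k (e + w) (-w), ?_, by rw [hi]⟩
      rw [hi]
      exact ⟨k, e, w, hr.isCell hw, by rw [cellOf, tip_eq_of_notMem hr.1]⟩
    -- An edge that is active only after the insertion has `(k, e)` as its missing common
    -- predecessor, so it lies on level `k + 1` and is a spoke or a side of the hexagon around the
    -- replaced point.
    by_cases hact : Active D l f w
    · by_cases h1 : (l, f) = (k, e)
      · obtain ⟨rfl, rfl⟩ := Prod.mk.inj h1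
        left; right
        rw [cellOf_insert_self hc.1]
        exact hself w hc.1
      by_cases h2 : (l, f + w) = (k, e)
      · obtain ⟨rfl, rfl⟩ := Prod.mk.inj h2
        left; right
        rw [← cellOf_symm, cellOf_insert_self hc.1.neg]
        exact hself _ hc.1.neg
      left; left
      rw [cellOf_insert_of_ne h1 h2]
      have hc' : IsCell D l f w := ⟨hc.1, hact, fun h => hc.2.2 ⟨Or.inr h.1, Or.inr h.2⟩⟩
      refine ⟨⟨l, f, w, hc', rfl⟩, fun hp => ?_⟩
      obtain ⟨rfl, rfl | rfl⟩ := vertex_index hu hD hr hc' hp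
      exacts [h1 rfl, h2 rfl]
    · cases l with
      | zero => exact (hact trivial).elim
      | succ l =>
      simp only [Active, not_forall] at hact
      obtain ⟨e', h1, h2, h3⟩ := hact
      have h4 : (l, e') ∈ insert (k, e) D := hc.2.1 e' h1 h2
      obtain ⟨rfl, rfl⟩ := Prod.mk.inj (h4.resolve_right h3)
      have hcen : ∀ w, IsU w → ∃ i : ℕ, cellOf z u (insert (l, e') D) (l + 1) (th e') w =
          convexQuad (pt z u l e') (pt z u (l + 2) (th (th e') + rot (un (i + j))))
            (pt z u (l + 1) (th e' + rot (un (i + j))))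
            (pt z u (l + 2) (th (th e') + rot (rot (un (i + j))))) := by
        intro w hw
        obtain ⟨i, hi⟩ := exists_un hw (j + 1)
        have hi' : rot (un (i + j)) = w := by rw [← un_succ, ← hi]; congr 1
        exact ⟨i, by rw [hnew w hw, hi']⟩
      -- On a side of the hexagon the second common predecessor `e' + v` was replaced before. The
      -- new rhombus is thus an old kite with its remaining tip moved.
      have hsd : ∀ f w v, IsCell (insert (l, e') D) (l + 1) f w → IsU v → f = th e' + v →
          f + w = th e' + rot v → cellOf z u (insert (l, e') D) (l + 1) f w =
            convexQuad (pt z u (l + 2) (th (th e') + rot v))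
          (pt z u (l + 1) (th e' + v)) (tip z u D l (e' + v) (-v))
          (pt z u (l + 1) (th e' + rot v)) := by
        intro f w v hc hv hf hfw
        have hw : w = rot (rot v) := by
          rw [rot_rot, ← add_right_inj f, hfw, hf]; abel
        subst hf hw
        have h5 : (l, e' + v) ∈ D := by
          refine (hc.2.1 (e' + v) (pre_th_add' hv) ?_).resolve_left ?_
          · rw [hfw]; exact pre_th_add_rot hv
          · simpa using hv.ne_zero
        rw [tip_eq_of_mem h5]
        exact cellOf_side (notMem_insert_of_pre hD hr.1 (pre_th_add hv))
          (notMem_insert_of_pre hD hr.1 (pre_th_add hv.rot))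
      rcases edge_of_common_pre hc.1 h1 h2 with hf | hf | ⟨v, hv, hf, hfw⟩ | ⟨v, hv, hfw, hf⟩
      · right; rw [hf]; exact hcen w hc.1
      · right; rw [← cellOf_symm, hf]; exact hcen _ hc.1.neg
      · left; right
        rw [hsd f w v hc hv hf hfw]
        exact hself v hv
      · left; right
        rw [← cellOf_symm, hsd _ _ v hc.symm hv hfw (by simpa using hf)]
        exact hself v hv

/-! ### Refinements of the rhombille tiling -/

lemma Down.insert {D : Set (ℕ × Eis)} (hD : Down D) {k : ℕ} {e : Eis} (hr : Ready D k e) :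
    Down (insert (k, e) D) := by
  rintro j f g (h | h) hp
  · obtain ⟨rfl, rfl⟩ := Prod.mk.inj h
    exact Or.inr (hr.2 j rfl g hp)
  · exact Or.inr (hD j f g h hp)

lemma Ready.isReplacementAt (hu : u ≠ 0) {D : Set (ℕ × Eis)} (hD : Down D) {k : ℕ} {e : Eis}
    (hr : Ready D k e) :
    IsReplacementAt (pt z u k e) (ev u k) (mesh z u D) (mesh z u (Insert.insert (k, e) D)) := by
  refine ⟨ev_ne_zero hu k, ?_, ?_⟩
  · rw [edgesAt_ready hu hD hr]
    ext x
    have h := hexVertex_eq (z := z) (u := u) k e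
    constructor
    · rintro ⟨w, hw, rfl⟩
      obtain ⟨i, rfl⟩ := exists_un hw 0
      exact ⟨i, by rw [← h i 0, pow_zero, mul_one]⟩
    · rintro ⟨i, rfl⟩
      refine ⟨un i, isU_un i, ?_⟩
      have := h i 0
      rw [pow_zero, mul_one, add_zero] at this
      rw [this]
  · have := replacement_eq (z := z) hu hD hr 0
    rw [pow_zero, mul_one] at this
    exact this.symm

/-- Factors `1 + ζ` are removed until none is left or level zero is reached; this gives the coarsest
level on which the point occurs. -/
lemma exists_canonical (k : ℕ) (e : Eis) :
    ∃ m g n, pt z u k e = pt z u m g ∧ k = m + n ∧ ∀ j, m = j + 1 → ∀ f, th f ≠ g := by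
  induction k generalizing e with
  | zero => exact ⟨0, e, 0, rfl, rfl, fun j h => by omega⟩
  | succ k ih =>
    by_cases h : ∃ f, th f = e
    · obtain ⟨f, rfl⟩ := h
      obtain ⟨m, g, n, h1, h2, h3⟩ := ih f
      exact ⟨m, g, n + 1, by rw [pt_succ_th, h1], by omega, h3⟩
    · exact ⟨k + 1, e, 0, rfl, rfl, fun j _ f hf => h ⟨f, hf⟩⟩

lemma exists_lattice_of_edge {D : Set (ℕ × Eis)} {p : ℂ} {x : Sym2 ℂ}
    (h : x ∈ edgesAt (mesh z u D) p) : ∃ k e, p = pt z u k e := by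
  obtain ⟨Q, ⟨k, e, w, hc, rfl⟩, hxs, hp⟩ := h
  have htip : ∀ e w, ∃ j f, tip z u D k e w = pt z u j f := by
    intro e w
    unfold tip
    split_ifs
    exacts [⟨_, _, rfl⟩, ⟨_, _, rfl⟩]
  have : p ∈ (cellOf z u D k e w).verts := ⟨x, hxs, hp⟩
  rcases mem_verts_convexQuad.1 this with h | h | h | h
  · rw [h]; exact htip _ _
  · exact ⟨_, _, h⟩
  · rw [h]; exact htip _ _
  · exact ⟨_, _, h⟩

lemma sym2_right_cancel {a b c : ℂ} (h : s(a, b) = s(a, c)) : b = c := Sym2.congr_right.1 h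

/-- Every replacement step in the mesh of `D` replaces a node that is ready. -/
lemma exists_ready_of_replacement (hu : u ≠ 0) {D : Set (ℕ × Eis)} (hD : Down D) (hfin : D.Finite)
    {p v : ℂ} {M' : Set Cell} (h : IsReplacementAt p v (mesh z u D) M') :
    ∃ k e, Ready D k e ∧ M' = mesh z u (Insert.insert (k, e) D) := by
  obtain ⟨hv, hedges, hM'⟩ := h
  have hmem : ∀ i, s(p, hexVertex p v i) ∈ edgesAt (mesh z u D) p := fun i => by
    rw [hedges]; exact ⟨i, rfl⟩
  obtain ⟨k, e, hpk⟩ := exists_lattice_of_edge (hmem 0)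
  obtain ⟨m, g, -, hpm, -, hcan⟩ := exists_canonical (z := z) (u := u) k e
  rw [hpm] at hpk
  clear hpm
  -- `n` counts the replacements already made at the point, so `m + n` is its current level. It
  -- exists because `D` is finite.
  obtain ⟨n, hn, hnmin⟩ : ∃ n, (m + n, th^[n] g) ∉ D ∧ ∀ n' < n, (m + n', th^[n'] g) ∈ D := by
    classical
    have hex : ∃ n, (m + n, th^[n] g) ∉ D := by
      by_contra hcon
      push Not at hcon
      refine Set.infinite_of_injective_forall_mem (f := fun n => (m + n, th^[n] g)) ?_ hcon hfin
      intro a b hab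
      have := congrArg Prod.fst hab
      simpa using this
    exact ⟨Nat.find hex, Nat.find_spec hex, fun n' hn' => not_not.1 (Nat.find_min hex hn')⟩
  have hready : Ready D (m + n) (th^[n] g) := by
    refine ⟨hn, ?_⟩
    cases n with
    | succ n =>
      intro j hj f hf
      rw [Function.iterate_succ_apply', pre_th_iff] at hf
      rw [show j = m + n by omega, hf]
      exact hnmin n (Nat.lt_succ_self n)
    | zero =>
      intro j hj f hf
      by_contra hfD
      change m = j + 1 at hj
      change Pre g f at hf
      change (m, g) ∉ D at hn
      subst hj
      have hf' : IsU (th f - g) := hf.resolve_left fun h => hcan j rfl f (sub_eq_zero.1 h)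
      have hE := fun i => edge_at_new hu hD (hcan j rfl) hn (hpk ▸ hmem i)
      have hvert : ∀ i, hexVertex (pt z u (j + 1) g) v i = pt z u (j + 1) g + v * zeta ^ i :=
        fun i => rfl
      -- All six edges have the length of the first. If they are short, the one in direction `th f -
      -- g` exists only if `f` is replaced, contrary to assumption. If they are long, two opposite
      -- ones make `g + w` and `g - w` multiples of `1 + ζ`, hence also `2 w`, which is impossible.
      rcases hE 0 with ⟨w, hw, hx, -⟩ | ⟨w, f', hw, hfw, hx⟩
      · have hvw : v = ev u (j + 1) * emb w := by
          have := sym2_right_cancel hx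
          rw [hvert, pow_zero, mul_one, pt_succ_add] at this
          exact add_left_cancel this
        obtain ⟨i, hi⟩ : ∃ i, v * zeta ^ i = ev u (j + 1) * emb (th f - g) := by
          obtain ⟨a, ha⟩ := exists_un hw 0
          obtain ⟨b, hb⟩ := exists_un hf' a
          refine ⟨b, ?_⟩
          rw [hvw, ← ha, ← hb, emb_un, emb_un, add_zero]; ring
        rcases hE i with ⟨w', hw', hx', hD'⟩ | ⟨w', f'', hw', hfw', hx'⟩
        · have := sym2_right_cancel hx'
          rw [hvert, hi, pt_succ_add] at this
          have := emb_injective (mul_left_cancel₀ (ev_ne_zero hu _) (add_left_cancel this))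
          exact hfD (hD' f (by rw [← this]; abel))
        · have := sym2_right_cancel hx'
          rw [hvert, hi, ← pt_succ_add, ← pt_succ_th j, ← pt_succ_th (j + 1)] at this
          exact th_ne_th_add hf' _ _ (pt_injective hu _ this).symm
      · have hz : ∀ w f', th f' = g + w → pt z u j f' =
            pt z u (j + 1) g + ev u (j + 1) * (1 + zeta) * emb w := by
          intro w f' hfw
          rw [← pt_add, ← hfw, pt_succ_th]
        have hvw : v = ev u (j + 1) * (1 + zeta) * emb w := by
          have := sym2_right_cancel hx
          rw [hvert, pow_zero, mul_one, hz _ _ hfw] at this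
          exact add_left_cancel this
        have hi : v * zeta ^ 3 = ev u (j + 1) * (1 + zeta) * emb (-w) := by
          rw [hvw, emb_neg]
          have : zeta ^ 3 = -1 := by
            rw [pow_succ, zeta_sq]; linear_combination zeta_mul_zeta
          rw [this]; ring
        rcases hE 3 with ⟨w', hw', hx', hD'⟩ | ⟨w', f'', hw', hfw', hx'⟩
        · have := sym2_right_cancel hx'
          rw [hvert, hi, ← pt_add, ← pt_succ_th (j + 1)] at this
          exact th_ne_th_add hw' _ _ (pt_injective hu _ this)
        · have := sym2_right_cancel hx'
          rw [hvert, hi, hz _ _ hfw'] at this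
          have hne : ev u (j + 1) * (1 + zeta) ≠ 0 :=
            mul_ne_zero (ev_ne_zero hu _) one_add_zeta_ne_zero
          have := emb_injective (mul_left_cancel₀ hne (add_left_cancel this))
          subst this
          simp only [IsU, th, Prod.ext_iff, Prod.fst_add, Prod.snd_add, Prod.fst_neg,
            Prod.snd_neg] at hfw hfw' hw
          omega
  rw [← pt_iterate m n g] at hpk
  refine ⟨_, _, hready, ?_⟩
  generalize m + n = k at hready hpk
  generalize th^[n] g = e at hready hpk
  obtain ⟨j, hj⟩ : ∃ j : ℕ, v = ev u k * zeta ^ j := by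
    have := hmem 0
    rw [hpk, edgesAt_ready hu hD hready] at this
    obtain ⟨w, hw, hx⟩ := this
    obtain ⟨j, rfl⟩ := exists_un hw 0
    refine ⟨j, ?_⟩
    have := sym2_right_cancel hx
    rw [pt_succ_add, hexVertex, pow_zero, mul_one, emb_un] at this
    exact add_left_cancel this
  rw [hM', hpk, hj]
  exact replacement_eq hu hD hready j

/-- Neighbouring lattice points of positive level always have a common predecessor, so without
replacements only edges of level zero are active. -/
lemma mesh_empty : mesh z u ∅ = rhombille z u := by
  have hcell : ∀ e i, cellOf z u ∅ 0 e (un i) = convexQuad (pt z u 0 e) (pt z u 0 e + u * zeta ^ i)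
      (pt z u 0 e + u * zeta ^ i + u * zeta ^ (i + 1)) (pt z u 0 e + u * zeta ^ (i + 1)) := by
    intro e i
    have h0 : ev u 0 = u := by simp [ev]
    unfold cellOf
    rw [tip_eq_of_notMem (by simp), tip_eq_of_notMem (by simp), pt_succ_add, pt_succ_add, pt_add,
      emb_un, ← un_succ, emb_un, h0]
    congr 1
    ring
  have hpt : ∀ m n : ℤ, pt z u 0 (m, n) = z + u * (1 + zeta) * (m + n * zeta) := by
    intro m n; simp [pt, emb]
  ext Q
  constructor
  · rintro ⟨k, e, w, hc, rfl⟩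
    cases k with
    | succ k =>
      obtain ⟨f, h1, h2⟩ := exists_common_pre e hc.1
      exact (hc.2.1 f h1 h2).elim
    | zero =>
      obtain ⟨i, rfl⟩ := exists_un hc.1 0
      exact ⟨e.1, e.2, i, pt z u 0 e, hpt e.1 e.2, hcell e i⟩
  · rintro ⟨m, n, i, p, hp, rfl⟩
    refine ⟨0, (m, n), un i, ⟨isU_un i, trivial, by simp⟩, ?_⟩
    rw [hcell, hpt, hp]

lemma down_empty : Down ∅ := fun _ _ _ h => h.elim

/-- A node of `D` that no other node of `D` depends on can be put back. -/
lemma Down.erase {D : Set (ℕ × Eis)} (hD : Down D) {k : ℕ} {e : Eis} (he : (k, e) ∈ D)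
    (hmax : ∀ f, Pre f e → (k + 1, f) ∉ D) :
    Down (D \ {(k, e)}) ∧ Ready (D \ {(k, e)}) k e ∧
      Insert.insert (k, e) (D \ {(k, e)}) = D := by
  refine ⟨?_, ⟨by simp, ?_⟩, by simp [Set.insert_eq_of_mem he]⟩
  · rintro j f g ⟨h1, -⟩ hp
    refine ⟨hD j f g h1 hp, ?_⟩
    rintro h
    obtain ⟨rfl, rfl⟩ := Prod.mk.inj (Set.mem_singleton_iff.1 h)
    exact hmax f hp h1
  · rintro j rfl f hf
    exact ⟨hD j e f he hf, by simp⟩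

/-- Induction on the number of nodes: a node of highest level can be taken back, because anything
depending on it would have a higher level. -/
lemma refines_of_down (hu : u ≠ 0) {D : Set (ℕ × Eis)} (hfin : D.Finite) (hD : Down D) :
    Refines (rhombille z u) (mesh z u D) := by
  induction hn : D.ncard generalizing D with
  | zero =>
    rw [(Set.ncard_eq_zero hfin).1 hn, mesh_empty]
    exact Relation.ReflTransGen.refl
  | succ n ih =>
    have hne : D.Nonempty := Set.nonempty_of_ncard_ne_zero (by omega)
    obtain ⟨⟨k, e⟩, he, hmax⟩ := Set.exists_max_image D Prod.fst hfin hne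
    obtain ⟨h1, h2, h3⟩ := hD.erase he fun f _ hf => by
      have := hmax _ hf; simp at this
    have h4 := ih (hfin.subset Set.sdiff_subset) h1 (by
      have := Set.ncard_sdiff_singleton_add_one he hfin; omega)
    have h5 := h2.isReplacementAt (z := z) hu h1
    rw [h3] at h5
    exact h4.tail ⟨_, _, h5⟩

/-- Refining only ever adds nodes. The inclusion `D ⊆ D'` is what turns the comparison with a
coarsest mesh into a statement about node sets. -/
lemma exists_down_of_refines (hu : u ≠ 0) {D : Set (ℕ × Eis)} (hfin : D.Finite) (hD : Down D)
    {M : Set Cell} (h : Refines (mesh z u D) M) :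
    ∃ D', D ⊆ D' ∧ D'.Finite ∧ Down D' ∧ M = mesh z u D' := by
  induction h with
  | refl => exact ⟨D, subset_rfl, hfin, hD, rfl⟩
  | tail _ hstep ih =>
    obtain ⟨D', h1, h2, h3, rfl⟩ := ih
    obtain ⟨p, v, hpv⟩ := hstep
    obtain ⟨k, e, hr, rfl⟩ := exists_ready_of_replacement hu h3 h2 hpv
    exact ⟨_, h1.trans (Set.subset_insert _ _), h2.insert _, h3.insert hr, rfl⟩

end

section

variable {z u : ℂ}

/-! ### Convex combinations -/

lemma Convex.comb_three {S : Set ℂ} (hS : Convex ℝ S) {a b c x : ℂ} {α β γ : ℝ} (ha : a ∈ S)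
    (hb : b ∈ S) (hc : c ∈ S) (hα : 0 ≤ α) (hβ : 0 ≤ β) (hγ : 0 ≤ γ) (h : α + β + γ = 1)
    (hx : x = α * a + β * b + γ * c) : x ∈ S := by
  rcases eq_or_lt_of_le (add_nonneg hα hβ) with h0 | h0
  · have h1 : α = 0 := by linarith
    have h2 : β = 0 := by linarith
    have h3 : γ = 1 := by linarith
    rw [hx, h1, h2, h3]; simpa using hc
  · have h1 : (α / (α + β)) • a + (β / (α + β)) • b ∈ S :=
      hS ha hb (by positivity) (by positivity) (by field_simp)
    have h2 := hS h1 hc h0.le hγ h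
    convert h2 using 1
    rw [hx]
    simp only [Complex.real_smul]
    push_cast
    have : (α : ℂ) + β ≠ 0 := by exact_mod_cast h0.ne'
    field_simp

lemma exists_comb_three {a b c x : ℂ} (h : x ∈ convexHull ℝ {a, b, c}) :
    ∃ α β γ : ℝ, 0 ≤ α ∧ 0 ≤ β ∧ 0 ≤ γ ∧ α + β + γ = 1 ∧ x = α * a + β * b + γ * c := by
  rw [convexHull_insert (by simp), convexHull_pair, mem_convexJoin] at h
  obtain ⟨_, rfl, y, ⟨s, t, hs, ht, hst, rfl⟩, ⟨p, q, hp, hq, hpq, rfl⟩⟩ := h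
  refine ⟨p, q * s, q * t, hp, by positivity, by positivity, ?_, ?_⟩
  · rw [add_assoc, ← mul_add, hst, mul_one, hpq]
  · simp only [Complex.real_smul]; push_cast; ring

lemma exists_comb_four {a b c d x : ℂ} (h : x ∈ convexHull ℝ {a, b, c, d}) :
    ∃ α β γ δ : ℝ, 0 ≤ α ∧ 0 ≤ β ∧ 0 ≤ γ ∧ 0 ≤ δ ∧ α + β + γ + δ = 1 ∧
      x = α * a + β * b + γ * c + δ * d := by
  rw [convexHull_insert (by simp), mem_convexJoin] at h
  obtain ⟨_, rfl, y, hy, ⟨p, q, hp, hq, hpq, rfl⟩⟩ := h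
  obtain ⟨α, β, γ, h1, h2, h3, h4, rfl⟩ := exists_comb_three hy
  refine ⟨p, q * α, q * β, q * γ, hp, by positivity, by positivity, by positivity, ?_, ?_⟩
  · rw [add_assoc, add_assoc, ← mul_add, ← mul_add, ← add_assoc, h4, mul_one, hpq]
  · simp only [Complex.real_smul]; push_cast; ring

/-- After squaring, the quadratic terms cancel and a half-plane remains (the whole plane if `a =
b`). -/
lemma convex_dist_le (a b : ℂ) : Convex ℝ {x : ℂ | dist x a ≤ dist x b} := by
  have : {x : ℂ | dist x a ≤ dist x b} =
      {x : ℂ | 2 * (b.re - a.re) * x.re + 2 * (b.im - a.im) * x.im ≤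
        b.re ^ 2 + b.im ^ 2 - a.re ^ 2 - a.im ^ 2} := by
    ext x
    simp only [Set.mem_ofPred_eq]
    rw [dist_eq_norm, dist_eq_norm, ← sq_le_sq₀ (norm_nonneg _) (norm_nonneg _), ← Complex.normSq_eq_norm_sq,
      ← Complex.normSq_eq_norm_sq, Complex.normSq_apply, Complex.normSq_apply]
    simp only [Complex.sub_re, Complex.sub_im]
    constructor <;> intro h <;> nlinarith
  rw [this]
  intro x hx y hy s t hs ht hst
  simp only [Set.mem_ofPred_eq, Complex.add_re, Complex.add_im, Complex.smul_re, Complex.smul_im,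
    smul_eq_mul] at hx hy ⊢
  have h1 := mul_le_mul_of_nonneg_left hx hs
  have h2 := mul_le_mul_of_nonneg_left hy ht
  have h3 : s = 1 - t := by linarith
  subst h3
  linarith

/-! ### Distances between lattice points -/

lemma norm_emb_sq (e : Eis) : ‖emb e‖ ^ 2 = ((e.1 * e.1 + e.1 * e.2 + e.2 * e.2 : ℤ) : ℝ) := by
  rw [← Complex.normSq_eq_norm_sq, emb_normSq]

lemma norm_emb_isU {w : Eis} (h : IsU w) : ‖emb w‖ = 1 := by
  have h1 := norm_emb_sq w
  have h2 : w.1 * w.1 + w.1 * w.2 + w.2 * w.2 = 1 := by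
    rcases h with ⟨h, h'⟩ | ⟨h, h'⟩ | ⟨h, h'⟩ | ⟨h, h'⟩ | ⟨h, h'⟩ | ⟨h, h'⟩ <;> rw [h, h'] <;> norm_num
  rw [h2] at h1
  have : ‖emb w‖ ^ 2 = 1 ^ 2 := by rw [h1]; norm_num
  exact (pow_left_inj₀ (norm_nonneg _) zero_le_one two_ne_zero).1 this

lemma one_le_norm_emb {e : Eis} (h : e ≠ 0) : 1 ≤ ‖emb e‖ := by
  have h1 := norm_emb_sq e
  have h2 : 0 < ‖emb e‖ := by
    rw [norm_pos_iff]
    intro h0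
    exact h (emb_injective (by rw [h0]; simp [emb]))
  have h3 : (0 : ℝ) < ((e.1 * e.1 + e.1 * e.2 + e.2 * e.2 : ℤ) : ℝ) := by rw [← h1]; positivity
  have h4 : (1 : ℤ) ≤ e.1 * e.1 + e.1 * e.2 + e.2 * e.2 := by exact_mod_cast h3
  have h5 : (1 : ℝ) ≤ ‖emb e‖ ^ 2 := by rw [h1]; exact_mod_cast h4
  nlinarith

/-- The edge length of level `k`. -/
def sl (u : ℂ) (k : ℕ) : ℝ := ‖ev u k‖

lemma norm_one_add_zeta : ‖1 + zeta‖ = √3 := by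
  have h3 : (√3 : ℝ) * √3 = 3 := Real.mul_self_sqrt (by norm_num)
  rw [← Real.sqrt_sq (norm_nonneg (1 + zeta)), ← Complex.normSq_eq_norm_sq]
  congr 1
  simp [zeta, Complex.normSq_apply]
  nlinarith

lemma sl_pos (hu : u ≠ 0) (k : ℕ) : 0 < sl u k := norm_pos_iff.2 (ev_ne_zero hu k)

lemma sl_zero : sl u 0 = ‖u‖ := by simp [sl, ev]

lemma sl_succ (k : ℕ) : sl u k = sl u (k + 1) * √3 := by
  rw [sl, ev_succ, norm_mul, norm_one_add_zeta, sl]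

lemma sl_two (k : ℕ) : sl u k = 3 * sl u (k + 2) := by
  have h3 : (√3 : ℝ) * √3 = 3 := Real.mul_self_sqrt (by norm_num)
  rw [sl_succ k, sl_succ (k + 1)]
  linear_combination sl u (k + 2) * h3

lemma sqrt_three_bounds : (17 / 10 : ℝ) < √3 ∧ √3 < 1.7321 := by
  constructor
  · exact Real.lt_sqrt_of_sq_lt (by norm_num)
  · rw [Real.sqrt_lt' (by norm_num)]; norm_num

lemma sl_antitone (hu : u ≠ 0) {j k : ℕ} (h : j ≤ k) : sl u k ≤ sl u j := by
  induction h with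
  | refl => exact le_rfl
  | step _ ih =>
    refine le_trans ?_ ih
    rename_i m _
    have := sl_pos hu (m + 1)
    rw [sl_succ m]
    nlinarith [sqrt_three_bounds.1]

lemma dist_pt_succ (k : ℕ) (e f : Eis) :
    dist (pt z u (k + 1) e) (pt z u (k + 1) f) = sl u k * ‖emb (e - f)‖ := by
  have h : pt z u (k + 1) e = pt z u (k + 1) f + ev u k * emb (e - f) := by
    rw [← add_sub_cancel f e, pt_add, ev_succ k]; congr 3; abel
  rw [h, dist_eq_norm, add_sub_cancel_left, norm_mul, sl]

lemma dist_pt (k : ℕ) (e f : Eis) :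
    dist (pt z u k e) (pt z u k f) = sl u k * √3 * ‖emb (e - f)‖ := by
  have h : pt z u k e = pt z u k f + ev u k * (1 + zeta) * emb (e - f) := by
    rw [← add_sub_cancel f e, pt_add]; congr 3; abel
  rw [h, dist_eq_norm, add_sub_cancel_left, norm_mul, norm_mul, norm_one_add_zeta, sl]

lemma dist_pt_mid (k : ℕ) {e w : Eis} (hw : IsU w) :
    dist (pt z u (k + 1) (th e + w)) (pt z u k e) = sl u k := by
  rw [pt_succ_add, dist_eq_norm, add_sub_cancel_left, norm_mul, norm_emb_isU hw, mul_one, sl]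

/-! ### Nearest lattice points -/

/-- `pt z u k e` is a nearest lattice point of level `k` to `x`. -/
def Near (z u : ℂ) (k : ℕ) (e : Eis) (x : ℂ) : Prop :=
  ∀ f, dist x (pt z u k e) ≤ dist x (pt z u k f)

lemma convex_near (k : ℕ) (e : Eis) : Convex ℝ {x | Near z u k e x} := by
  have : {x | Near z u k e x} = ⋂ f, {x | dist x (pt z u k e) ≤ dist x (pt z u k f)} := by
    ext x; simp [Near]
  rw [this]
  exact convex_iInter fun f => convex_dist_le _ _

lemma near_self (k : ℕ) (e : Eis) : Near z u k e (pt z u k e) := fun f => by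
  rw [dist_self]; exact dist_nonneg

/-- The distance to `pt z u k e` is the minimal distance of the lattice of level `k + 1`, which
contains all points of level `k` but does not have this point among them. -/
lemma near_mid (k : ℕ) {e w : Eis} (hw : IsU w) :
    Near z u k e (pt z u (k + 1) (th e + w)) := fun f => by
  rw [dist_pt_mid k hw, ← pt_succ_th k f, dist_pt_succ]
  have h1 : th e + w - th f ≠ 0 := fun h => th_ne_th_add hw e f (sub_eq_zero.1 h).symm
  have h2 := one_le_norm_emb h1
  have h3 : 0 ≤ sl u k := norm_nonneg _
  nlinarith

/-- The minimal distance of the lattice is `sl u k * √3`, so by the triangle inequality every other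
point is at least half of this away. -/
lemma near_midpoint (k : ℕ) {e w : Eis} (hw : IsU w) :
    Near z u k e ((pt z u k e + pt z u k (e + w)) / 2) := fun f => by
  by_cases hf : f = e
  · rw [hf]
  have h0 : 0 ≤ sl u k := norm_nonneg _
  have h1 : dist (pt z u k e) (pt z u k (e + w)) = sl u k * √3 := by
    rw [dist_pt, sub_add_cancel_left, norm_emb_isU hw.neg, mul_one]
  have h2 : sl u k * √3 ≤ dist (pt z u k e) (pt z u k f) := by
    rw [dist_pt]
    have := one_le_norm_emb (sub_ne_zero.2 (Ne.symm hf))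
    nlinarith [mul_nonneg h0 (Real.sqrt_nonneg 3)]
  have h3 : dist ((pt z u k e + pt z u k (e + w)) / 2) (pt z u k e) = sl u k * √3 / 2 := by
    rw [← h1, dist_comm (pt z u k e), dist_eq_norm, dist_eq_norm]
    rw [show (pt z u k e + pt z u k (e + w)) / 2 - pt z u k e =
      (pt z u k (e + w) - pt z u k e) / 2 by ring, norm_div]
    simp
  have h4 := dist_triangle_left (pt z u k e) (pt z u k f) ((pt z u k e + pt z u k (e + w)) / 2)
  linarith

/-- The three squared distances, averaged with the barycentric weights `1 - a - b`, `a`, `b`, give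
`a * b + (a + b) * (1 - a - b)`, which is at most `1 / 3`. -/
lemma exists_round_triangle (a b : ℝ) (ha : 0 ≤ a) (hb : 0 ≤ b) (hab : a + b ≤ 1) :
    a ^ 2 + a * b + b ^ 2 ≤ 1 / 3 ∨ (a - 1) ^ 2 + (a - 1) * b + b ^ 2 ≤ 1 / 3 ∨
      a ^ 2 + a * (b - 1) + (b - 1) ^ 2 ≤ 1 / 3 := by
  by_contra! h
  obtain ⟨h1, h2, h3⟩ := h
  have e1 := mul_le_mul_of_nonneg_left h1.le (by linarith : 0 ≤ 1 - a - b)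
  have e2 := mul_le_mul_of_nonneg_left h2.le ha
  have e3 := mul_le_mul_of_nonneg_left h3.le hb
  have e4 : a * b + (a + b) * (1 - a - b) ≤ 1 / 3 := by
    nlinarith [sq_nonneg (a - b), sq_nonneg (a + b - 2 / 3)]
  -- A weight may vanish, so only weak inequalities survive the averaging; the equality case at the
  -- centroid is excluded separately.
  have e5 : a = 1 / 3 ∧ b = 1 / 3 := by
    have : (a + b - 2 / 3) ^ 2 ≤ 0 := by nlinarith [sq_nonneg (a - b)]
    have h6 : a + b - 2 / 3 = 0 := by nlinarith [sq_nonneg (a + b - 2 / 3)]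
    have h7 : (a - b) ^ 2 ≤ 0 := by nlinarith [sq_nonneg (a - b)]
    have h8 : a - b = 0 := by nlinarith [sq_nonneg (a - b)]
    constructor <;> linarith
  obtain ⟨rfl, rfl⟩ := e5
  norm_num at h1

/-- The fractional parts lie in one of two triangles of the unit cell, and a point reflection maps
the upper one to the lower. -/
lemma exists_round (a b : ℝ) :
    ∃ m n : ℤ, (a - m) ^ 2 + (a - m) * (b - n) + (b - n) ^ 2 ≤ 1 / 3 := by
  have ha := Int.self_sub_floor a
  have hb := Int.self_sub_floor b
  have ha0 := Int.fract_nonneg a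
  have hb0 := Int.fract_nonneg b
  have ha1 := (Int.fract_lt_one a).le
  have hb1 := (Int.fract_lt_one b).le
  rcases le_total (Int.fract a + Int.fract b) 1 with h | h
  · rcases exists_round_triangle _ _ ha0 hb0 h with h | h | h
    · exact ⟨⌊a⌋, ⌊b⌋, by rwa [ha, hb]⟩
    · refine ⟨⌊a⌋ + 1, ⌊b⌋, ?_⟩
      push_cast
      rwa [hb, ← sub_sub, ha]
    · refine ⟨⌊a⌋, ⌊b⌋ + 1, ?_⟩
      push_cast
      rwa [ha, ← sub_sub, hb]
  · rcases exists_round_triangle (1 - Int.fract a) (1 - Int.fract b) (by linarith) (by linarith)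
      (by linarith) with h | h | h
    · refine ⟨⌊a⌋ + 1, ⌊b⌋ + 1, ?_⟩
      push_cast
      rw [← sub_sub, ← sub_sub, ha, hb]; linarith
    · refine ⟨⌊a⌋, ⌊b⌋ + 1, ?_⟩
      push_cast
      rw [← sub_sub, ha, hb]; linarith
    · refine ⟨⌊a⌋ + 1, ⌊b⌋, ?_⟩
      push_cast
      rw [← sub_sub, ha, hb]; linarith

lemma exists_real_coords (w : ℂ) : ∃ a b : ℝ, w = a + b * zeta := by
  refine ⟨w.re - w.im / √3, 2 * w.im / √3, ?_⟩
  have h3 : √3 ≠ 0 := by positivity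
  apply Complex.ext
  · simp [zeta]; ring
  · simp [zeta]; field_simp

lemma normSq_real_coords (a b : ℝ) :
    Complex.normSq (a + b * zeta) = a ^ 2 + a * b + b ^ 2 := by
  have h3 : (√3 : ℝ) * √3 = 3 := Real.mul_self_sqrt (by norm_num)
  simp [zeta, Complex.normSq_apply]
  nlinarith

/-- Every point of the plane has coordinates with respect to each lattice. -/
lemma exists_eq_coords (hu : u ≠ 0) (k : ℕ) (x : ℂ) :
    ∃ w : ℂ, x = z + ev u k * (1 + zeta) * w := by
  refine ⟨(x - z) / (ev u k * (1 + zeta)), ?_⟩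
  have := ev_ne_zero hu k
  have := one_add_zeta_ne_zero
  field_simp; ring

lemma pt_eq (k : ℕ) (e : Eis) : pt z u k e = z + ev u k * (1 + zeta) * emb e := by
  simp only [pt, ev]; ring

/-- A triangular lattice of spacing `√3 * s` has covering radius `s`. -/
lemma exists_pt_close (hu : u ≠ 0) (k : ℕ) (x : ℂ) : ∃ e, dist x (pt z u k e) ≤ sl u k := by
  obtain ⟨w, rfl⟩ := exists_eq_coords (z := z) hu k x
  obtain ⟨a, b, rfl⟩ := exists_real_coords w
  obtain ⟨m, n, h⟩ := exists_round a b
  refine ⟨(m, n), ?_⟩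
  rw [pt_eq, dist_eq_norm, add_sub_add_left_eq_sub, ← mul_sub, norm_mul, norm_mul,
    norm_one_add_zeta]
  have h1 : (a + b * zeta - emb (m, n) : ℂ) = ((a - m : ℝ) : ℂ) + ((b - n : ℝ) : ℂ) * zeta := by
    simp [emb]; ring
  have h2 : ‖(a + b * zeta - emb (m, n) : ℂ)‖ ^ 2 ≤ 1 / 3 := by
    rw [← Complex.normSq_eq_norm_sq, h1, normSq_real_coords]; exact h
  have h3 : √3 * ‖(a + b * zeta - emb (m, n) : ℂ)‖ ≤ 1 := by
    have h3 : (√3 : ℝ) ^ 2 = 3 := Real.sq_sqrt (by norm_num)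
    have : (√3 * ‖(a + b * zeta - emb (m, n) : ℂ)‖) ^ 2 ≤ 1 ^ 2 := by
      rw [mul_pow, h3]; linarith
    exact (pow_le_pow_iff_left₀ (by positivity) zero_le_one two_ne_zero).1 this
  rw [mul_assoc]
  exact mul_le_of_le_one_right (norm_nonneg _) h3

/-- A disk contains a bounded number of Eisenstein integers. -/
lemma exists_lattice_count (C : ℝ) :
    ∃ n : ℕ, ∀ w : ℂ, {e : Eis | dist (emb e) w ≤ C}.Finite ∧
      {e : Eis | dist (emb e) w ≤ C}.ncard ≤ n := by
  refine ⟨(2 * (⌈4 * C⌉.toNat) + 1) ^ 2, fun w => ?_⟩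
  rcases Set.eq_empty_or_nonempty {e : Eis | dist (emb e) w ≤ C} with h | ⟨e₀, h₀⟩
  · rw [h]; simp
  set L : ℤ := ((⌈4 * C⌉.toNat : ℕ) : ℤ) with hL
  have hC : 0 ≤ C := dist_nonneg.trans h₀
  have hsub : {e : Eis | dist (emb e) w ≤ C} ⊆
      (Finset.Icc (e₀.1 - L) (e₀.1 + L) ×ˢ Finset.Icc (e₀.2 - L) (e₀.2 + L) : Finset Eis) := by
    intro e he
    have h1 : ‖emb (e - e₀)‖ ≤ 2 * C := by
      rw [emb_sub, ← dist_eq_norm]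
      have := dist_triangle_right (emb e) (emb e₀) w
      have h2 : dist (emb e) w ≤ C := he
      have h3 : dist (emb e₀) w ≤ C := h₀
      linarith
    have h2 : ‖emb (e - e₀)‖ ^ 2 ≤ (2 * C) ^ 2 := by gcongr
    rw [norm_emb_sq] at h2
    push_cast at h2
    have hLC : 4 * C ≤ L := by
      rw [hL]
      have h4 : (4 * C) ≤ (⌈4 * C⌉ : ℝ) := Int.le_ceil _
      have h5 : ⌈4 * C⌉ ≤ (⌈4 * C⌉.toNat : ℤ) := Int.self_le_toNat _
      have h6 : ((⌈4 * C⌉ : ℤ) : ℝ) ≤ ((⌈4 * C⌉.toNat : ℤ) : ℝ) := by exact_mod_cast h5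
      linarith
    set a : ℤ := (e - e₀).1 with ha
    set b : ℤ := (e - e₀).2 with hb
    have h7 : |(a : ℝ)| ≤ L := by
      apply abs_le_of_sq_le_sq _ (by linarith)
      nlinarith [sq_nonneg ((a : ℝ) + 2 * b)]
    have h8 : |(b : ℝ)| ≤ L := by
      apply abs_le_of_sq_le_sq _ (by linarith)
      nlinarith [sq_nonneg ((b : ℝ) + 2 * a)]
    rw [abs_le] at h7 h8
    have h7' : -L ≤ a ∧ a ≤ L := ⟨by exact_mod_cast h7.1, by exact_mod_cast h7.2⟩
    have h8' : -L ≤ b ∧ b ≤ L := ⟨by exact_mod_cast h8.1, by exact_mod_cast h8.2⟩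
    rw [Finset.mem_coe, Finset.mem_product, Finset.mem_Icc, Finset.mem_Icc]
    simp only [ha, hb, Prod.fst_sub, Prod.snd_sub] at h7' h8'
    omega
  refine ⟨(Finset.finite_toSet _).subset hsub, ?_⟩
  refine (Set.ncard_le_ncard hsub (Finset.finite_toSet _)).trans ?_
  rw [Set.ncard_coe_finset, Finset.card_product, Int.card_Icc, Int.card_Icc]
  have h1 : (e₀.1 + L + 1 - (e₀.1 - L)).toNat = 2 * ⌈4 * C⌉.toNat + 1 := by omega
  have h2 : (e₀.2 + L + 1 - (e₀.2 - L)).toNat = 2 * ⌈4 * C⌉.toNat + 1 := by omega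
  rw [h1, h2, pow_two]

/-- Every level is similar to the Eisenstein integers, so one bound serves all `z`, `u` and `k`. -/
lemma exists_level_count (C : ℝ) :
    ∃ n : ℕ, ∀ z u : ℂ, u ≠ 0 → ∀ (k : ℕ) (x : ℂ),
      {e : Eis | dist (pt z u k e) x ≤ C * sl u k}.Finite ∧
      {e : Eis | dist (pt z u k e) x ≤ C * sl u k}.ncard ≤ n := by
  obtain ⟨n, hn⟩ := exists_lattice_count C
  refine ⟨n, fun z u hu k x => ?_⟩
  obtain ⟨w, rfl⟩ := exists_eq_coords (z := z) hu k x
  have hsub : {e : Eis | dist (pt z u k e) (z + ev u k * (1 + zeta) * w) ≤ C * sl u k} ⊆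
      {e : Eis | dist (emb e) w ≤ C} := by
    intro e he
    have he : dist (pt z u k e) (z + ev u k * (1 + zeta) * w) ≤ C * sl u k := he
    rw [pt_eq, dist_eq_norm, add_sub_add_left_eq_sub, ← mul_sub, norm_mul, norm_mul,
      norm_one_add_zeta, ← sl, ← dist_eq_norm] at he
    have h1 := sl_pos hu k
    have h2 : √3 * dist (emb e) w ≤ C := by
      by_contra! h
      nlinarith
    have : 1 ≤ √3 := by linarith [sqrt_three_bounds.1]
    change dist (emb e) w ≤ C
    nlinarith [dist_nonneg (x := emb e) (y := w)]
  exact ⟨(hn w).1.subset hsub, (Set.ncard_le_ncard hsub (hn w).1).trans (hn w).2⟩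

lemma exists_near (hu : u ≠ 0) (k : ℕ) (x : ℂ) : ∃ e, Near z u k e x := by
  obtain ⟨e₀, h₀⟩ := exists_pt_close (z := z) hu k x
  obtain ⟨n, hn⟩ := exists_level_count 1
  obtain ⟨e, he, hmin⟩ := Set.exists_min_image _ (fun e => dist (pt z u k e) x) (hn z u hu k x).1
    ⟨e₀, by change dist _ _ ≤ _; rw [dist_comm]; linarith⟩
  have he : dist (pt z u k e) x ≤ 1 * sl u k := he
  refine ⟨e, fun f => ?_⟩
  rw [dist_comm x, dist_comm x]
  by_cases hf : dist (pt z u k f) x ≤ 1 * sl u k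
  · exact hmin f hf
  · push Not at hf; exact he.trans hf.le

lemma Near.dist_le (hu : u ≠ 0) {k : ℕ} {e : Eis} {x : ℂ} (h : Near z u k e x) :
    dist x (pt z u k e) ≤ sl u k := by
  obtain ⟨f, hf⟩ := exists_pt_close (z := z) hu k x
  exact (h f).trans hf

/-- Near a replaced point, all nearest lattice points of the previous level are replaced. -/
lemma Down.near_mem (hu : u ≠ 0) {D : Set (ℕ × Eis)} (hD : Down D) {j : ℕ} {w q : Eis} {x : ℂ}
    (hw : (j + 1, w) ∈ D) (hx : dist x (pt z u (j + 1) w) < 3 / 2 * sl u (j + 1))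
    (hq : Near z u j q x) : (j, q) ∈ D := by
  have hs := sl_pos hu (j + 1)
  have h1 := hq.dist_le hu
  obtain ⟨r1, r2⟩ := sqrt_three_bounds
  have h3 : (√3 : ℝ) * √3 = 3 := Real.mul_self_sqrt (by norm_num)
  have hd : dist (pt z u j q) (pt z u (j + 1) w) = sl u (j + 1) * √3 * ‖emb (th q - w)‖ := by
    rw [← pt_succ_th j, dist_pt]
  have htri := dist_triangle_left (pt z u j q) (pt z u (j + 1) w) x
  rw [sl_succ j] at h1
  have hn : √3 * ‖emb (th q - w)‖ < √3 + 3 / 2 := by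
    by_contra! h
    nlinarith
  have hn2 : ‖emb (th q - w)‖ < 19 / 10 := by nlinarith [norm_nonneg (emb (th q - w))]
  have hnorm : (th q - w).1 * (th q - w).1 + (th q - w).1 * (th q - w).2 +
      (th q - w).2 * (th q - w).2 < 4 := by
    have h4 := norm_emb_sq (th q - w)
    have h5 : ‖emb (th q - w)‖ ^ 2 < 4 := by nlinarith [norm_nonneg (emb (th q - w))]
    rw [h4] at h5
    exact_mod_cast h5
  -- If the point of `w` already occurs on level `j`, it competes with `q`. The nearest point `q` is
  -- then closer than `3 / 2 * sl u (j + 1)` too, which gives a total below `3 = √3 * √3` units.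
  have hdiv : (∃ w', th w' = w) → ‖emb (th q - w)‖ < √3 := by
    rintro ⟨w', rfl⟩
    have h6 := hq w'
    rw [← pt_succ_th j w'] at h6
    have h7 : √3 * ‖emb (th q - th w')‖ < 3 := by
      by_contra! h
      nlinarith
    by_contra! h
    nlinarith
  apply hD j w q hw
  set g := th q - w with hg
  have hb1 : -2 ≤ g.1 ∧ g.1 ≤ 2 := by
    constructor <;> nlinarith [sq_nonneg (g.1 + 2 * g.2)]
  have hb2 : -2 ≤ g.2 ∧ g.2 ≤ 2 := by
    constructor <;> nlinarith [sq_nonneg (2 * g.1 + g.2)]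
  -- Eisenstein norms below 4 are 0, 1 and 3, and elements of norm 3 are multiples of `1 + ζ`. In
  -- the last case `w` is such a multiple as well, and `hdiv` applies.
  have key : g = 0 ∨ IsU g ∨ (g.1 * g.1 + g.1 * g.2 + g.2 * g.2 = 3 ∧ ∃ h, th h = g) := by
    obtain ⟨a, b⟩ := g
    simp only at hb1 hb2 hnorm
    obtain ⟨hb1, hb1'⟩ := hb1
    obtain ⟨hb2, hb2'⟩ := hb2
    have h8 : (∃ h, th h = (a, b)) ↔ (b - a) % 3 = 0 := by
      constructor
      · rintro ⟨h, hh⟩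
        simp only [th, Prod.ext_iff] at hh; omega
      · intro h
        exact ⟨(a + (b - a) / 3, (b - a) / 3), by simp only [th, Prod.ext_iff]; omega⟩
    rw [h8]
    simp only [IsU, Prod.ext_iff, Prod.fst_zero, Prod.snd_zero]
    interval_cases a <;> interval_cases b <;> simp_all
  rcases key with h | h | ⟨h, f, hf⟩
  · exact Or.inl h
  · exact Or.inr h
  · exfalso
    have h9 := hdiv ⟨q - f, by
      rw [sub_eq_add_neg, th_add, th_neg, hf, hg]; abel⟩
    have h10 := norm_emb_sq g
    rw [h] at h10
    push_cast at h10
    nlinarith [norm_nonneg (emb g)]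

/-- The neighbourhood of a replaced point is replaced on all lower levels. -/
lemma Down.near_mem_lower (hu : u ≠ 0) {D : Set (ℕ × Eis)} (hD : Down D) {i n : ℕ} {w : Eis}
    {x : ℂ} (hw : (i + n + 1, w) ∈ D)
    (hx : dist x (pt z u (i + n + 1) w) < 3 / 2 * sl u (i + n + 1)) :
    ∀ q, Near z u i q x → (i, q) ∈ D := by
  induction n generalizing w with
  | zero => exact fun q hq => hD.near_mem hu hw hx hq
  | succ n ih =>
    intro q hq
    obtain ⟨q', hq'⟩ := exists_near (z := z) hu (i + n + 1) x
    have h1 := hD.near_mem hu hw hx hq'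
    -- The nearest point `q'` is within one edge length, less than the admitted `3 / 2`, so the
    -- hypothesis reproduces itself on the next lower level.
    refine ih h1 ?_ q hq
    have := hq'.dist_le hu
    linarith [sl_pos hu (i + n + 1)]

end

section

variable {z u : ℂ}

/-! ### The cells of the mesh of `D` in the plane -/

lemma pt_add_eq (k : ℕ) (e w : Eis) : pt z u k (e + w) =
    pt z u (k + 1) (th e + w) + pt z u (k + 1) (th e + rot w) - pt z u k e := by
  rw [pt_add, pt_succ_add, pt_succ_add, emb_rot]; ring

lemma pt_inner_eq (k : ℕ) (e w : Eis) : pt z u (k + 2) (th (th e) + rot w) =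
    (pt z u k e + pt z u (k + 1) (th e + w) + pt z u (k + 1) (th e + rot w)) / 3 := by
  rw [pt_succ_add, pt_succ_add, pt_succ_add, pt_succ_th, emb_rot, ev_succ k]
  linear_combination (-ev u (k + 1) * emb w / 3) * zeta_mul_zeta

lemma pt_inner_eq' (k : ℕ) (e w : Eis) : pt z u (k + 2) (th (th (e + w)) + rot (-w)) =
    (2 * pt z u (k + 1) (th e + w) + 2 * pt z u (k + 1) (th e + rot w) - pt z u k e) / 3 := by
  rw [pt_inner_eq, th_add_neg, th_add_rot_neg, pt_add_eq]; ring

/-- A point of a mesh cell of level `k` has a nearest lattice point of level `k` or `k + 1` that is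
not replaced. -/
lemma IsCell.exists_near_notMem {D : Set (ℕ × Eis)} (hD : Down D) {k : ℕ} {e w : Eis}
    (hc : IsCell D k e w) {x : ℂ} (hx : x ∈ (cellOf z u D k e w).region) :
    (∃ q, Near z u k q x ∧ (k, q) ∉ D) ∨ ∃ q, Near z u (k + 1) q x ∧ (k + 1, q) ∉ D := by
  wlog he : (k, e) ∉ D generalizing e w
  · refine this hc.symm (by rwa [cellOf_symm]) fun h => hc.2.2 ⟨not_not.1 he, h⟩
  have hw := hc.1
  obtain ⟨α, β, γ, δ, hα, hβ, hγ, hδ, hsum, hx⟩ := exists_comb_four hx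
  rw [tip_eq_of_notMem he] at hx
  have n1 : Near z u k e (pt z u (k + 1) (th e + w)) := near_mid k hw
  have n2 : Near z u k e (pt z u (k + 1) (th e + rot w)) := near_mid k hw.rot
  by_cases hew : (k, e + w) ∈ D
  · rw [tip_eq_of_mem hew, pt_inner_eq'] at hx
    -- The diagonal through the middle corners cuts the kite into a triangle at `e`, where `e` is
    -- nearest, and a flat one, where a middle corner is nearest on level `k + 1`. The middle
    -- corners are not replaced because `e` precedes both.
    rcases le_or_gt γ (3 * α) with h | h
    · left
      refine ⟨e, ?_, he⟩
      refine Convex.comb_three (convex_near k e) (near_self k e) n1 n2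
        (α := α - γ / 3) (β := β + 2 * γ / 3) (γ := δ + 2 * γ / 3)
        (by linarith) (by positivity) (by positivity) (by linarith) ?_
      rw [hx]; push_cast; ring
    · right
      have hrr : th e + w + rot (rot w) = th e + rot w := by rw [rot_rot]; abel
      have hrr' : th e + rot w + -rot (rot w) = th e + w := by rw [rot_rot]; abel
      have m1 : Near z u (k + 1) (th e + w)
          ((pt z u (k + 1) (th e + w) + pt z u (k + 1) (th e + rot w)) / 2) := by
        have := near_midpoint (z := z) (u := u) (k + 1) (e := th e + w) hw.rot.rot
        rwa [hrr] at this
      have m2 : Near z u (k + 1) (th e + rot w)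
          ((pt z u (k + 1) (th e + w) + pt z u (k + 1) (th e + rot w)) / 2) := by
        have := near_midpoint (z := z) (u := u) (k + 1) (e := th e + rot w) hw.rot.rot.neg
        rwa [hrr', add_comm (pt z u (k + 1) (th e + rot w))] at this
      have c1 : Near z u (k + 1) (th e + w) (pt z u (k + 2) (th (th (e + w)) + rot (-w))) := by
        have : th (th (e + w)) + rot (-w) = th (th e + w) + rot (rot w) := by
          ext <;> simp only [th, rot, Prod.fst_add, Prod.snd_add, Prod.fst_neg, Prod.snd_neg] <;>
          ring
        rw [this]
        exact near_mid (k + 1) hw.rot.rot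
      have c2 : Near z u (k + 1) (th e + rot w) (pt z u (k + 2) (th (th (e + w)) + rot (-w))) := by
        have : th (th (e + w)) + rot (-w) = th (th e + rot w) + w := by
          ext <;> simp only [th, rot, Prod.fst_add, Prod.snd_add, Prod.fst_neg, Prod.snd_neg] <;>
          ring
        rw [this]
        exact near_mid (k + 1) hw
      rcases le_total (δ + 2 * α) (β + 2 * α) with h' | h'
      · refine ⟨th e + w, ?_, notMem_of_pre hD he (pre_th_add hw)⟩
        refine Convex.comb_three (convex_near (k + 1) (th e + w)) c1 (near_self _ _) m1
          (α := γ - 3 * α) (β := β - δ) (γ := 2 * (δ + 2 * α))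
          (by linarith) (by linarith) (by positivity) (by linarith) ?_
        rw [hx, pt_inner_eq']; push_cast; ring
      · refine ⟨th e + rot w, ?_, notMem_of_pre hD he (pre_th_add hw.rot)⟩
        refine Convex.comb_three (convex_near (k + 1) (th e + rot w)) c2 (near_self _ _) m2
          (α := γ - 3 * α) (β := δ - β) (γ := 2 * (β + 2 * α))
          (by linarith) (by linarith) (by positivity) (by linarith) ?_
        rw [hx, pt_inner_eq']; push_cast; ring
  · left
    rw [tip_eq_of_notMem hew] at hx
    rcases le_total γ α with h | h
    · refine ⟨e, ?_, he⟩
      refine Convex.comb_three (convex_near k e) (near_self k e) n1 n2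
        (α := α - γ) (β := β + γ) (γ := δ + γ)
        (by linarith) (by positivity) (by positivity) (by linarith) ?_
      rw [hx, pt_add_eq k e w]; push_cast; ring
    · refine ⟨e + w, ?_, hew⟩
      have n3 : Near z u k (e + w) (pt z u (k + 1) (th e + w)) := by
        rw [← th_add_rot_neg]; exact near_mid k hw.neg.rot
      have n4 : Near z u k (e + w) (pt z u (k + 1) (th e + rot w)) := by
        rw [← th_add_neg]; exact near_mid k hw.neg
      refine Convex.comb_three (convex_near k (e + w)) (near_self k (e + w)) n3 n4
        (α := γ - α) (β := β + α) (γ := δ + α)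
        (by linarith) (by positivity) (by positivity) (by linarith) ?_
      rw [hx, pt_add_eq k e w]; push_cast; ring

/-- The full rhombus of level `k` on the lattice edge from `e` to `e + w`. -/
def rhombus (z u : ℂ) (k : ℕ) (e w : Eis) : Set ℂ :=
  convexHull ℝ {pt z u k e, pt z u (k + 1) (th e + w), pt z u k (e + w),
    pt z u (k + 1) (th e + rot w)}

lemma rhombus_symm (k : ℕ) (e w : Eis) : rhombus z u k (e + w) (-w) = rhombus z u k e w := by
  unfold rhombus
  rw [th_add_neg, th_add_rot_neg, add_neg_cancel_right]
  congr 1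
  ext x; simp only [Set.mem_insert_iff, Set.mem_singleton_iff]; tauto

lemma mem_hull_one (a b c d : ℂ) : a ∈ convexHull ℝ {a, b, c, d} := subset_convexHull _ _ (by simp)
lemma mem_hull_two (a b c d : ℂ) : b ∈ convexHull ℝ {a, b, c, d} := subset_convexHull _ _ (by simp)
lemma mem_hull_three (a b c d : ℂ) : c ∈ convexHull ℝ {a, b, c, d} :=
  subset_convexHull _ _ (by simp)
lemma mem_hull_four (a b c d : ℂ) : d ∈ convexHull ℝ {a, b, c, d} :=
  subset_convexHull _ _ (by simp)

/-- A rhombus of level `k` at a point splits into parts of two rhombi of level `k + 1` at this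
point and the remaining kite. -/
lemma mem_rhombus_succ_or {k : ℕ} {e w : Eis} {x : ℂ} {s t : ℝ} (hs : 0 ≤ s) (ht : 0 ≤ t)
    (hx : x = pt z u k e + s * (pt z u (k + 1) (th e + w) - pt z u k e)
      + t * (pt z u (k + 1) (th e + rot w) - pt z u k e)) :
    (x ∈ rhombus z u (k + 1) (th e) w ∨ x ∈ rhombus z u (k + 1) (th e) (rot w)) ∨
      (1 ≤ s + 2 * t ∧ 1 ≤ 2 * s + t) := by
  rcases le_total t s with h | h
  · rcases le_total 1 (s + 2 * t) with h1 | h1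
    · right; exact ⟨h1, by linarith⟩
    · left; left
      refine Convex.comb_three (convex_convexHull ℝ _) (mem_hull_one _ _ _ _)
        (mem_hull_three _ _ _ _) (mem_hull_four _ _ _ _)
        (α := 1 - s - 2 * t) (β := s - t) (γ := 3 * t)
        (by linarith) (by linarith) (by positivity) (by ring) ?_
      rw [pt_inner_eq, pt_succ_th, hx]; push_cast; ring
  · rcases le_total 1 (2 * s + t) with h1 | h1
    · right; exact ⟨by linarith, h1⟩
    · left; right
      refine Convex.comb_three (convex_convexHull ℝ _) (mem_hull_one _ _ _ _)
        (mem_hull_three _ _ _ _) (mem_hull_two _ _ _ _)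
        (α := 1 - t - 2 * s) (β := t - s) (γ := 3 * s)
        (by linarith) (by linarith) (by positivity) (by ring) ?_
      rw [pt_inner_eq, pt_succ_th, hx]; push_cast; ring

lemma active_succ_of_mem {D : Set (ℕ × Eis)} {k : ℕ} {e : Eis} (he : (k, e) ∈ D) (w : Eis) :
    Active D (k + 1) (th e) w := by
  intro f h1 _
  rwa [pre_th_iff.1 h1]

/-- Active rhombi are covered by the mesh. -/
lemma exists_cell_of_mem_rhombus {D : Set (ℕ × Eis)} {N : ℕ}
    (hN : ∀ n ∈ D, n.1 < N) (n : ℕ) {k : ℕ} (hn : N ≤ k + n) {e w : Eis} (hw : IsU w)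
    (hact : Active D k e w) {x : ℂ} (hx : x ∈ rhombus z u k e w) :
    ∃ j f v, IsCell D j f v ∧ x ∈ (cellOf z u D j f v).region := by
  -- `n` bounds the number of levels left below `N`. From level `N` on nothing is replaced and every
  -- active rhombus is itself a cell.
  induction n generalizing k e w with
  | zero =>
    have h0 : ∀ e, (k, e) ∉ D := fun e he => by have := hN _ he; simp at this; omega
    refine ⟨k, e, w, ⟨hw, hact, fun h => h0 _ h.1⟩, ?_⟩
    change x ∈ convexHull ℝ _
    rwa [tip_eq_of_notMem (h0 _), tip_eq_of_notMem (h0 _)]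
  | succ n ih =>
    have ih' : ∀ {e w}, IsU w → Active D (k + 1) e w → x ∈ rhombus z u (k + 1) e w →
        ∃ j f v, IsCell D j f v ∧ x ∈ (cellOf z u D j f v).region :=
      fun hw ha hx => ih (by omega) hw ha hx
    by_contra hcon
    -- barycentric conditions off the inner rhombi around a replaced end of the edge
    have hout : ∀ e w, IsU w → (k, e) ∈ D → ∀ s t : ℝ, 0 ≤ s → 0 ≤ t →
        x = pt z u k e + s * (pt z u (k + 1) (th e + w) - pt z u k e)
          + t * (pt z u (k + 1) (th e + rot w) - pt z u k e) →
        1 ≤ s + 2 * t ∧ 1 ≤ 2 * s + t := by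
      intro e w hw he s t hs ht hx
      rcases mem_rhombus_succ_or hs ht hx with (h | h) | h
      · exact (hcon (ih' hw (active_succ_of_mem he w) h)).elim
      · exact (hcon (ih' hw.rot (active_succ_of_mem he _) h)).elim
      · exact h
    have hcoord : ∀ e w, x ∈ rhombus z u k e w → ∃ s t : ℝ, 0 ≤ s ∧ 0 ≤ t ∧ s ≤ 1 ∧ t ≤ 1 ∧
        x = pt z u k e + s * (pt z u (k + 1) (th e + w) - pt z u k e)
          + t * (pt z u (k + 1) (th e + rot w) - pt z u k e) := by
      intro e w hx
      obtain ⟨α, β, γ, δ, hα, hβ, hγ, hδ, hsum, hx⟩ := exists_comb_four hx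
      refine ⟨β + γ, δ + γ, by positivity, by positivity, by linarith, by linarith, ?_⟩
      rw [hx, pt_add_eq k e w, show α = 1 - β - γ - δ by linarith]; push_cast; ring
    have hone : ∀ e w, IsU w → Active D k e w → x ∈ rhombus z u k e w → (k, e) ∈ D →
        (k, e + w) ∉ D → False := by
      intro e w hw hact hx he hew
      obtain ⟨s, t, hs, ht, hs1, ht1, hxs⟩ := hcoord e w hx
      obtain ⟨h1, h2⟩ := hout e w hw he s t hs ht hxs
      refine hcon ⟨k, e, w, ⟨hw, hact, fun h => hew h.2⟩, ?_⟩
      change x ∈ convexHull ℝ _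
      rw [tip_eq_of_mem he, tip_eq_of_notMem hew]
      rcases le_total t s with h | h
      · refine Convex.comb_three (convex_convexHull ℝ _) (mem_hull_one _ _ _ _)
          (mem_hull_two _ _ _ _) (mem_hull_three _ _ _ _)
          (α := 3 * (1 - s) / 2) (β := s - t) (γ := t - (1 - s) / 2)
          (by linarith) (by linarith) (by linarith) (by ring) ?_
        rw [hxs, pt_inner_eq, pt_add_eq k e w]; push_cast; ring
      · refine Convex.comb_three (convex_convexHull ℝ _) (mem_hull_one _ _ _ _)
          (mem_hull_four _ _ _ _) (mem_hull_three _ _ _ _)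
          (α := 3 * (1 - t) / 2) (β := t - s) (γ := s - (1 - t) / 2)
          (by linarith) (by linarith) (by linarith) (by ring) ?_
        rw [hxs, pt_inner_eq, pt_add_eq k e w]; push_cast; ring
    by_cases he : (k, e) ∈ D <;> by_cases hew : (k, e + w) ∈ D
    -- Both ends replaced: outside the inner rhombi at the two ends there remains the rhombus of
    -- level `k + 1` over the short diagonal. It is active because its common predecessors are
    -- exactly these two ends.
    · obtain ⟨s, t, hs, ht, hs1, ht1, hxs⟩ := hcoord e w hx
      obtain ⟨h1, h2⟩ := hout e w hw he s t hs ht hxs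
      obtain ⟨h3, h4⟩ := hout (e + w) (-w) hw.neg hew (1 - s) (1 - t) (by linarith) (by linarith)
        (by rw [th_add_neg, th_add_rot_neg, pt_add_eq k e w, hxs]; push_cast; ring)
      have hrr : th e + w + rot (rot w) = th e + rot w := by rw [rot_rot]; abel
      refine hcon (ih' (e := th e + w) hw.rot.rot ?_ ?_)
      · intro f g1 g2
        rw [hrr] at g2
        rcases common_pre_side hw g1 g2 with rfl | rfl <;> assumption
      · have e1 : th (th e + w) + rot (rot w) = th (th (e + w)) + rot (-w) := by
          ext <;> simp only [th, rot, Prod.fst_add, Prod.snd_add, Prod.fst_neg, Prod.snd_neg] <;>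
          ring
        have e2 : th (th e + w) + rot (rot (rot w)) = th (th e) + rot w := by
          ext <;> simp only [th, rot, Prod.fst_add, Prod.snd_add] <;> ring
        unfold rhombus
        rw [hrr, e1, e2]
        rcases le_total t s with h | h
        · refine Convex.comb_three (convex_convexHull ℝ _) (mem_hull_one _ _ _ _)
            (mem_hull_two _ _ _ _) (mem_hull_four _ _ _ _)
            (α := s - t) (β := 2 * t + s - 1) (γ := 2 - 2 * s - t)
            (by linarith) (by linarith) (by linarith) (by ring) ?_
          rw [hxs, pt_inner_eq k e w, pt_inner_eq']; push_cast; ring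
        · refine Convex.comb_three (convex_convexHull ℝ _) (mem_hull_three _ _ _ _)
            (mem_hull_two _ _ _ _) (mem_hull_four _ _ _ _)
            (α := t - s) (β := 2 * s + t - 1) (γ := 2 - 2 * t - s)
            (by linarith) (by linarith) (by linarith) (by ring) ?_
          rw [hxs, pt_inner_eq k e w, pt_inner_eq']; push_cast; ring
    · exact hone e w hw hact hx he hew
    · exact hone (e + w) (-w) hw.neg hact.symm (by rwa [rhombus_symm]) hew (by simpa using he)
    · refine hcon ⟨k, e, w, ⟨hw, hact, fun h => he h.1⟩, ?_⟩
      change x ∈ convexHull ℝ _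
      rwa [tip_eq_of_notMem he, tip_eq_of_notMem hew]

/-- The rhombi of level zero cover the plane. -/
lemma exists_rhombus_zero (hu : u ≠ 0) (x : ℂ) : ∃ e w, IsU w ∧ x ∈ rhombus z u 0 e w := by
  have htri : ∀ g w, IsU w → ∀ α β γ : ℝ, 0 ≤ α → 0 ≤ β → 0 ≤ γ → α + β + γ = 1 →
      x = α * pt z u 1 g + β * pt z u 1 (g + w) + γ * pt z u 1 (g + rot w) →
      ∃ e w, IsU w ∧ x ∈ rhombus z u 0 e w := by
    intro g w hw α β γ hα hβ hγ hsum hx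
    have key : ∀ e v, IsU v → ∀ α β γ : ℝ, 0 ≤ α → 0 ≤ β → 0 ≤ γ → α + β + γ = 1 →
        x = α * pt z u 1 (th e) + β * pt z u 1 (th e + v) + γ * pt z u 1 (th e + rot v) →
        ∃ e w, IsU w ∧ x ∈ rhombus z u 0 e w := by
      intro e v hv α β γ hα hβ hγ hsum hx
      refine ⟨e, v, hv, ?_⟩
      refine Convex.comb_three (convex_convexHull ℝ _) (mem_hull_one _ _ _ _)
            (mem_hull_two _ _ _ _) (mem_hull_four _ _ _ _) hα hβ hγ hsum ?_
      rw [hx, pt_succ_th]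
    have hdiv : ∀ a b : ℤ, (b - a) % 3 = 0 → ∃ e, th e = (a, b) := fun a b h =>
      ⟨(a + (b - a) / 3, (b - a) / 3), by simp only [th, Prod.ext_iff]; omega⟩
    -- Exactly one corner of a triangle of level one is a point of level zero. Seen from that
    -- corner, the triangle is half of a rhombus of level zero.
    by_cases h0 : (g.2 - g.1) % 3 = 0
    · obtain ⟨e, he⟩ := hdiv _ _ h0
      exact key e w hw α β γ hα hβ hγ hsum (by rw [he]; exact hx)
    by_cases h1 : ((g + w).2 - (g + w).1) % 3 = 0
    · obtain ⟨e, he⟩ := hdiv _ _ h1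
      refine key e (rot (rot w)) hw.rot.rot β γ α hβ hγ hα (by linarith) ?_
      rw [he]
      change x = β * pt z u 1 (g + w) + γ * pt z u 1 (g + w + rot (rot w)) +
        α * pt z u 1 (g + w + rot (rot (rot w)))
      have e1 : g + w + rot (rot w) = g + rot w := by rw [rot_rot]; abel
      have e2 : g + w + rot (rot (rot w)) = g := by
        ext <;> simp only [rot, Prod.fst_add, Prod.snd_add] <;> ring
      rw [e1, e2, hx]; ring
    · have h2 : ((g + rot w).2 - (g + rot w).1) % 3 = 0 := by
        simp only [IsU, rot, Prod.fst_add, Prod.snd_add] at hw h0 h1 ⊢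
        omega
      obtain ⟨e, he⟩ := hdiv _ _ h2
      refine key e (-rot w) hw.rot.neg γ α β hγ hα hβ (by linarith) ?_
      rw [he]
      change x = γ * pt z u 1 (g + rot w) + α * pt z u 1 (g + rot w + -rot w) +
        β * pt z u 1 (g + rot w + rot (-rot w))
      have e1 : g + rot w + -rot w = g := by abel
      have e2 : g + rot w + rot (-rot w) = g + w := by rw [rot_neg, rot_rot]; abel
      rw [e1, e2, hx]; ring
  obtain ⟨w, hw⟩ := exists_eq_coords (z := z) hu 1 x
  obtain ⟨a, b, rfl⟩ := exists_real_coords w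
  have ha : (a : ℂ) = ⌊a⌋ + (Int.fract a : ℝ) := by
    have := Int.floor_add_fract a
    exact_mod_cast this.symm
  have hb : (b : ℂ) = ⌊b⌋ + (Int.fract b : ℝ) := by
    have := Int.floor_add_fract b
    exact_mod_cast this.symm
  have ha0 := Int.fract_nonneg a
  have hb0 := Int.fract_nonneg b
  have ha1 := (Int.fract_lt_one a).le
  have hb1 := (Int.fract_lt_one b).le
  rw [ha, hb] at hw
  rcases le_total (Int.fract a + Int.fract b) 1 with h | h
  · refine htri (⌊a⌋, ⌊b⌋) (1, 0) (by simp [IsU]) (1 - Int.fract a - Int.fract b) (Int.fract a)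
      (Int.fract b) (by linarith) ha0 hb0 (by ring) ?_
    rw [hw]
    simp only [pt_eq, emb, rot, Prod.mk_add_mk]
    push_cast; ring
  · refine htri (⌊a⌋ + 1, ⌊b⌋ + 1) (-1, 0) (by simp [IsU]) (Int.fract a + Int.fract b - 1)
      (1 - Int.fract a) (1 - Int.fract b) (by linarith) (by linarith) (by linarith) (by ring) ?_
    rw [hw]
    simp only [pt_eq, emb, rot, Prod.mk_add_mk]
    push_cast; ring

/-- The mesh of `D` covers the plane. -/
lemma exists_cell_mem (hu : u ≠ 0) {D : Set (ℕ × Eis)} (hfin : D.Finite) (x : ℂ) :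
    ∃ j f v, IsCell D j f v ∧ x ∈ (cellOf z u D j f v).region := by
  obtain ⟨N, hN⟩ : ∃ N, ∀ n ∈ D, n.1 < N := by
    obtain ⟨B, hB⟩ := (hfin.image Prod.fst).bddAbove
    exact ⟨B + 1, fun n hn => Nat.lt_succ_of_le (hB ⟨n, hn, rfl⟩)⟩
  obtain ⟨e, w, hw, hx⟩ := exists_rhombus_zero (z := z) hu x
  exact exists_cell_of_mem_rhombus hN N (k := 0) (by omega) hw trivial hx

lemma convexHull_four_subset {S : Set ℂ} (hS : Convex ℝ S) {a b c d : ℂ} (ha : a ∈ S) (hb : b ∈ S)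
    (hc : c ∈ S) (hd : d ∈ S) : convexHull ℝ {a, b, c, d} ⊆ S := by
  refine convexHull_min ?_ hS
  rintro x (rfl | rfl | rfl | rfl) <;> assumption

/-- The cell lies in every convex set that contains the full rhombus. -/
lemma cellOf_region_subset {D : Set (ℕ × Eis)} {k : ℕ} {e w : Eis} :
    (cellOf z u D k e w).region ⊆ rhombus z u k e w := by
  have h1 : pt z u k e ∈ rhombus z u k e w := mem_hull_one _ _ _ _
  have h2 : pt z u (k + 1) (th e + w) ∈ rhombus z u k e w := mem_hull_two _ _ _ _
  have h3 : pt z u k (e + w) ∈ rhombus z u k e w := mem_hull_three _ _ _ _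
  have h4 : pt z u (k + 1) (th e + rot w) ∈ rhombus z u k e w := mem_hull_four _ _ _ _
  refine convexHull_four_subset (convex_convexHull ℝ _) ?_ h2 ?_ h4
  · unfold tip
    split_ifs
    · refine Convex.comb_three (convex_convexHull ℝ _) h1 h2 h4 (α := 1 / 3) (β := 1 / 3)
        (γ := 1 / 3) (by norm_num) (by norm_num) (by norm_num) (by norm_num) ?_
      rw [pt_inner_eq]; push_cast; ring
    · exact h1
  · unfold tip
    split_ifs
    · refine Convex.comb_three (convex_convexHull ℝ _) h3 h2 h4 (α := 1 / 3) (β := 1 / 3)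
        (γ := 1 / 3) (by norm_num) (by norm_num) (by norm_num) (by norm_num) ?_
      rw [pt_inner_eq, th_add_neg, th_add_rot_neg]; push_cast; ring
    · exact h3

lemma dist_le_of_mem_rhombus {k : ℕ} {e w : Eis} (hw : IsU w) {x : ℂ}
    (hx : x ∈ rhombus z u k e w) : dist x (pt z u k e) ≤ 2 * sl u k := by
  have h0 : 0 ≤ sl u k := norm_nonneg _
  have hsub : rhombus z u k e w ⊆ Metric.closedBall (pt z u k e) (2 * sl u k) := by
    refine convexHull_four_subset (convex_closedBall _ _) ?_ ?_ ?_ ?_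
    · exact Metric.mem_closedBall_self (by positivity)
    · rw [Metric.mem_closedBall, dist_pt_mid k hw]; linarith
    · rw [Metric.mem_closedBall, dist_pt, add_sub_cancel_left, norm_emb_isU hw]
      nlinarith [sqrt_three_bounds.2]
    · rw [Metric.mem_closedBall, dist_pt_mid k hw.rot]; linarith
  exact hsub hx

lemma edgeLength_mk (a b : ℂ) : edgeLength s(a, b) = dist a b := rfl

/-- The sides of a cell of level `k` have length `sl u k` or `sl u (k + 1)`. -/
lemma edgeLength_side {D : Set (ℕ × Eis)} {k : ℕ} {e w : Eis} (hc : IsCell D k e w) {x : Sym2 ℂ}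
    (hx : x ∈ (cellOf z u D k e w).sides) :
    edgeLength x = sl u k ∨ edgeLength x = sl u (k + 1) := by
  obtain ⟨e, w, hc, hx⟩ := side_rep hc hx
  have hw := hc.1
  by_cases he : (k, e) ∈ D
  · right
    rw [tip_eq_of_mem he] at hx
    rcases hx with rfl | rfl
    · rw [th_th_add_rot]
      exact dist_pt_mid (k + 1) hw.neg
    · rw [th_th_add_rot']
      exact dist_pt_mid (k + 1) hw.rot.rot.neg
  · left
    rw [tip_eq_of_notMem he] at hx
    rcases hx with rfl | rfl
    · rw [edgeLength_mk, dist_comm]; exact dist_pt_mid k hw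
    · rw [edgeLength_mk, dist_comm]; exact dist_pt_mid k hw.rot

lemma pt_eq_two (k : ℕ) (e : Eis) : pt z u (k + 2) (th (th e)) = pt z u k e := by
  rw [pt_succ_th (k + 1), pt_succ_th]

/-- Near an active rhombus there is a replaced point of the previous level. -/
lemma exists_mem_of_active (hu : u ≠ 0) {D : Set (ℕ × Eis)} {k : ℕ} {e w : Eis} (hw : IsU w)
    (hact : Active D (k + 1) e w) :
    ∃ q, (k, q) ∈ D ∧ ∀ x ∈ rhombus z u (k + 1) e w,
      dist x (pt z u k q) < 3 / 2 * sl u k := by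
  obtain ⟨q, h1, h2⟩ := exists_common_pre e hw
  refine ⟨q, hact q h1 h2, fun x hx => ?_⟩
  have hs := sl_pos hu (k + 1)
  -- All corners lie within `2 * sl u (k + 1)` of the common predecessor; since `2 / √3 < 3 / 2`,
  -- this is inside the radius that `Down.near_mem` admits.
  have hlen : 2 * sl u (k + 1) < 3 / 2 * sl u k := by
    rw [sl_succ k]; nlinarith [sqrt_three_bounds.1]
  have hpre : ∀ e, Pre e q → dist (pt z u (k + 1) e) (pt z u k q) ≤ 2 * sl u (k + 1) := by
    intro e he
    rw [← pt_succ_th k q, dist_comm, dist_pt]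
    rcases he with h | h
    · rw [h]; simp [emb]; positivity
    · rw [norm_emb_isU h]; nlinarith [sqrt_three_bounds.2]
  have hmid : ∀ v, IsU v → (v = w ∨ v = rot w) →
      dist (pt z u (k + 2) (th e + v)) (pt z u k q) ≤ 2 * sl u (k + 1) := by
    intro v hv hvw
    rw [← pt_eq_two k q, dist_pt_succ (k + 1)]
    have h3 := norm_emb_sq (th e + v - th (th q))
    have h4 : ‖emb (th e + v - th (th q))‖ ^ 2 ≤ 2 ^ 2 := by
      rw [h3]
      norm_cast
      have h5 : ∃ g, g = th q - e := ⟨_, rfl⟩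
      obtain ⟨g, hg⟩ := h5
      have h6 : th e + v - th (th q) = v + -th g := by
        rw [hg, sub_eq_add_neg (th q), th_add, th_neg]; abel
      have h7 : th q - (e + w) = g - w := by rw [hg]; abel
      unfold Pre at h1 h2
      rw [← hg] at h1
      rw [h7] at h2
      rw [h6]
      obtain ⟨a, b⟩ := g
      obtain ⟨c, d⟩ := w
      simp only [IsU, Prod.ext_iff, Prod.fst_zero, Prod.snd_zero, Prod.fst_sub, Prod.snd_sub]
        at h1 h2 hw
      rcases hvw with rfl | rfl <;>
      simp only [th, rot, Prod.fst_add, Prod.snd_add, Prod.fst_neg, Prod.snd_neg] <;>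
      rcases hw with ⟨rfl, rfl⟩ | ⟨rfl, rfl⟩ | ⟨rfl, rfl⟩ | ⟨rfl, rfl⟩ | ⟨rfl, rfl⟩ | ⟨rfl, rfl⟩ <;>
      rcases h1 with ⟨rfl, rfl⟩ | ⟨rfl, rfl⟩ | ⟨rfl, rfl⟩ | ⟨rfl, rfl⟩ | ⟨rfl, rfl⟩ | ⟨rfl, rfl⟩ |
        ⟨rfl, rfl⟩ <;>
      first
        | (norm_num; done)
        | (exfalso; omega)
    have h8 : ‖emb (th e + v - th (th q))‖ ≤ 2 :=
      (pow_le_pow_iff_left₀ (norm_nonneg _) (by norm_num) two_ne_zero).1 h4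
    nlinarith
  have hsub : rhombus z u (k + 1) e w ⊆ Metric.closedBall (pt z u k q) (2 * sl u (k + 1)) :=
    convexHull_four_subset (convex_closedBall _ _) (hpre e h1) (hmid w hw (Or.inl rfl))
      (hpre _ h2) (hmid _ hw.rot (Or.inr rfl))
  exact lt_of_le_of_lt (hsub hx) hlen

end

section

variable {z u : ℂ}

/-! ### Local feature size -/

lemma localFeatureSize_le {Ω : Set ℂ} {σ : ℂ → ℝ} (hσ : ∀ p ∈ Ω, 0 < σ p) (p : ℂ) {q : ℂ}
    (hq : q ∈ Ω) : localFeatureSize Ω σ p ≤ dist p q + σ q := by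
  refine ciInf_le (f := fun q : Ω => dist p q + σ q) ⟨0, ?_⟩ ⟨q, hq⟩
  rintro _ ⟨r, rfl⟩
  exact add_nonneg dist_nonneg (hσ r r.2).le

lemma le_localFeatureSize {Ω : Set ℂ} {σ : ℂ → ℝ} (hne : Ω.Nonempty) {p : ℂ} {c : ℝ}
    (h : ∀ q ∈ Ω, c ≤ dist p q + σ q) : c ≤ localFeatureSize Ω σ p := by
  have := hne.to_subtype
  exact le_ciInf fun q => h q q.2

/-- An infimum of functions with Lipschitz constant 1 in `p`. -/
lemma localFeatureSize_le_add {Ω : Set ℂ} {σ : ℂ → ℝ} (hσ : ∀ p ∈ Ω, 0 < σ p) (hne : Ω.Nonempty)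
    (p q : ℂ) : localFeatureSize Ω σ p ≤ localFeatureSize Ω σ q + dist p q := by
  rw [← sub_le_iff_le_add]
  refine le_localFeatureSize hne fun r hr => ?_
  have h1 := localFeatureSize_le hσ p hr
  have h2 := dist_triangle p q r
  linarith

/-! ### The cells of a diamond-kite mesh compared to the local feature size -/

/-- The cells of a mesh that obeys `σ` are not larger than the local feature size. -/
lemma IsCell.sl_le (hu : u ≠ 0) {D : Set (ℕ × Eis)} (hfin : D.Finite) (hD : Down D) {Ω : Set ℂ}
    {σ : ℂ → ℝ} (hσ : ∀ p ∈ Ω, 0 < σ p) (hob : ObeysSize Ω σ (mesh z u D)) {k : ℕ} {e w : Eis}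
    (hc : IsCell D k e w) {x y : ℂ} (hx : x ∈ (cellOf z u D k e w).region) (hy : y ∈ Ω) :
    sl u k ≤ 9 * (dist x y + σ y) := by
  by_contra! hlt
  have h2 := sl_two (u := u) k
  have h4 := sl_two (u := u) (k + 2)
  have hs := sl_pos hu k
  obtain ⟨j, f, v, hc', hy'⟩ := exists_cell_mem (z := z) hu hfin y
  have hside : s(tip z u D j f v, pt z u (j + 1) (th f + v)) ∈ (cellOf z u D j f v).sides :=
    mem_sides_convexQuad.2 (Or.inl rfl)
  have hlen := hob _ ⟨j, f, v, hc', rfl⟩ y ⟨hy', hy⟩ _ hside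
  have hj1 : sl u (j + 1) ≤ σ y := by
    rcases edgeLength_side hc' hside with h | h <;> rw [h] at hlen
    · exact (sl_antitone hu (Nat.le_succ j)).trans hlen
    · exact hlen
  have hdn : 0 ≤ dist x y := dist_nonneg
  -- `sl u (k + 4)` is `sl u k / 9`: this is the factor 9 of the statement, and the cell at `y` is
  -- several levels finer than the one at `x`.
  have hjk : k + 4 < j + 1 := by
    by_contra! h
    have h5 := sl_antitone hu h
    rw [show k + 4 = k + 2 + 2 by rfl] at h5
    linarith
  obtain ⟨n, rfl⟩ : ∃ n, j = k + 1 + 1 + n + 1 + 1 := ⟨j - k - 4, by omega⟩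
  obtain ⟨q, hq, hqd⟩ := exists_mem_of_active (z := z) hu hc'.1 hc'.2.1
  have hyq := hqd y (cellOf_region_subset hy')
  -- The nearest point to `y` on level `i + 1` is replaced, and it is within `4 / 3 * sl u (i + 1)`
  -- of `x`, because `dist x y` is below a third of `sl u (k + 2)`. So `Down.near_mem` passes from
  -- `y` to `x`.
  have key : ∀ i, (i = k ∨ i = k + 1) → ∀ g, Near z u i g x → (i, g) ∈ D := by
    intro i hi g hg
    obtain ⟨g', hg'⟩ := exists_near (z := z) hu (i + 1) y
    have hg'D : (i + 1, g') ∈ D := by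
      rcases hi with rfl | rfl
      · refine hD.near_mem_lower (z := z) (i := i + 1) (n := n + 1) hu (w := q) (x := y) ?_ ?_ g' hg'
        · rwa [show i + 1 + (n + 1) + 1 = i + 1 + 1 + n + 1 by ring]
        · rwa [show i + 1 + (n + 1) + 1 = i + 1 + 1 + n + 1 by ring]
      · exact hD.near_mem_lower (z := z) (i := k + 1 + 1) (n := n) hu (w := q) (x := y) hq hyq g' hg'
    refine hD.near_mem hu hg'D ?_ hg
    have h6 := hg'.dist_le hu
    have h7 : sl u (k + 2) ≤ sl u (i + 1) := sl_antitone hu (by omega)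
    have h8 := dist_triangle x y (pt z u (i + 1) g')
    have h9 := hσ y hy
    linarith
  rcases hc.exists_near_notMem hD hx with ⟨g, hg, hgD⟩ | ⟨g, hg, hgD⟩
  · exact hgD (key k (Or.inl rfl) g hg)
  · exact hgD (key (k + 1) (Or.inr rfl) g hg)

/-- Once a point is replaced, all its edges are short. -/
lemma edgeLength_lt_of_mem (hu : u ≠ 0) {D : Set (ℕ × Eis)} (hfin : D.Finite) (hD : Down D) {k : ℕ}
    {e : Eis} (he : (k, e) ∈ D) {x : Sym2 ℂ} (hx : x ∈ edgesAt (mesh z u D) (pt z u k e)) :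
    edgeLength x < sl u k := by
  classical
  have hex : ∃ n, (k + n, th^[n] e) ∉ D := by
    by_contra hcon
    push Not at hcon
    refine Set.infinite_of_injective_forall_mem (f := fun n => (k + n, th^[n] e)) ?_ hcon hfin
    intro a b hab
    have := congrArg Prod.fst hab
    simpa using this
  obtain ⟨n, hn, hmin⟩ : ∃ n, (k + n, th^[n] e) ∉ D ∧ ∀ n' < n, (k + n', th^[n'] e) ∈ D :=
    ⟨Nat.find hex, Nat.find_spec hex, fun n' hn' => not_not.1 (Nat.find_min hex hn')⟩
  cases n with
  | zero => exact (hn he).elim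
  | succ n =>
    have hr : Ready D (k + (n + 1)) (th^[n + 1] e) := by
      refine ⟨hn, fun j hj f hf => ?_⟩
      rw [Function.iterate_succ_apply', pre_th_iff] at hf
      rw [show j = k + n by omega, hf]
      exact hmin n (Nat.lt_succ_self n)
    rw [← pt_iterate k (n + 1) e, edgesAt_ready hu hD hr] at hx
    obtain ⟨w, hw, rfl⟩ := hx
    rw [edgeLength_mk, dist_comm, dist_pt_mid _ hw]
    have h1 : sl u (k + (n + 1)) ≤ sl u (k + 1) := sl_antitone hu (by omega)
    have h2 := sl_pos hu (k + 1)
    have h3 := sl_succ (u := u) k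
    nlinarith [sqrt_three_bounds.1]

/-- In a coarsest mesh each last replacement step is forced by the size function. -/
lemma exists_small_of_maximal (hu : u ≠ 0) {D : Set (ℕ × Eis)} (hfin : D.Finite) (hD : Down D)
    {Ω : Set ℂ} {σ : ℂ → ℝ} (hM : IsDiamondKiteMeshFor (rhombille z u) Ω σ (mesh z u D)) {k : ℕ}
    {e : Eis} (he : (k, e) ∈ D) (hmax : ∀ f, Pre f e → (k + 1, f) ∉ D) :
    ∃ x ∈ Ω, dist x (pt z u k e) ≤ 2 * sl u k ∧ σ x < sl u k := by
  obtain ⟨h1, h2, h3⟩ := hD.erase he hmax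
  have hfin' : (D \ {(k, e)}).Finite := hfin.subset Set.sdiff_subset
  -- Otherwise the mesh with this node put back would refine the coarsest mesh, hence also come from
  -- a node set containing `(k, e)`. Its edges at that point would then be shorter than `sl u k`,
  -- but they have exactly this length.
  have hno : ¬ ObeysSize Ω σ (mesh z u (D \ {(k, e)})) := by
    intro hob
    have href := hM.coarsest _ (refines_of_down hu hfin' h1) hob
    obtain ⟨D', hsub, hfinD', hD', heq⟩ := exists_down_of_refines hu hfin hD href
    have hU : IsU (1, 0) := by simp [IsU]
    have hedge : s(pt z u k e, pt z u (k + 1) (th e + (1, 0))) ∈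
        edgesAt (mesh z u (D \ {(k, e)})) (pt z u k e) := by
      rw [edgesAt_ready hu h1 h2]; exact ⟨_, hU, rfl⟩
    rw [heq] at hedge
    have := edgeLength_lt_of_mem hu hfinD' hD' (hsub he) hedge
    rw [edgeLength_mk, dist_comm, dist_pt_mid _ hU] at this
    exact lt_irrefl _ this
  unfold ObeysSize at hno
  push Not at hno
  obtain ⟨Q, hQ, x, ⟨hxQ, hxΩ⟩, y, hy, hlt⟩ := hno
  have hstep := (h2.isReplacementAt (z := z) hu h1).2.2
  rw [h3] at hstep
  -- The oversized element must touch the point put back, since all other elements belong to the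
  -- original mesh, which obeys `σ`.
  by_cases hp : pt z u k e ∈ Q.verts
  · obtain ⟨j, f, w, hc, rfl⟩ := hQ
    obtain ⟨rfl, hf⟩ := vertex_index hu h1 h2 hc hp
    have hlen : edgeLength y ≤ sl u j := by
      rcases edgeLength_side hc hy with h | h
      · exact h.le
      · rw [h]; exact sl_antitone hu (Nat.le_succ j)
    refine ⟨x, hxΩ, ?_, hlt.trans_le hlen⟩
    have hxr := cellOf_region_subset hxQ
    rcases hf with rfl | rfl
    · exact dist_le_of_mem_rhombus hc.1 hxr
    · rw [← rhombus_symm] at hxr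
      exact dist_le_of_mem_rhombus hc.1.neg hxr
  · have hQM : Q ∈ mesh z u D := by
      rw [hstep]; exact Or.inl (Or.inl ⟨hQ, hp⟩)
    exact absurd (hM.obeys Q hQM x ⟨hxQ, hxΩ⟩ y hy) (not_le.2 hlt)

/-- Climb to dependent nodes as long as possible. The moves are at most `sl u k`, `sl u (k + 1)` and
so on, a geometric series of ratio `1 / √3` with sum below `3 * sl u k`. -/
lemma exists_maximal_near (hu : u ≠ 0) {D : Set (ℕ × Eis)} {N : ℕ} (hN : ∀ n ∈ D, n.1 < N) (n : ℕ)
    {k : ℕ} (hn : N ≤ k + n) {e : Eis} (he : (k, e) ∈ D) :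
    ∃ j f, (j, f) ∈ D ∧ (∀ g, Pre g f → (j + 1, g) ∉ D) ∧ sl u j ≤ sl u k ∧
      dist (pt z u j f) (pt z u k e) ≤ 3 * sl u k := by
  induction n generalizing k e with
  | zero => have := hN _ he; simp at this; omega
  | succ n ih =>
    by_cases h : ∃ f, Pre f e ∧ (k + 1, f) ∈ D
    · obtain ⟨f, hf, hfD⟩ := h
      obtain ⟨j, g, h1, h2, h3, h4⟩ := ih (k := k + 1) (by omega) hfD
      have hs := sl_pos hu (k + 1)
      have hk := sl_succ (u := u) k
      refine ⟨j, g, h1, h2, h3.trans (sl_antitone hu (Nat.le_succ k)), ?_⟩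
      have hd : dist (pt z u (k + 1) f) (pt z u k e) ≤ sl u k := by
        rw [← pt_succ_th k, dist_comm, dist_pt, ← hk]
        rcases hf with hf | hf
        · rw [hf]; simp [emb]; exact (sl_pos hu k).le
        · rw [norm_emb_isU hf, mul_one]
      have htri := dist_triangle (pt z u j g) (pt z u (k + 1) f) (pt z u k e)
      nlinarith [sqrt_three_bounds.1]
    · push Not at h
      refine ⟨k, e, he, h, le_rfl, ?_⟩
      rw [dist_self]
      linarith [sl_pos hu k]

/-- A maximal node within `3 * sl u k`, and from there a point of small `σ` within twice an edge
length: `5 = 3 + 2`. -/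
lemma exists_small_of_mem (hu : u ≠ 0) {D : Set (ℕ × Eis)} (hfin : D.Finite) (hD : Down D)
    {Ω : Set ℂ} {σ : ℂ → ℝ} (hM : IsDiamondKiteMeshFor (rhombille z u) Ω σ (mesh z u D)) {k : ℕ}
    {e : Eis} (he : (k, e) ∈ D) :
    ∃ x ∈ Ω, dist x (pt z u k e) ≤ 5 * sl u k ∧ σ x < sl u k := by
  obtain ⟨N, hN⟩ : ∃ N, ∀ n ∈ D, n.1 < N := by
    obtain ⟨B, hB⟩ := (hfin.image Prod.fst).bddAbove
    exact ⟨B + 1, fun n hn => Nat.lt_succ_of_le (hB ⟨n, hn, rfl⟩)⟩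
  obtain ⟨j, f, h1, h2, h3, h4⟩ := exists_maximal_near (z := z) hu hN N (k := k) (by omega) he
  obtain ⟨x, hx, hxd, hxσ⟩ := exists_small_of_maximal hu hfin hD hM h1 h2
  refine ⟨x, hx, ?_, hxσ.trans_le h3⟩
  have := dist_triangle x (pt z u j f) (pt z u k e)
  linarith

/-- The cells of a coarsest mesh are not much smaller than the local feature size. -/
lemma IsCell.localFeatureSize_le (hu : u ≠ 0) {D : Set (ℕ × Eis)} (hfin : D.Finite) (hD : Down D)
    {Ω : Set ℂ} {σ : ℂ → ℝ} (hσ : ∀ p ∈ Ω, 0 < σ p) {K : ℝ}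
    (hK : ∀ p ∈ Ω, localFeatureSize Ω σ p ≤ K * ‖u‖)
    (hM : IsDiamondKiteMeshFor (rhombille z u) Ω σ (mesh z u D)) {k : ℕ}
    {e w : Eis} (hc : IsCell D k e w) {x : ℂ} (hx : x ∈ (cellOf z u D k e w).region)
    (hxΩ : x ∈ Ω) : localFeatureSize Ω σ x ≤ max K 14 * sl u k := by
  cases k with
  | zero =>
    rw [sl_zero]
    refine (hK x hxΩ).trans ?_
    gcongr
    exact le_max_left _ _
  | succ k =>
    obtain ⟨q, hq, hqd⟩ := exists_mem_of_active (z := z) hu hc.1 hc.2.1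
    have h1 := hqd x (cellOf_region_subset hx)
    obtain ⟨y, hy, hyd, hyσ⟩ := exists_small_of_mem hu hfin hD hM hq
    have h2 := DiamondKite.localFeatureSize_le hσ x hy
    have h3 := dist_triangle_right x y (pt z u k q)
    have hk := sl_succ (u := u) k
    have hs := sl_pos hu (k + 1)
    -- `3 / 2 + 5` edge lengths of distance and one of size, and `15 / 2 * √3 < 14`.
    have h4 : localFeatureSize Ω σ x ≤ 14 * sl u (k + 1) := by
      nlinarith [sqrt_three_bounds.2]
    refine h4.trans ?_
    gcongr
    exact le_max_right _ _

end

section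

/-! ### Elements of bounded aspect ratio -/

lemma edgeSegment_mk (a b : ℂ) : edgeSegment s(a, b) = segment ℝ a b := by
  have : {x | x ∈ s(a, b)} = ({a, b} : Set ℂ) := by ext x; simp
  rw [edgeSegment, this, convexHull_pair]

lemma mem_edgeSegment_mk {a b x : ℂ} :
    x ∈ edgeSegment s(a, b) ↔ ∃ t : ℝ, 0 ≤ t ∧ t ≤ 1 ∧ x = a + t * (b - a) := by
  rw [edgeSegment_mk, segment_eq_image']
  constructor
  · rintro ⟨t, ⟨h0, h1⟩, rfl⟩
    exact ⟨t, h0, h1, by simp⟩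
  · rintro ⟨t, h0, h1, rfl⟩
    exact ⟨t, ⟨h0, h1⟩, by simp⟩

lemma mem_edgeSegment_of_mem {e : Sym2 ℂ} {v : ℂ} (h : v ∈ e) : v ∈ edgeSegment e :=
  subset_convexHull _ _ h

/-- The cross product of two plane vectors. -/
def cr (p q : ℂ) : ℝ := p.re * q.im - p.im * q.re

lemma cr_self (p : ℂ) : cr p p = 0 := by simp [cr]; ring
lemma cr_add_right (p q r : ℂ) : cr p (q + r) = cr p q + cr p r := by simp [cr]; ring
lemma cr_mul_right (p q : ℂ) (t : ℝ) : cr p (t * q) = t * cr p q := by simp [cr]; ring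
lemma cr_swap (p q : ℂ) : cr q p = -cr p q := by simp [cr]; ring
lemma cr_zero_right (p : ℂ) : cr p 0 = 0 := by simp [cr]

lemma abs_cr_le (p q : ℂ) : |cr p q| ≤ ‖p‖ * ‖q‖ := by
  apply abs_le_of_sq_le_sq _ (by positivity)
  rw [mul_pow, ← Complex.normSq_eq_norm_sq, ← Complex.normSq_eq_norm_sq, Complex.normSq_apply,
    Complex.normSq_apply, cr]
  nlinarith [sq_nonneg (p.re * q.re + p.im * q.im)]

lemma exists_eq_mul_of_cr_eq_zero {p q : ℂ} (hp : p ≠ 0) (h : cr p q = 0) : ∃ t : ℝ, q = t * p := by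
  have hn : p.re ^ 2 + p.im ^ 2 ≠ 0 := by
    intro h0
    apply hp
    apply Complex.ext
    · simp; nlinarith [sq_nonneg p.re, sq_nonneg p.im]
    · simp; nlinarith [sq_nonneg p.re, sq_nonneg p.im]
  refine ⟨(p.re * q.re + p.im * q.im) / (p.re ^ 2 + p.im ^ 2), ?_⟩
  unfold cr at h
  apply Complex.ext
  · rw [Complex.re_ofReal_mul]; field_simp; linear_combination (-p.im) * h
  · rw [Complex.im_ofReal_mul]; field_simp; linear_combination p.re * h

/-- Cramer's rule. -/
lemma eq_comb_of_cr_ne_zero {p q : ℂ} (h : cr p q ≠ 0) (x : ℂ) :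
    x = (cr x q / cr p q : ℝ) * p + (cr p x / cr p q : ℝ) * q := by
  apply Complex.ext
  · simp; field_simp; simp only [cr]; ring
  · simp; field_simp; simp only [cr]; ring

lemma cr_ne_zero_of_affineIndependent {a b c : ℂ} (h : AffineIndependent ℝ ![a, b, c]) :
    cr (b - a) (c - a) ≠ 0 := by
  intro h0
  by_cases hab : b - a = 0
  · have := h.injective.ne (show (1 : Fin 3) ≠ 0 by decide)
    exact this (by simpa using sub_eq_zero.1 hab)
  obtain ⟨t, ht⟩ := exists_eq_mul_of_cr_eq_zero hab h0
  rw [affineIndependent_iff_not_collinear_set] at h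
  apply h
  rw [collinear_iff_of_mem (p₀ := a) (by simp)]
  refine ⟨b - a, ?_⟩
  rintro p (rfl | rfl | rfl)
  · exact ⟨0, by simp⟩
  · exact ⟨1, by simp⟩
  · exact ⟨t, by
      simp only [Complex.real_smul, vadd_eq_add]
      linear_combination ht⟩

/-- The cross product with `c - a` is a signed multiple of the distance to the line `ac`; the sign
tells the side. -/
lemma cr_mul_neg_of_sOppSide {a b c d : ℂ} (hac : a ≠ c) (h : (line[ℝ, a, c]).SOppSide b d) :
    cr (c - a) (b - a) * cr (c - a) (d - a) < 0 := by
  obtain ⟨⟨p₁, hp₁, p₂, hp₂, hray⟩, hb, hd⟩ := h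
  have hmem : ∀ x, cr (c - a) (x - a) = 0 → x ∈ line[ℝ, a, c] := by
    intro x hx
    obtain ⟨t, ht⟩ := exists_eq_mul_of_cr_eq_zero (sub_ne_zero.2 hac.symm) hx
    have : x = AffineMap.lineMap a c t := by
      rw [AffineMap.lineMap_apply]
      simp only [vsub_eq_sub, Complex.real_smul, vadd_eq_add]
      linear_combination ht
    rw [this]
    exact AffineMap.lineMap_mem_affineSpan_pair _ _ _
  have hmem' : ∀ x ∈ line[ℝ, a, c], cr (c - a) (x - a) = 0 := by
    intro x hx
    obtain ⟨t, rfl⟩ := mem_affineSpan_pair_iff_exists_lineMap_eq.1 hx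
    rw [AffineMap.lineMap_apply]
    simp only [vsub_eq_sub, Complex.real_smul, vadd_eq_add, add_sub_cancel_right]
    rw [cr_mul_right, cr_self, mul_zero]
  have hb' : cr (c - a) (b - a) ≠ 0 := fun h => hb (hmem _ h)
  have hd' : cr (c - a) (d - a) ≠ 0 := fun h => hd (hmem _ h)
  have e1 : cr (c - a) (b -ᵥ p₁) = cr (c - a) (b - a) := by
    have := hmem' p₁ hp₁
    simp only [vsub_eq_sub, cr, Complex.sub_re, Complex.sub_im] at this ⊢
    linarith
  have e2 : cr (c - a) (p₂ -ᵥ d) = -cr (c - a) (d - a) := by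
    have := hmem' p₂ hp₂
    simp only [vsub_eq_sub, cr, Complex.sub_re, Complex.sub_im] at this ⊢
    linarith
  rcases hray with h0 | h0 | ⟨r₁, r₂, h1, h2, h3⟩
  · rw [h0, cr_zero_right] at e1; exact (hb' e1.symm).elim
  · rw [h0, cr_zero_right] at e2
    exact (hd' (by linarith)).elim
  · have h4 := congrArg (cr (c - a)) h3
    rw [Complex.real_smul, Complex.real_smul, cr_mul_right, cr_mul_right, e1, e2] at h4
    have h5 : 0 < cr (c - a) (b - a) ^ 2 := by positivity
    by_contra! hcon
    have h6 : r₁ * cr (c - a) (b - a) ^ 2 = -(r₂ * (cr (c - a) (b - a) * cr (c - a) (d - a))) := by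
      linear_combination cr (c - a) (b - a) * h4
    nlinarith [mul_pos h1 h5, mul_nonneg h2.le hcon]

lemma splitQuad_swap_diagonal (a b c d : ℂ) : splitQuad a b c d = splitQuad c b a d := by
  ext x
  · simp only [splitQuad, Set.mem_insert_iff, Set.mem_singleton_iff]
    rw [Sym2.eq_swap (a := c) (b := b), Sym2.eq_swap (a := b) (b := a), Sym2.eq_swap (a := a) (b := d),
      Sym2.eq_swap (a := d) (b := c)]
    tauto
  · have h1 : ({a, b, c} : Set ℂ) = {c, b, a} := by
      ext x; simp only [Set.mem_insert_iff, Set.mem_singleton_iff]; tauto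
    have h2 : ({a, c, d} : Set ℂ) = {c, a, d} := by
      ext x; simp only [Set.mem_insert_iff, Set.mem_singleton_iff]; tauto
    simp only [splitQuad, h1, h2]

lemma splitQuad_swap_sides (a b c d : ℂ) : splitQuad a b c d = splitQuad a d c b := by
  ext x
  · simp only [splitQuad, Set.mem_insert_iff, Set.mem_singleton_iff]
    rw [Sym2.eq_swap (a := a) (b := d), Sym2.eq_swap (a := d) (b := c), Sym2.eq_swap (a := c) (b := b),
      Sym2.eq_swap (a := b) (b := a)]
    tauto
  · have h1 : ({a, b, c} : Set ℂ) = {a, c, b} := by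
      ext x; simp only [Set.mem_insert_iff, Set.mem_singleton_iff]; tauto
    have h2 : ({a, c, d} : Set ℂ) = {a, d, c} := by
      ext x; simp only [Set.mem_insert_iff, Set.mem_singleton_iff]; tauto
    simp only [splitQuad, h1, h2, Set.union_comm]

lemma mem_verts_triangle {a b c v : ℂ} :
    v ∈ (triangle a b c).verts ↔ v = a ∨ v = b ∨ v = c := by
  simp only [Cell.verts, triangle, Set.mem_insert_iff, Set.mem_singleton_iff, Set.mem_ofPred_eq]
  constructor
  · rintro ⟨e, rfl | rfl | rfl, h⟩ <;> simp only [Sym2.mem_iff] at h <;> tauto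
  · rintro (rfl | rfl | rfl)
    · exact ⟨_, Or.inl rfl, by simp⟩
    · exact ⟨_, Or.inl rfl, by simp⟩
    · exact ⟨_, Or.inr (Or.inl rfl), by simp⟩

lemma mem_verts_splitQuad {a b c d v : ℂ} :
    v ∈ (splitQuad a b c d).verts ↔ v = a ∨ v = b ∨ v = c ∨ v = d :=
  mem_verts_convexQuad

lemma mem_sides_splitQuad {a b c d : ℂ} {e : Sym2 ℂ} :
    e ∈ (splitQuad a b c d).sides ↔ e = s(a, b) ∨ e = s(b, c) ∨ e = s(c, d) ∨ e = s(d, a) :=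
  mem_sides_convexQuad

lemma mem_sides_triangle {a b c : ℂ} {e : Sym2 ℂ} :
    e ∈ (triangle a b c).sides ↔ e = s(a, b) ∨ e = s(b, c) ∨ e = s(c, a) := by
  simp [triangle]

/-- The open cone at `v` spanned by `p` and `q` lies in the element `Q` near `v` and does not
meet the sides of `Q` at `v`. -/
def InnerCone (Q : Cell) (v p q : ℂ) : Prop :=
  cr p q ≠ 0 ∧ ∀ s t : ℝ, 0 < s → 0 < t → ∃ ε > 0, ∀ η : ℝ, 0 < η → η < ε →
    v + η * (s * p + t * q) ∈ Q.region ∧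
      ∀ f ∈ Q.sides, v ∈ f → v + η * (s * p + t * q) ∉ edgeSegment f

/-- A side at `v` runs along a bounding ray of the cone or into the other half-plane of the line
`vy`. The latter case is the second side at an end of a quadrilateral's diagonal. -/
lemma innerCone_of_hull {Q : Cell} {v x y : ℂ} (hcr : cr (x - v) (y - v) ≠ 0)
    (hsub : convexHull ℝ {v, x, y} ⊆ Q.region)
    (hsides : ∀ f ∈ Q.sides, v ∈ f → ∃ q, f = s(v, q) ∧
      (q = x ∨ q = y ∨ cr (y - v) (x - v) * cr (y - v) (q - v) < 0)) :
    InnerCone Q v (x - v) (y - v) := by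
  refine ⟨hcr, fun s t hs ht => ⟨1 / (s + t), by positivity, fun η hη hη' => ⟨hsub ?_, ?_⟩⟩⟩
  · have h1 : η * (s + t) < 1 := by rwa [lt_div_iff₀ (by positivity)] at hη'
    refine Convex.comb_three (convex_convexHull ℝ _) (a := v) (b := x) (c := y)
      (subset_convexHull _ _ (by simp)) (subset_convexHull _ _ (by simp))
      (subset_convexHull _ _ (by simp)) (α := 1 - η * (s + t)) (β := η * s) (γ := η * t)
      (by linarith) (by positivity) (by positivity) (by ring) ?_
    push_cast; ring
  · intro f hf hvf hmem
    obtain ⟨q, rfl, hq⟩ := hsides f hf hvf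
    obtain ⟨l, hl0, hl1, hl⟩ := mem_edgeSegment_mk.1 hmem
    have hl' : (η : ℂ) * (s * (x - v) + t * (y - v)) = l * (q - v) := add_left_cancel hl
    have h1 := congrArg (cr (x - v)) hl'
    have h2 := congrArg (cr (y - v)) hl'
    simp only [cr_mul_right, cr_add_right, cr_self] at h1 h2
    have hcr' := hcr
    rw [cr_swap, neg_ne_zero] at hcr'
    rcases hq with rfl | rfl | hq
    · rw [cr_self] at h1
      have : η * t * cr (q - v) (y - v) = 0 := by linarith
      simp [hη.ne', ht.ne', hcr] at this
    · rw [cr_self] at h2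
      have : η * s * cr (q - v) (x - v) = 0 := by linarith
      simp [hη.ne', hs.ne', hcr'] at this
    · have h3 : 0 < cr (y - v) (x - v) ^ 2 := by positivity
      have h4 : η * s * cr (y - v) (x - v) ^ 2 =
          l * (cr (y - v) (x - v) * cr (y - v) (q - v)) := by
        linear_combination cr (y - v) (x - v) * h2
      have h5 : 0 < η * s * cr (y - v) (x - v) ^ 2 := by positivity
      nlinarith

/-- The combinatorial and geometric properties of triangles and simple quadrilaterals that are used
below. -/
structure IsProper (Q : Cell) : Prop where
  finite : Q.sides.Finite
  nonempty : Q.sides.Nonempty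
  ne : ∀ a b, s(a, b) ∈ Q.sides → a ≠ b
  next : ∀ a b, s(a, b) ∈ Q.sides → ∃ f ∈ Q.sides, b ∈ f ∧ a ∉ f
  disjoint : ∀ e ∈ Q.sides, ∀ f ∈ Q.sides, (∀ v ∈ e, v ∉ f) →
    Disjoint (edgeSegment e) (edgeSegment f)
  cone : ∀ v ∈ Q.verts, ∃ x y, x ≠ y ∧ s(v, x) ∈ Q.sides ∧ s(v, y) ∈ Q.sides ∧
    (InnerCone Q v (x - v) (y - v) ∨
      ∃ c, c ≠ v ∧ InnerCone Q v (x - v) (c - v) ∧ InnerCone Q v (y - v) (c - v))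
  closed : IsClosed Q.region
  hull : ∀ S : Set ℂ, Convex ℝ S → Q.verts ⊆ S → Q.region ⊆ S
  near : ∀ v ∈ Q.verts, ∀ w ∈ Q.verts, v = w ∨ s(v, w) ∈ Q.sides ∨
    ∃ x, s(v, x) ∈ Q.sides ∧ s(x, w) ∈ Q.sides

lemma IsTriangle.isProper {Q : Cell} (h : Q.IsTriangle) : IsProper Q := by
  obtain ⟨a, b, c, hind, rfl⟩ := h
  have hcr := cr_ne_zero_of_affineIndependent hind
  have hrot : cr (c - b) (a - b) = cr (b - a) (c - a) := by simp [cr]; ring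
  have hrot' : cr (a - c) (b - c) = cr (b - a) (c - a) := by simp [cr]; ring
  have hab : a ≠ b := by rintro rfl; simp [cr] at hcr
  have hbc : b ≠ c := by rintro rfl; exact hcr (cr_self _)
  have hca : c ≠ a := by rintro rfl; simp [cr] at hcr
  have hcone : ∀ a b c : ℂ, cr (b - a) (c - a) ≠ 0 → a ≠ b → b ≠ c → c ≠ a →
      InnerCone (triangle a b c) a (b - a) (c - a) := by
    intro a b c hcr hab hbc hca
    refine innerCone_of_hull hcr subset_rfl fun f hf hvf => ?_
    rcases mem_sides_triangle.1 hf with rfl | rfl | rfl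
    · exact ⟨b, rfl, Or.inl rfl⟩
    · simp [hab, hca.symm] at hvf
    · exact ⟨c, Sym2.eq_swap, Or.inr (Or.inl rfl)⟩
  have htri : ∀ a b c : ℂ, triangle a b c = triangle b c a := by
    intro a b c
    ext x
    · simp only [mem_sides_triangle]; tauto
    · have : ({a, b, c} : Set ℂ) = {b, c, a} := by
        ext x; simp only [Set.mem_insert_iff, Set.mem_singleton_iff]; tauto
      simp only [triangle, this]
  refine ⟨?_, ⟨_, mem_sides_triangle.2 (Or.inl rfl)⟩, ?_, ?_, ?_, ?_, ?_, ?_, ?_⟩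
  · exact Set.toFinite {s(a, b), s(b, c), s(c, a)}
  · intro x y h
    rcases mem_sides_triangle.1 h with h | h | h <;>
    rcases Sym2.eq_iff.1 h with ⟨rfl, rfl⟩ | ⟨rfl, rfl⟩ <;> first | assumption | (apply Ne.symm; assumption)
  · intro x y h
    rcases mem_sides_triangle.1 h with h | h | h <;>
    rcases Sym2.eq_iff.1 h with ⟨rfl, rfl⟩ | ⟨rfl, rfl⟩
    · exact ⟨s(y, c), by simp [mem_sides_triangle], by simp, by simp [hab, hca.symm]⟩
    · exact ⟨s(c, y), by simp [mem_sides_triangle], by simp, by simp [hab.symm, hbc]⟩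
    · exact ⟨s(y, a), by simp [mem_sides_triangle], by simp, by simp [hab.symm, hbc]⟩
    · exact ⟨s(a, y), by simp [mem_sides_triangle], by simp, by simp [hca, hbc.symm]⟩
    · exact ⟨s(y, b), by simp [mem_sides_triangle], by simp, by simp [hca, hbc.symm]⟩
    · exact ⟨s(b, y), by simp [mem_sides_triangle], by simp, by simp [hab, hca.symm]⟩
  · intro e he f hf hdis
    exfalso
    rcases mem_sides_triangle.1 he with rfl | rfl | rfl <;>
    rcases mem_sides_triangle.1 hf with rfl | rfl | rfl <;> simp at hdis
  · intro v hv
    rcases mem_verts_triangle.1 hv with rfl | rfl | rfl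
    · exact ⟨b, c, hbc, by simp [mem_sides_triangle], by simp [mem_sides_triangle, Sym2.eq_swap],
        Or.inl (hcone _ _ _ hcr hab hbc hca)⟩
    · rw [htri]
      exact ⟨c, a, hca, by simp [mem_sides_triangle], by simp [mem_sides_triangle, Sym2.eq_swap],
        Or.inl (hcone _ _ _ (by rwa [hrot]) hbc hca hab)⟩
    · rw [htri, htri]
      exact ⟨a, b, hab, by simp [mem_sides_triangle], by simp [mem_sides_triangle, Sym2.eq_swap],
        Or.inl (hcone _ _ _ (by rwa [hrot']) hca hab hbc)⟩
  · exact (Set.toFinite _).isClosed_convexHull ℝ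
  · intro S hS hsub
    refine convexHull_min ?_ hS
    rintro x (rfl | rfl | rfl) <;> exact hsub (mem_verts_triangle.2 (by simp))
  · intro v hv w hw
    rcases mem_verts_triangle.1 hv with rfl | rfl | rfl <;>
    rcases mem_verts_triangle.1 hw with rfl | rfl | rfl <;>
    simp [mem_sides_triangle, Sym2.eq_swap]

/-- The two segments lie in opposite closed half-planes of the line `ac` and meet this line only in
`a` and in `c`. -/
lemma disjoint_sides_of_cr {a b c d : ℂ} (hac : a ≠ c)
    (h : cr (c - a) (b - a) * cr (c - a) (d - a) < 0) :
    Disjoint (edgeSegment s(a, b)) (edgeSegment s(c, d)) := by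
  rw [Set.disjoint_left]
  intro x hx hx'
  obtain ⟨s, hs0, hs1, hs⟩ := mem_edgeSegment_mk.1 hx
  obtain ⟨t, ht0, ht1, ht⟩ := mem_edgeSegment_mk.1 hx'
  have h1 : (s : ℂ) * (b - a) = (c - a) + t * ((d - a) + ((-1 : ℝ) : ℂ) * (c - a)) := by
    rw [hs] at ht
    push_cast
    linear_combination ht
  have h2 := congrArg (cr (c - a)) h1
  simp only [cr_mul_right, cr_add_right, cr_self] at h2
  have h3 : s * cr (c - a) (b - a) = t * cr (c - a) (d - a) := by linarith
  have hb : cr (c - a) (b - a) ≠ 0 := by intro h0; rw [h0] at h; simp at h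
  have h4 : 0 < cr (c - a) (b - a) ^ 2 := by positivity
  have h5 : s * cr (c - a) (b - a) ^ 2 = t * (cr (c - a) (b - a) * cr (c - a) (d - a)) := by
    linear_combination cr (c - a) (b - a) * h3
  have h6 : s * cr (c - a) (b - a) ^ 2 ≤ 0 := by rw [h5]; nlinarith
  have hs' : s = 0 := by nlinarith
  have hd : cr (c - a) (d - a) ≠ 0 := by intro h0; rw [h0] at h; simp at h
  have ht' : t = 0 := by
    rw [hs', zero_mul] at h3
    simpa [hd] using h3.symm
  rw [hs', ht'] at h1
  simp at h1
  exact hac (sub_eq_zero.1 h1.symm).symm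

/-- Everything follows from the opposite signs of `b` and `d` with respect to the diagonal. At the
ends of the diagonal the angle may be reflex, so the two cones on either side of the diagonal
replace it. -/
lemma IsQuadrilateral.isProper {Q : Cell} (h : Q.IsQuadrilateral) : IsProper Q := by
  obtain ⟨a, b, c, d, hac, hopp, rfl⟩ := h
  have hcr := cr_mul_neg_of_sOppSide hac hopp
  have hswap : ∀ {a b c d : ℂ}, cr (c - a) (b - a) * cr (c - a) (d - a) < 0 →
      cr (a - c) (b - c) * cr (a - c) (d - c) < 0 := by
    intro a b c d h
    have e1 : cr (a - c) (b - c) = -cr (c - a) (b - a) := by simp [cr]; ring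
    have e2 : cr (a - c) (d - c) = -cr (c - a) (d - a) := by simp [cr]; ring
    rw [e1, e2]; linarith
  have hneq : ∀ {a b c d : ℂ}, cr (c - a) (b - a) * cr (c - a) (d - a) < 0 →
      a ≠ b ∧ b ≠ c ∧ b ≠ d := by
    intro a b c d h
    refine ⟨?_, ?_, ?_⟩ <;> rintro rfl
    · simp [cr] at h
    · rw [cr_self] at h; simp at h
    · nlinarith [mul_self_nonneg (cr (c - a) (b - a))]
  have hcr' : cr (c - a) (d - a) * cr (c - a) (b - a) < 0 := by linarith
  obtain ⟨hab, hbc, hbd⟩ := hneq hcr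
  obtain ⟨had, hdc, -⟩ := hneq hcr'
  have hconeA : ∀ {a b c d : ℂ}, a ≠ c → cr (c - a) (b - a) * cr (c - a) (d - a) < 0 →
      InnerCone (splitQuad a b c d) a (b - a) (c - a) := by
    intro a b c d hac h
    obtain ⟨hab, hbc, hbd⟩ := hneq h
    obtain ⟨had, hdc, -⟩ := hneq (b := d) (d := b) (by linarith : cr (c - a) (d - a) * _ < 0)
    refine innerCone_of_hull ?_ Set.subset_union_left fun f hf hvf => ?_
    · rw [cr_swap, neg_ne_zero]
      intro h0; rw [h0] at h; simp at h
    · rcases mem_sides_splitQuad.1 hf with rfl | rfl | rfl | rfl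
      · exact ⟨b, rfl, Or.inl rfl⟩
      · simp [hab, hac] at hvf
      · simp [hac, had] at hvf
      · exact ⟨d, Sym2.eq_swap, Or.inr (Or.inr h)⟩
  have hconeB : ∀ {a b c d : ℂ}, a ≠ c → cr (c - a) (b - a) * cr (c - a) (d - a) < 0 →
      InnerCone (splitQuad a b c d) b (a - b) (c - b) := by
    intro a b c d hac h
    obtain ⟨hab, hbc, hbd⟩ := hneq h
    refine innerCone_of_hull ?_ ?_ fun f hf hvf => ?_
    · have : cr (a - b) (c - b) = cr (c - a) (b - a) := by simp [cr]; ring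
      rw [this]
      intro h0; rw [h0] at h; simp at h
    · have : ({b, a, c} : Set ℂ) = {a, b, c} := by
        ext x; simp only [Set.mem_insert_iff, Set.mem_singleton_iff]; tauto
      rw [this]
      exact Set.subset_union_left
    · rcases mem_sides_splitQuad.1 hf with rfl | rfl | rfl | rfl
      · exact ⟨a, Sym2.eq_swap, Or.inl rfl⟩
      · exact ⟨c, rfl, Or.inr (Or.inl rfl)⟩
      · simp [hbc, hbd] at hvf
      · simp [hab.symm, hbd] at hvf
  have hA : ∀ {a b c d : ℂ}, a ≠ c → cr (c - a) (b - a) * cr (c - a) (d - a) < 0 →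
      ∃ x y, x ≠ y ∧ s(a, x) ∈ (splitQuad a b c d).sides ∧ s(a, y) ∈ (splitQuad a b c d).sides ∧
      (InnerCone (splitQuad a b c d) a (x - a) (y - a) ∨
      ∃ e, e ≠ a ∧ InnerCone (splitQuad a b c d) a (x - a) (e - a) ∧
        InnerCone (splitQuad a b c d) a (y - a) (e - a)) := by
    intro a b c d hac h
    refine ⟨b, d, (hneq h).2.2, by simp [mem_sides_splitQuad],
      by simp [mem_sides_splitQuad, Sym2.eq_swap], Or.inr ⟨c, hac.symm, hconeA hac h, ?_⟩⟩
    rw [splitQuad_swap_sides]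
    exact hconeA hac (by linarith)
  have hB : ∀ {a b c d : ℂ}, a ≠ c → cr (c - a) (b - a) * cr (c - a) (d - a) < 0 →
      ∃ x y, x ≠ y ∧ s(b, x) ∈ (splitQuad a b c d).sides ∧ s(b, y) ∈ (splitQuad a b c d).sides ∧
      (InnerCone (splitQuad a b c d) b (x - b) (y - b) ∨
      ∃ e, e ≠ b ∧ InnerCone (splitQuad a b c d) b (x - b) (e - b) ∧
        InnerCone (splitQuad a b c d) b (y - b) (e - b)) := by
    intro a b c d hac h
    exact ⟨a, c, hac, by simp [mem_sides_splitQuad, Sym2.eq_swap], by simp [mem_sides_splitQuad],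
      Or.inl (hconeB hac h)⟩
  refine ⟨Set.toFinite {s(a, b), s(b, c), s(c, d), s(d, a)}, ⟨_, mem_sides_splitQuad.2 (Or.inl rfl)⟩, ?_, ?_, ?_, ?_, ?_, ?_, ?_⟩
  · intro x y h
    rcases mem_sides_splitQuad.1 h with h | h | h | h <;>
    rcases Sym2.eq_iff.1 h with ⟨rfl, rfl⟩ | ⟨rfl, rfl⟩ <;> first | assumption | (apply Ne.symm; assumption)
  · intro x y h
    rcases mem_sides_splitQuad.1 h with h | h | h | h <;>
    rcases Sym2.eq_iff.1 h with ⟨rfl, rfl⟩ | ⟨rfl, rfl⟩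
    · exact ⟨s(y, c), by simp [mem_sides_splitQuad], by simp, by simp [hab, hac]⟩
    · exact ⟨s(d, y), by simp [mem_sides_splitQuad], by simp, by simp [hab.symm, hbd]⟩
    · exact ⟨s(y, d), by simp [mem_sides_splitQuad], by simp, by simp [hbc, hbd]⟩
    · exact ⟨s(a, y), by simp [mem_sides_splitQuad], by simp, by simp [hac.symm, hbc.symm]⟩
    · exact ⟨s(y, a), by simp [mem_sides_splitQuad], by simp, by simp [hac.symm, hdc.symm]⟩
    · exact ⟨s(b, y), by simp [mem_sides_splitQuad], by simp, by simp [hbd.symm, hdc]⟩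
    · exact ⟨s(y, b), by simp [mem_sides_splitQuad], by simp, by simp [had.symm, hbd.symm]⟩
    · exact ⟨s(c, y), by simp [mem_sides_splitQuad], by simp, by simp [hac, had]⟩
  · have h1 := disjoint_sides_of_cr hac hcr
    have h2 := disjoint_sides_of_cr hac.symm (hswap hcr)
    rw [Sym2.eq_swap (a := c) (b := b), Sym2.eq_swap (a := a) (b := d)] at h2
    intro e he f hf hdis
    rcases mem_sides_splitQuad.1 he with rfl | rfl | rfl | rfl <;>
    rcases mem_sides_splitQuad.1 hf with rfl | rfl | rfl | rfl <;>
    first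
      | exact h1
      | exact h1.symm
      | exact h2
      | exact h2.symm
      | (exfalso; simp at hdis)
  · intro v hv
    rcases mem_verts_splitQuad.1 hv with rfl | rfl | rfl | rfl
    · exact hA hac hcr
    · exact hB hac hcr
    · rw [splitQuad_swap_diagonal]
      exact hA hac.symm (hswap hcr)
    · rw [splitQuad_swap_sides]
      exact hB hac hcr'
  · exact ((Set.toFinite _).isClosed_convexHull ℝ).union ((Set.toFinite _).isClosed_convexHull ℝ)
  · intro S hS hsub
    refine Set.union_subset (convexHull_min ?_ hS) (convexHull_min ?_ hS) <;>
    rintro x (rfl | rfl | rfl) <;> exact hsub (mem_verts_splitQuad.2 (by simp))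
  · have s1 : s(a, b) ∈ (splitQuad a b c d).sides := by simp [splitQuad]
    have s2 : s(b, c) ∈ (splitQuad a b c d).sides := by simp [splitQuad]
    have s3 : s(c, d) ∈ (splitQuad a b c d).sides := by simp [splitQuad]
    have s4 : s(d, a) ∈ (splitQuad a b c d).sides := by simp [splitQuad]
    have t1 := s1
    have t2 := s2
    have t3 := s3
    have t4 := s4
    rw [Sym2.eq_swap] at t1 t2 t3 t4
    intro v hv w hw
    rcases mem_verts_splitQuad.1 hv with rfl | rfl | rfl | rfl <;>
    rcases mem_verts_splitQuad.1 hw with rfl | rfl | rfl | rfl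
    exacts [Or.inl rfl, Or.inr (Or.inl s1), Or.inr (Or.inr ⟨_, s1, s2⟩), Or.inr (Or.inl t4),
      Or.inr (Or.inl t1), Or.inl rfl, Or.inr (Or.inl s2), Or.inr (Or.inr ⟨_, s2, s3⟩),
      Or.inr (Or.inr ⟨_, s3, s4⟩), Or.inr (Or.inl t2), Or.inl rfl, Or.inr (Or.inl s3),
      Or.inr (Or.inl s4), Or.inr (Or.inr ⟨_, s4, s1⟩), Or.inr (Or.inl t3), Or.inl rfl]

end

/-! ### The size of an element and its aspect ratio -/

section

/-- The length of the longest side. -/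
def csize (Q : Cell) : ℝ := sSup (edgeLength '' Q.sides)

variable {Q : Cell} {ρ : ℝ}

lemma IsProper.edgeLength_le (hQ : IsProper Q) {e : Sym2 ℂ} (he : e ∈ Q.sides) :
    edgeLength e ≤ csize Q :=
  le_csSup (hQ.finite.image _).bddAbove ⟨e, he, rfl⟩

lemma IsProper.exists_edgeLength_eq (hQ : IsProper Q) : ∃ e ∈ Q.sides, edgeLength e = csize Q :=
  (hQ.nonempty.image edgeLength).csSup_mem (hQ.finite.image _)

lemma IsProper.csize_pos (hQ : IsProper Q) : 0 < csize Q := by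
  obtain ⟨e, he⟩ := hQ.nonempty
  refine lt_of_lt_of_le ?_ (hQ.edgeLength_le he)
  induction e with
  | _ a b => rw [edgeLength_mk]; exact dist_pos.2 (hQ.ne a b he)

lemma IsProper.csize_le_infDist (hQ : IsProper Q) (hρ : Q.AspectRatioLE ρ) {v : ℂ} {f : Sym2 ℂ}
    (hv : v ∈ Q.verts) (hf : f ∈ Q.sides) (hvf : v ∉ f) :
    csize Q ≤ ρ * Metric.infDist v (edgeSegment f) := by
  obtain ⟨e, he, h⟩ := hQ.exists_edgeLength_eq
  rw [← h]
  exact hρ e he v hv f hf hvf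

lemma IsProper.csize_le_dist (hQ : IsProper Q) (hρ : Q.AspectRatioLE ρ) (h0 : 0 ≤ ρ) {v x : ℂ}
    {f : Sym2 ℂ} (hv : v ∈ Q.verts) (hf : f ∈ Q.sides) (hvf : v ∉ f) (hx : x ∈ edgeSegment f) :
    csize Q ≤ ρ * dist v x :=
  (hQ.csize_le_infDist hρ hv hf hvf).trans
    (mul_le_mul_of_nonneg_left (Metric.infDist_le_dist_of_mem hx) h0)

/-- The next side contains `b` but not `a`, so the length of `ab` bounds a height from above. All
sides of an element are therefore comparable. -/
lemma IsProper.csize_le_edgeLength (hQ : IsProper Q) (hρ : Q.AspectRatioLE ρ) (h0 : 0 ≤ ρ)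
    {e : Sym2 ℂ} (he : e ∈ Q.sides) : csize Q ≤ ρ * edgeLength e := by
  induction e with
  | _ a b =>
    obtain ⟨f, hf, hbf, haf⟩ := hQ.next a b he
    exact hQ.csize_le_dist hρ h0 ⟨_, he, by simp⟩ hf haf (mem_edgeSegment_of_mem hbf)

/-- Two vertices are joined by at most two sides, and the element lies in the convex hull of its
vertices. -/
lemma IsProper.dist_le (hQ : IsProper Q) {x v : ℂ} (hx : x ∈ Q.region) (hv : v ∈ Q.verts) :
    dist x v ≤ 2 * csize Q := by
  have hpos := hQ.csize_pos
  refine hQ.hull (Metric.closedBall v (2 * csize Q)) (convex_closedBall _ _) (fun w hw => ?_) hx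
  rw [Metric.mem_closedBall, dist_comm]
  rcases hQ.near v hv w hw with rfl | h | ⟨y, h1, h2⟩
  · rw [dist_self]; positivity
  · have := hQ.edgeLength_le h
    rw [edgeLength_mk] at this
    linarith
  · have h3 := hQ.edgeLength_le h1
    have h4 := hQ.edgeLength_le h2
    rw [edgeLength_mk] at h3 h4
    linarith [dist_triangle v y w]

/-! ### Distances between the sides of an element -/

/-- Scaling about `b` moves the point with the larger parameter to the end of its side, where the
bound on the heights applies. -/
lemma dist_side_adjacent {a b c y y' : ℂ} {h : ℝ}
    (ha : ∀ x ∈ edgeSegment s(b, c), h ≤ dist a x) (hc : ∀ x ∈ edgeSegment s(b, a), h ≤ dist c x)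
    (h0 : 0 ≤ h) (hy : y ∈ edgeSegment s(b, a)) (hy' : y' ∈ edgeSegment s(b, c)) :
    h * dist y b ≤ dist a b * dist y y' := by
  obtain ⟨τ, ht0, ht1, rfl⟩ := mem_edgeSegment_mk.1 hy
  obtain ⟨τ', ht0', ht1', rfl⟩ := mem_edgeSegment_mk.1 hy'
  have hd : dist (b + τ * (a - b)) b = τ * dist a b := by
    rw [dist_eq_norm, add_sub_cancel_left, norm_mul, Complex.norm_real, Real.norm_eq_abs,
      abs_of_nonneg ht0, dist_eq_norm]
  have key : τ * h ≤ dist (b + τ * (a - b)) (b + τ' * (c - b)) := by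
    rcases le_total τ' τ with hle | hle
    · rcases eq_or_lt_of_le ht0 with h1 | h1
      · rw [← h1, zero_mul]; exact dist_nonneg
      have h2 := ha (b + (τ' / τ : ℝ) * (c - b))
        (mem_edgeSegment_mk.2 ⟨τ' / τ, by positivity, div_le_one_of_le₀ hle ht0, rfl⟩)
      have h3 : dist (b + τ * (a - b)) (b + τ' * (c - b)) =
          τ * dist a (b + (τ' / τ : ℝ) * (c - b)) := by
        have h4 : (τ : ℂ) ≠ 0 := by exact_mod_cast h1.ne'
        have h5 : (b + τ * (a - b)) - (b + τ' * (c - b)) =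
            (τ : ℂ) * (a - (b + (τ' / τ : ℝ) * (c - b))) := by
          push_cast; field_simp; ring
        rw [dist_eq_norm, h5, norm_mul, Complex.norm_real, Real.norm_eq_abs, abs_of_nonneg ht0,
          ← dist_eq_norm]
      rw [h3]
      exact mul_le_mul_of_nonneg_left h2 ht0
    · rcases eq_or_lt_of_le ht0' with h1 | h1
      · have : τ = 0 := by linarith
        rw [this, zero_mul]; exact dist_nonneg
      have h2 := hc (b + (τ / τ' : ℝ) * (a - b))
        (mem_edgeSegment_mk.2 ⟨τ / τ', by positivity, div_le_one_of_le₀ hle ht0', rfl⟩)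
      have h3 : dist (b + τ * (a - b)) (b + τ' * (c - b)) =
          τ' * dist c (b + (τ / τ' : ℝ) * (a - b)) := by
        have h4 : (τ' : ℂ) ≠ 0 := by exact_mod_cast h1.ne'
        have h5 : (b + τ' * (c - b)) - (b + τ * (a - b)) =
            (τ' : ℂ) * (c - (b + (τ / τ' : ℝ) * (a - b))) := by
          push_cast; field_simp; ring
        rw [dist_comm, dist_eq_norm, h5, norm_mul, Complex.norm_real, Real.norm_eq_abs,
          abs_of_nonneg ht0', ← dist_eq_norm]
      rw [h3]
      exact (mul_le_mul_of_nonneg_right hle h0).trans (mul_le_mul_of_nonneg_left h2 ht0')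
  rw [hd]
  nlinarith [dist_nonneg (x := a) (y := b)]

/-- Moving a pair of points along two segments until one of them reaches an end. -/
lemma dist_le_of_slide {a b c d : ℂ} {h τ τ' μ ν r : ℝ}
    (ha : ∀ x ∈ edgeSegment s(c, d), h ≤ dist a x) (hb : ∀ x ∈ edgeSegment s(c, d), h ≤ dist b x)
    (hc : ∀ x ∈ edgeSegment s(a, b), h ≤ dist c x) (hd : ∀ x ∈ edgeSegment s(a, b), h ≤ dist d x)
    (ht0 : 0 ≤ τ) (ht1 : τ ≤ 1) (ht0' : 0 ≤ τ') (ht1' : τ' ≤ 1)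
    (hend : ¬ (0 ≤ τ + μ ∧ τ + μ ≤ 1 ∧ 0 ≤ τ' + ν ∧ τ' + ν ≤ 1))
    (hr : ∀ t : ℝ, 0 ≤ t → t ≤ 1 →
      dist (a + (τ + t * μ : ℝ) * (b - a)) (c + (τ' + t * ν : ℝ) * (d - c)) ≤ r) : h ≤ r := by
  -- The smallest of the four margins of the parameters; it vanishes when one of the moving points
  -- first reaches an end of its segment.
  set φ : ℝ → ℝ := fun t =>
    min (min (τ + t * μ) (1 - (τ + t * μ))) (min (τ' + t * ν) (1 - (τ' + t * ν))) with hφ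
  have hcont : Continuous φ := by fun_prop
  have h0 : 0 ≤ φ 0 := by
    simp only [hφ, zero_mul, add_zero, le_min_iff]
    exact ⟨⟨ht0, by linarith⟩, ht0', by linarith⟩
  have h1 : φ 1 ≤ 0 := by
    by_contra! hcon
    simp only [hφ, one_mul, lt_min_iff] at hcon
    exact hend ⟨hcon.1.1.le, by linarith, hcon.2.1.le, by linarith⟩
  obtain ⟨t, ⟨hta, htb⟩, ht⟩ := intermediate_value_Icc' (zero_le_one (α := ℝ)) hcont.continuousOn
    (show (0 : ℝ) ∈ Set.Icc (φ 1) (φ 0) from ⟨h1, h0⟩)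
  have hle := hr t hta htb
  have hnn : 0 ≤ τ + t * μ ∧ τ + t * μ ≤ 1 ∧ 0 ≤ τ' + t * ν ∧ τ' + t * ν ≤ 1 := by
    have : 0 ≤ φ t := ht.ge
    simp only [hφ, le_min_iff] at this
    exact ⟨this.1.1, by linarith, this.2.1, by linarith⟩
  have m1 : a + (τ + t * μ : ℝ) * (b - a) ∈ edgeSegment s(a, b) :=
    mem_edgeSegment_mk.2 ⟨_, hnn.1, hnn.2.1, rfl⟩
  have m2 : c + (τ' + t * ν : ℝ) * (d - c) ∈ edgeSegment s(c, d) :=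
    mem_edgeSegment_mk.2 ⟨_, hnn.2.2.1, hnn.2.2.2, rfl⟩
  have hcases : τ + t * μ = 0 ∨ τ + t * μ = 1 ∨ τ' + t * ν = 0 ∨ τ' + t * ν = 1 := by
    by_contra! hcon
    have : 0 < φ t := by
      simp only [hφ, lt_min_iff]
      refine ⟨⟨lt_of_le_of_ne hnn.1 hcon.1.symm, ?_⟩, lt_of_le_of_ne hnn.2.2.1 hcon.2.2.1.symm, ?_⟩
      · linarith [lt_of_le_of_ne hnn.2.1 hcon.2.1]
      · linarith [lt_of_le_of_ne hnn.2.2.2 hcon.2.2.2]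
    exact this.ne' ht
  rcases hcases with h2 | h2 | h2 | h2 <;> rw [h2] at hle
  · exact (by simpa using ha _ m2 : h ≤ _).trans (by simpa using hle)
  · exact (by simpa using hb _ m2 : h ≤ _).trans (by simpa using hle)
  · have := hc _ m1
    rw [dist_comm] at this
    exact this.trans (by simpa using hle)
  · have := hd _ m1
    rw [dist_comm] at this
    exact this.trans (by simpa using hle)

/-- The distance of two disjoint segments is attained at an end of one of them. -/
lemma dist_side_opposite {a b c d y y' : ℂ} {h : ℝ} (hab : a ≠ b) (hcd : c ≠ d)
    (hdis : Disjoint (edgeSegment s(a, b)) (edgeSegment s(c, d)))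
    (ha : ∀ x ∈ edgeSegment s(c, d), h ≤ dist a x) (hb : ∀ x ∈ edgeSegment s(c, d), h ≤ dist b x)
    (hc : ∀ x ∈ edgeSegment s(a, b), h ≤ dist c x) (hd : ∀ x ∈ edgeSegment s(a, b), h ≤ dist d x)
    (hy : y ∈ edgeSegment s(a, b)) (hy' : y' ∈ edgeSegment s(c, d)) : h ≤ dist y y' := by
  obtain ⟨τ, ht0, ht1, rfl⟩ := mem_edgeSegment_mk.1 hy
  obtain ⟨τ', ht0', ht1', rfl⟩ := mem_edgeSegment_mk.1 hy'
  by_cases hcr : cr (b - a) (d - c) = 0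
  -- Parallel segments: both points move by the same vector, chosen longer than the first segment,
  -- and their distance does not change.
  · obtain ⟨κ, hκ⟩ := exists_eq_mul_of_cr_eq_zero (sub_ne_zero.2 hab.symm) hcr
    have hκ0 : κ ≠ 0 := by
      rintro rfl
      apply hcd
      rw [Complex.ofReal_zero, zero_mul, sub_eq_zero] at hκ
      exact hκ.symm
    refine dist_le_of_slide (μ := 2) (ν := 2 / κ) ha hb hc hd ht0 ht1 ht0' ht1'
      (fun h => by linarith [h.2.1]) fun t _ _ => le_of_eq ?_
    rw [dist_eq_norm, dist_eq_norm]
    congr 1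
    have : (κ : ℂ) ≠ 0 := by exact_mod_cast hκ0
    push_cast
    rw [hκ]
    field_simp; ring
  -- The points move towards the intersection of the two lines. The distance shrinks linearly, and
  -- disjointness makes one of them run off its segment first.
  · have heq := eq_comb_of_cr_ne_zero hcr ((a + τ * (b - a)) - (c + τ' * (d - c)))
    generalize cr ((a + τ * (b - a)) - (c + τ' * (d - c))) (d - c) / cr (b - a) (d - c) = μ at heq
    generalize cr (b - a) ((a + τ * (b - a)) - (c + τ' * (d - c))) / cr (b - a) (d - c) = ν at heq
    refine dist_le_of_slide (μ := -μ) (ν := ν) ha hb hc hd ht0 ht1 ht0' ht1' ?_ ?_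
    · rintro ⟨h1, h2, h3, h4⟩
      refine Set.disjoint_left.1 hdis (mem_edgeSegment_mk.2 ⟨_, h1, h2, rfl⟩)
        (mem_edgeSegment_mk.2 ⟨_, h3, h4, ?_⟩)
      push_cast
      linear_combination heq
    · intro t h0 h1
      have : (a + (τ + t * -μ : ℝ) * (b - a)) - (c + (τ' + t * ν : ℝ) * (d - c)) =
          ((1 - t : ℝ) : ℂ) * ((a + τ * (b - a)) - (c + τ' * (d - c))) := by
        push_cast
        linear_combination (t : ℂ) * heq
      rw [dist_eq_norm, this, norm_mul, Complex.norm_real, Real.norm_eq_abs,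
        abs_of_nonneg (by linarith), ← dist_eq_norm]
      exact mul_le_of_le_one_left dist_nonneg (by linarith)

/-- If two sides of an element come close to each other, then near a common vertex. -/
lemma IsProper.exists_vertex_near (hQ : IsProper Q) (hρ : Q.AspectRatioLE ρ) (h1 : 1 ≤ ρ)
    {e f : Sym2 ℂ} (he : e ∈ Q.sides) (hf : f ∈ Q.sides) (hef : e ≠ f) {y y' : ℂ}
    (hy : y ∈ edgeSegment e) (hy' : y' ∈ edgeSegment f) : ∃ v ∈ e, dist y v ≤ ρ * dist y y' := by
  have h0 : 0 ≤ ρ := by linarith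
  have hpos := hQ.csize_pos
  have hdist : ∀ {v x f}, v ∈ Q.verts → f ∈ Q.sides → v ∉ f → x ∈ edgeSegment f →
      csize Q / ρ ≤ dist v x := by
    intro v x f hv hf hvf hx
    rw [div_le_iff₀' (by linarith)]
    exact hQ.csize_le_dist hρ h0 hv hf hvf hx
  by_cases hcom : ∃ b ∈ e, b ∈ f
  · obtain ⟨b, hbe, hbf⟩ := hcom
    obtain ⟨a, rfl⟩ := hbe
    obtain ⟨c, rfl⟩ := hbf
    refine ⟨b, by simp, ?_⟩
    have hba := hQ.ne _ _ he
    have hbc := hQ.ne _ _ hf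
    have hac : a ≠ c := by rintro rfl; exact hef rfl
    have h2 := dist_side_adjacent (h := csize Q / ρ) (a := a) (b := b) (c := c)
      (fun x hx => hdist ⟨_, he, by simp⟩ hf (by simp [hba.symm, hac]) hx)
      (fun x hx => hdist ⟨_, hf, by simp⟩ he (by simp [hbc.symm, hac.symm]) hx)
      (by positivity) hy hy'
    have h3 := hQ.edgeLength_le he
    rw [edgeLength_mk, dist_comm] at h3
    have h4 : csize Q * dist y b ≤ csize Q * (ρ * dist y y') := by
      calc csize Q * dist y b = ρ * (csize Q / ρ * dist y b) := by field_simp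
        _ ≤ ρ * (dist a b * dist y y') := by gcongr
        _ ≤ ρ * (csize Q * dist y y') := by gcongr
        _ = _ := by ring
    exact le_of_mul_le_mul_left h4 hpos
  · push Not at hcom
    have hdis := hQ.disjoint e he f hf hcom
    induction e with
    | _ a b =>
    induction f with
    | _ c d =>
    refine ⟨a, by simp, ?_⟩
    have hcom' : ∀ v ∈ s(c, d), v ∉ s(a, b) := fun v hv hv' => hcom v hv' hv
    have h2 := dist_side_opposite (h := csize Q / ρ) (hQ.ne _ _ he) (hQ.ne _ _ hf) hdis
      (fun x hx => hdist ⟨_, he, by simp⟩ hf (hcom _ (by simp)) hx)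
      (fun x hx => hdist ⟨_, he, by simp⟩ hf (hcom _ (by simp)) hx)
      (fun x hx => hdist ⟨_, hf, by simp⟩ he (hcom' _ (by simp)) hx)
      (fun x hx => hdist ⟨_, hf, by simp⟩ he (hcom' _ (by simp)) hx) hy hy'
    have h3 := hQ.edgeLength_le he
    rw [edgeLength_mk] at h3
    have h4 : dist y a ≤ dist a b := by
      obtain ⟨t, ht0, ht1, rfl⟩ := mem_edgeSegment_mk.1 hy
      rw [dist_eq_norm, add_sub_cancel_left, norm_mul, Complex.norm_real, Real.norm_eq_abs,
        abs_of_nonneg ht0, dist_comm, dist_eq_norm]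
      exact mul_le_of_le_one_left (norm_nonneg _) ht1
    rw [div_le_iff₀' (by linarith)] at h2
    linarith

/-! ### The number of elements at a vertex -/

/-- For an angle `θ` between the unit vectors these are `2 sin (θ / 2)`, `2 cos (θ / 2)` and `|sin
θ|`. -/
lemma norm_sub_mul_norm_add {p q : ℂ} (hp : ‖p‖ = 1) (hq : ‖q‖ = 1) :
    ‖p - q‖ * ‖p + q‖ = 2 * |cr p q| := by
  have h1 : p.re * p.re + p.im * p.im = 1 := by
    rw [← Complex.normSq_apply, Complex.normSq_eq_norm_sq, hp]; norm_num
  have h2 : q.re * q.re + q.im * q.im = 1 := by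
    rw [← Complex.normSq_apply, Complex.normSq_eq_norm_sq, hq]; norm_num
  rw [← pow_left_inj₀ (by positivity) (by positivity) two_ne_zero, mul_pow, mul_pow, sq_abs,
    ← Complex.normSq_eq_norm_sq, ← Complex.normSq_eq_norm_sq, Complex.normSq_apply,
    Complex.normSq_apply, cr]
  simp only [Complex.sub_re, Complex.sub_im, Complex.add_re, Complex.add_im]
  have e1 : (p.re - q.re) * (p.re - q.re) + (p.im - q.im) * (p.im - q.im) =
      2 - 2 * (p.re * q.re + p.im * q.im) := by linear_combination h1 + h2
  have e2 : (p.re + q.re) * (p.re + q.re) + (p.im + q.im) * (p.im + q.im) =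
      2 + 2 * (p.re * q.re + p.im * q.im) := by linear_combination h1 + h2
  rw [e1, e2]
  linear_combination (-4) * (q.re * q.re + q.im * q.im) * h1 - 4 * h2

/-- Finitely many directions meet all open cones that are not too narrow. -/
lemma exists_directions {δ : ℝ} (hδ : 0 < δ) : ∃ F : Set ℂ, F.Finite ∧ ∀ p q : ℂ, ‖p‖ = 1 → ‖q‖ = 1 →
    δ ≤ ‖p - q‖ → cr p q ≠ 0 → ∃ ω ∈ F, ∃ s t : ℝ, 0 < s ∧ 0 < t ∧ ω = s * p + t * q := by
  -- `F` is a `δ / 2`-net of the circle. The bisecting unit vector is `‖p - q‖ / 2 ≥ δ / 2` away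
  -- from both boundary lines of the cone, so a net point close to it stays inside.
  obtain ⟨F, -, hF, hcov⟩ := (isCompact_sphere (0 : ℂ) 1).finite_cover_balls (half_pos hδ)
  refine ⟨F, hF, fun p q hp hq hpq hcr => ?_⟩
  have hn : 0 < ‖p + q‖ := by
    rw [norm_pos_iff]
    intro h
    rw [add_eq_zero_iff_eq_neg.1 h] at hcr
    simp [cr] at hcr
    exact hcr (by ring)
  set m : ℂ := ((1 / ‖p + q‖ : ℝ) : ℂ) * (p + q) with hm
  have hm1 : m ∈ Metric.sphere (0 : ℂ) 1 := by
    rw [mem_sphere_zero_iff_norm, hm, norm_mul, Complex.norm_real, Real.norm_eq_abs,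
      abs_of_pos (by positivity)]
    field_simp
  obtain ⟨ω, hω, hball⟩ := Set.mem_iUnion₂.1 (hcov hm1)
  have hdist : ‖ω - m‖ < δ / 2 := by rwa [← dist_eq_norm, dist_comm]
  have hκ : δ / 2 ≤ |cr p q| / ‖p + q‖ := by
    rw [le_div_iff₀ hn]
    have := norm_sub_mul_norm_add hp hq
    nlinarith
  have key : ∀ r : ℝ, |r| < δ / 2 → 0 < (cr p q / ‖p + q‖ + r) / cr p q := by
    intro r hr
    have h1 : |r| < |cr p q / ‖p + q‖| := by
      rw [abs_div, abs_of_pos hn]; linarith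
    rcases lt_or_gt_of_ne hcr with h | h
    · apply div_pos_of_neg_of_neg _ h
      rw [abs_of_neg (div_neg_of_neg_of_pos h hn)] at h1
      linarith [le_abs_self r]
    · apply div_pos _ h
      rw [abs_of_pos (div_pos h hn)] at h1
      linarith [neg_abs_le r]
  have e1 : cr p ω = cr p q / ‖p + q‖ + cr p (ω - m) := by
    have : cr p ω = cr p m + cr p (ω - m) := by rw [← cr_add_right]; congr 1; ring
    rw [this, hm, cr_mul_right, cr_add_right, cr_self]; ring
  have e2 : cr ω q = cr p q / ‖p + q‖ + cr (ω - m) q := by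
    have h1 : cr q ω = cr q m + cr q (ω - m) := by rw [← cr_add_right]; congr 1; ring
    rw [cr_swap q ω, cr_swap q (ω - m), h1, hm, cr_mul_right, cr_add_right, cr_self, cr_swap p q]
    ring
  refine ⟨ω, hω, _, _, ?_, ?_, eq_comb_of_cr_ne_zero hcr ω⟩
  · rw [e2]
    refine key _ (lt_of_le_of_lt (abs_cr_le _ _) ?_)
    rwa [hq, mul_one]
  · rw [e1]
    refine key _ (lt_of_le_of_lt (abs_cr_le _ _) ?_)
    rwa [hp, one_mul]

/-- Two sides of an element at a vertex do not have almost the same direction. -/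
lemma IsProper.direction_sep (hQ : IsProper Q) (hρ : Q.AspectRatioLE ρ) (h1 : 1 ≤ ρ) {v x y : ℂ}
    (hxy : x ≠ y) (hx : s(v, x) ∈ Q.sides) (hy : s(v, y) ∈ Q.sides) :
    1 / ρ ≤ ‖(x - v) / (‖x - v‖ : ℂ) - (y - v) / (‖y - v‖ : ℂ)‖ := by
  wlog hle : ‖x - v‖ ≤ ‖y - v‖ generalizing x y
  · rw [norm_sub_rev]
    exact this hxy.symm hy hx (not_le.1 hle).le
  have hvx := hQ.ne _ _ hx
  have hvy := hQ.ne _ _ hy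
  have hnx : 0 < ‖x - v‖ := norm_pos_iff.2 (sub_ne_zero.2 hvx.symm)
  have hny : 0 < ‖y - v‖ := norm_pos_iff.2 (sub_ne_zero.2 hvy.symm)
  have h2 := hQ.csize_le_dist hρ (by linarith) (v := x) ⟨_, hx, by simp⟩ hy
    (by simp [hvx.symm, hxy])
    (mem_edgeSegment_mk.2 ⟨‖x - v‖ / ‖y - v‖, by positivity, div_le_one_of_le₀ hle hny.le, rfl⟩)
  have h3 : dist x (v + ((‖x - v‖ / ‖y - v‖ : ℝ) : ℂ) * (y - v)) =
      ‖x - v‖ * ‖(x - v) / (‖x - v‖ : ℂ) - (y - v) / (‖y - v‖ : ℂ)‖ := by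
    rw [dist_eq_norm]
    have : x - (v + ((‖x - v‖ / ‖y - v‖ : ℝ) : ℂ) * (y - v)) =
      (‖x - v‖ : ℂ) * ((x - v) / (‖x - v‖ : ℂ) - (y - v) / (‖y - v‖ : ℂ)) := by
      have hx' : (‖x - v‖ : ℂ) ≠ 0 := by exact_mod_cast hnx.ne'
      have hy' : (‖y - v‖ : ℂ) ≠ 0 := by exact_mod_cast hny.ne'
      push_cast; field_simp; ring
    rw [this, norm_mul, Complex.norm_real, norm_norm]
  have h4 := hQ.edgeLength_le hx
  rw [edgeLength_mk, dist_comm, dist_eq_norm] at h4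
  rw [h3] at h2
  rw [div_le_iff₀' (by linarith)]
  by_contra! hcon
  nlinarith

/-- Seen from `v`, the element `Q` extends in direction `ω`. -/
def Sees (Q : Cell) (v ω : ℂ) : Prop :=
  ∃ ε > 0, ∀ η : ℝ, 0 < η → η < ε →
    v + η * ω ∈ Q.region ∧ ∀ f ∈ Q.sides, v + η * ω ∉ edgeSegment f

/-- The sides not at `v` are at distance at least `csize Q / ρ` from `v`, so only the sides at `v`
matter nearby. -/
lemma InnerCone.sees {v p q : ℂ} (hQ : IsProper Q) (hρ : Q.AspectRatioLE ρ) (h1 : 1 ≤ ρ)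
    (hv : v ∈ Q.verts) (h : InnerCone Q v p q) {s t : ℝ} (hs : 0 < s) (ht : 0 < t) :
    Sees Q v (s * p + t * q) := by
  obtain ⟨ε, hε, hin⟩ := h.2 s t hs ht
  set ω : ℂ := s * p + t * q with hω
  have hpos := hQ.csize_pos
  refine ⟨min ε (csize Q / (ρ * (‖ω‖ + 1))), by positivity, fun η h0 hη => ?_⟩
  obtain ⟨hη1, hη2⟩ := lt_min_iff.1 hη
  refine ⟨(hin η h0 hη1).1, fun f hf hmem => ?_⟩
  by_cases hvf : v ∈ f
  · exact (hin η h0 hη1).2 f hf hvf hmem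
  · have h2 := hQ.csize_le_dist hρ (by linarith) hv hf hvf hmem
    rw [dist_comm, dist_eq_norm, add_sub_cancel_left, norm_mul, Complex.norm_real, Real.norm_eq_abs,
      abs_of_pos h0] at h2
    rw [lt_div_iff₀ (by positivity)] at hη2
    nlinarith [mul_pos h0 (by linarith : 0 < ρ)]

/-- If the angle is split by a diagonal, one of the two parts keeps at least half of the separation
`1 / ρ` of the sides; hence the net for `1 / (2 * ρ)`. -/
lemma exists_directions_sees {ρ : ℝ} (h1 : 1 ≤ ρ) : ∃ F : Set ℂ, F.Finite ∧ ∀ Q : Cell, IsProper Q →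
    Q.AspectRatioLE ρ → ∀ v ∈ Q.verts, ∃ ω ∈ F, Sees Q v ω := by
  have hρ0 : 0 < ρ := by linarith
  obtain ⟨F, hF, hdir⟩ := exists_directions (δ := 1 / (2 * ρ)) (by positivity)
  refine ⟨F, hF, fun Q hQ hρ v hv => ?_⟩
  have key : ∀ p q : ℂ, p ≠ 0 → q ≠ 0 → InnerCone Q v p q →
      1 / (2 * ρ) ≤ ‖p / (‖p‖ : ℂ) - q / (‖q‖ : ℂ)‖ → ∃ ω ∈ F, Sees Q v ω := by
    intro p q hp hq hcone hpq
    have hp' : 0 < ‖p‖ := norm_pos_iff.2 hp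
    have hq' : 0 < ‖q‖ := norm_pos_iff.2 hq
    have e : ∀ p : ℂ, p / (‖p‖ : ℂ) = ((1 / ‖p‖ : ℝ) : ℂ) * p := by
      intro p; push_cast; ring
    obtain ⟨ω, hω, s, t, hs, ht, rfl⟩ := hdir (p / (‖p‖ : ℂ)) (q / (‖q‖ : ℂ))
      (by rw [norm_div, Complex.norm_real, norm_norm, div_self hp'.ne'])
      (by rw [norm_div, Complex.norm_real, norm_norm, div_self hq'.ne']) hpq (by
        rw [e p, e q, cr_mul_right, cr_swap, cr_mul_right, cr_swap]
        have := hcone.1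
        simp only [ne_eq, mul_eq_zero, neg_eq_zero, not_or]
        refine ⟨by positivity, by positivity, by simpa using this⟩)
    refine ⟨_, hω, ?_⟩
    have := hcone.sees hQ hρ h1 hv (s := s / ‖p‖) (t := t / ‖q‖) (by positivity) (by positivity)
    convert this using 1
    push_cast; ring
  obtain ⟨x, y, hxy, hx, hy, hc⟩ := hQ.cone v hv
  have hsep := hQ.direction_sep hρ h1 hxy hx hy
  have hvx : x - v ≠ 0 := sub_ne_zero.2 (hQ.ne _ _ hx).symm
  have hvy : y - v ≠ 0 := sub_ne_zero.2 (hQ.ne _ _ hy).symm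
  have hhalf : 1 / ρ = 1 / (2 * ρ) + 1 / (2 * ρ) := by field_simp; norm_num
  rcases hc with hc | ⟨c, hcv, hc1, hc2⟩
  · refine key _ _ hvx hvy hc ?_
    have : 0 < 1 / (2 * ρ) := by positivity
    linarith
  · have hvc : c - v ≠ 0 := sub_ne_zero.2 hcv
    by_contra hcon
    have n1 : ‖(x - v) / (‖x - v‖ : ℂ) - (c - v) / (‖c - v‖ : ℂ)‖ < 1 / (2 * ρ) := by
      by_contra! h; exact hcon (key _ _ hvx hvc hc1 h)
    have n2 : ‖(y - v) / (‖y - v‖ : ℂ) - (c - v) / (‖c - v‖ : ℂ)‖ < 1 / (2 * ρ) := by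
      by_contra! h; exact hcon (key _ _ hvy hvc hc2 h)
    rw [norm_sub_rev] at n2
    have := norm_sub_le_norm_sub_add_norm_sub ((x - v) / (‖x - v‖ : ℂ))
      ((c - v) / (‖c - v‖ : ℂ)) ((y - v) / (‖y - v‖ : ℂ))
    linarith

lemma IsBoundedAspectMesh.isProper {Ω : Set ℂ} {N : Set Cell} (hN : IsBoundedAspectMesh ρ Ω N)
    (hQ : Q ∈ N) : IsProper Q :=
  (hN.shape Q hQ).elim IsTriangle.isProper IsQuadrilateral.isProper

/-- Just off `v` in direction `ω` the two elements share a point on no side of `Q`, which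
edge-to-edge meshes forbid for different elements. -/
lemma eq_of_sees {N : Set Cell} (hN : EdgeToEdge N) {Q R : Cell} (hQ : Q ∈ N) (hR : R ∈ N) {v ω : ℂ}
    (h1 : Sees Q v ω) (h2 : Sees R v ω) : Q = R := by
  by_contra hne
  obtain ⟨ε₁, hε₁, h1⟩ := h1
  obtain ⟨ε₂, hε₂, h2⟩ := h2
  have hpos : 0 < min ε₁ ε₂ := lt_min hε₁ hε₂
  obtain ⟨a1, a2⟩ := h1 (min ε₁ ε₂ / 2) (by positivity)
    (lt_of_lt_of_le (half_lt_self hpos) (min_le_left _ _))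
  obtain ⟨b1, -⟩ := h2 (min ε₁ ε₂ / 2) (by positivity)
    (lt_of_lt_of_le (half_lt_self hpos) (min_le_right _ _))
  rcases hN Q hQ R hR hne _ ⟨a1, b1⟩ with h | ⟨e, he, hmem⟩
  · obtain ⟨f, hf, hvf⟩ := h.1
    exact a2 f hf (mem_edgeSegment_of_mem hvf)
  · exact a2 e he.1 hmem

/-- The number of elements at a vertex is bounded in terms of the aspect ratio. -/
lemma exists_degree_bound {ρ : ℝ} (h1 : 1 ≤ ρ) : ∃ B : ℕ, ∀ (Ω : Set ℂ) (N : Set Cell),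
    IsBoundedAspectMesh ρ Ω N → ∀ v, {Q ∈ N | v ∈ Q.verts}.ncard ≤ B := by
  obtain ⟨F, hF, hsees⟩ := exists_directions_sees h1
  refine ⟨F.ncard, fun Ω N hN v => ?_⟩
  have hex : ∀ Q : Cell, ∃ ω, Q ∈ N → v ∈ Q.verts → ω ∈ F ∧ Sees Q v ω := by
    intro Q
    by_cases h : Q ∈ N ∧ v ∈ Q.verts
    · obtain ⟨ω, h3, h4⟩ := hsees Q (hN.isProper h.1) (hN.aspect Q h.1) v h.2
      exact ⟨ω, fun _ _ => ⟨h3, h4⟩⟩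
    · exact ⟨0, fun h3 h4 => (h ⟨h3, h4⟩).elim⟩
  choose g hg using hex
  refine Set.ncard_le_ncard_of_injOn g (fun Q hQ => (hg Q hQ.1 hQ.2).1) ?_ hF
  intro Q hQ R hR hQR
  refine eq_of_sees hN.edgeToEdge hQ.1 hR.1 (hg Q hQ.1 hQ.2).2 ?_
  rw [hQR]
  exact (hg R hR.1 hR.2).2

end

section

/-! ### Following a path through a mesh -/

variable {N : Set Cell} {ρ : ℝ} {Ω : Set ℂ}

/-- A path in the union of a mesh stays in a family of elements that it cannot leave. -/
lemma mem_of_path (hfin : N.Finite) (hcl : ∀ Q ∈ N, IsClosed Q.region) {γ : ℝ → ℂ} {t₀ : ℝ}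
    (ht₀ : t₀ ≤ 1) (hγ : ContinuousOn γ (Set.Icc t₀ 1))
    (hcov : ∀ t ∈ Set.Icc t₀ 1, ∃ Q ∈ N, γ t ∈ Q.region) {G : Set Cell} (hG : G ⊆ N)
    (hstart : ∃ Q ∈ G, γ t₀ ∈ Q.region)
    (hstep : ∀ t ∈ Set.Icc t₀ 1, ∀ S ∈ G, ∀ S' ∈ N, S ≠ S' → γ t ∈ S.region → γ t ∈ S'.region →
      S' ∈ G) {R : Cell} (hR : R ∈ N) (hγR : γ 1 ∈ R.region) : R ∈ G := by
  by_contra hRG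
  have hconn := isPreconnected_Icc.image γ hγ
  have hA : IsClosed (⋃ S ∈ G, S.region) :=
    (hfin.subset hG).isClosed_biUnion fun S hS => hcl S (hG hS)
  have hB : IsClosed (⋃ S ∈ N \ G, S.region) :=
    (hfin.subset Set.sdiff_subset).isClosed_biUnion fun S hS => hcl S hS.1
  obtain ⟨Q, hQ, hQm⟩ := hstart
  obtain ⟨_, ⟨t, ht, rfl⟩, hxA, hxB⟩ := isPreconnected_closed_iff.1 hconn _ _ hA hB
    (by
      rintro _ ⟨t, ht, rfl⟩
      obtain ⟨Q, hQ, hQm⟩ := hcov t ht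
      by_cases h : Q ∈ G
      · exact Or.inl (Set.mem_biUnion h hQm)
      · exact Or.inr (Set.mem_biUnion (show Q ∈ N \ G from ⟨hQ, h⟩) hQm))
    ⟨_, ⟨t₀, ⟨le_rfl, ht₀⟩, rfl⟩, Set.mem_biUnion hQ hQm⟩
    ⟨_, ⟨1, ⟨ht₀, le_rfl⟩, rfl⟩, Set.mem_biUnion (show R ∈ N \ G from ⟨hR, hRG⟩) hγR⟩
  obtain ⟨S, hS, hSm⟩ := Set.mem_iUnion₂.1 hxA
  obtain ⟨S', hS', hSm'⟩ := Set.mem_iUnion₂.1 hxB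
  exact hS'.2 (hstep t ht S hS S' hS'.1 (by rintro rfl; exact hS'.2 hS) hSm hSm')

/-- Two elements of `N` are adjacent at `v` if they share a side at `v`. -/
def starGraph (N : Set Cell) (v : ℂ) : SimpleGraph Cell where
  Adj Q R := Q ≠ R ∧ Q ∈ N ∧ R ∈ N ∧ ∃ e, e ∈ Q.sides ∧ e ∈ R.sides ∧ v ∈ e
  symm := ⟨fun _ _ h => ⟨h.1.symm, h.2.2.1, h.2.1, h.2.2.2.imp fun _ h => ⟨h.2.1, h.1, h.2.2⟩⟩⟩
  loopless := ⟨fun _ h => h.1 rfl⟩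

lemma mem_of_starGraph_walk {v : ℂ} {Q R : Cell} (p : (starGraph N v).Walk Q R) (hQ : Q ∈ N)
    (hv : v ∈ Q.verts) : ∀ S ∈ p.support, S ∈ N ∧ v ∈ S.verts := by
  induction p with
  | nil => simpa using ⟨hQ, hv⟩
  | cons h p ih =>
    intro S hS
    rw [SimpleGraph.Walk.support_cons, List.mem_cons] at hS
    rcases hS with rfl | hS
    · exact ⟨hQ, hv⟩
    · obtain ⟨-, -, h2, e, -, h3, h4⟩ := h
      exact ih h2 ⟨e, h3, h4⟩ S hS

lemma csize_le_of_side (hN : IsBoundedAspectMesh ρ Ω N) (h1 : 1 ≤ ρ) {Q R : Cell} (hQ : Q ∈ N)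
    (hR : R ∈ N) {e : Sym2 ℂ} (heQ : e ∈ Q.sides) (heR : e ∈ R.sides) : csize Q ≤ ρ * csize R :=
  ((hN.isProper hQ).csize_le_edgeLength (hN.aspect Q hQ) (by linarith) heQ).trans
    (mul_le_mul_of_nonneg_left ((hN.isProper hR).edgeLength_le heR) (by linarith))

lemma csize_le_of_starGraph_walk (hN : IsBoundedAspectMesh ρ Ω N) (h1 : 1 ≤ ρ) {v : ℂ} {Q R : Cell}
    (p : (starGraph N v).Walk Q R) : csize Q ≤ ρ ^ p.length * csize R := by
  induction p with
  | nil => simp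
  | cons h p ih =>
    rw [SimpleGraph.Walk.length_cons, pow_succ', mul_assoc]
    obtain ⟨-, h2, h3, e, h4, h5, -⟩ := h
    have := csize_le_of_side hN h1 h2 h3 h4 h5
    exact this.trans (mul_le_mul_of_nonneg_left ih (by linarith))

/-- A path without repetition around `v` has at most `B` elements, and each step costs a factor `ρ`.
-/
lemma csize_le_of_reachable (hN : IsBoundedAspectMesh ρ Ω N) (h1 : 1 ≤ ρ) {v : ℂ} {B : ℕ}
    (hB : {Q ∈ N | v ∈ Q.verts}.ncard ≤ B) {Q R : Cell} (hQ : Q ∈ N) (hv : v ∈ Q.verts)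
    (h : (starGraph N v).Reachable Q R) : csize Q ≤ ρ ^ B * csize R ∧ R ∈ N ∧ v ∈ R.verts := by
  classical
  obtain ⟨p, hp⟩ := h.exists_isPath
  have hmem := mem_of_starGraph_walk p hQ hv
  have hR := hmem R p.end_mem_support
  refine ⟨(csize_le_of_starGraph_walk hN h1 p).trans (mul_le_mul_of_nonneg_right
    (pow_le_pow_right₀ h1 ?_) (hN.isProper hR.1).csize_pos.le), hR⟩
  have hfin : {Q ∈ N | v ∈ Q.verts}.Finite := hN.finite.subset fun Q hQ => hQ.1
  have h2 : (p.support.toFinset : Set Cell) ⊆ {Q ∈ N | v ∈ Q.verts} := fun S hS =>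
    hmem S (by simpa using hS)
  have h3 := (Set.ncard_le_ncard h2 hfin).trans hB
  rw [Set.ncard_coe_finset, List.toFinset_card_of_nodup hp.support_nodup,
    SimpleGraph.Walk.length_support] at h3
  omega

lemma exists_common_side (hN : IsBoundedAspectMesh ρ Ω N) {x : ℂ}
    (hx : ∀ Q ∈ N, x ∉ Q.verts) {S S' : Cell} (hS : S ∈ N) (hS' : S' ∈ N) (hne : S ≠ S')
    (h : x ∈ S.region) (h' : x ∈ S'.region) : ∃ e, e ∈ S.sides ∧ e ∈ S'.sides ∧ x ∈ edgeSegment e := by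
  rcases hN.edgeToEdge S hS S' hS' hne x ⟨h, h'⟩ with hv | ⟨e, he, hmem⟩
  · exact (hx S hS hv.1).elim
  · exact ⟨e, he.1, he.2, hmem⟩

/-- The sizes of the elements at the ends of a path that avoids the vertices. -/
lemma csize_le_of_path (hN : IsBoundedAspectMesh ρ Ω N) (h1 : 1 ≤ ρ) {B : ℕ}
    (hB : ∀ v, {Q ∈ N | v ∈ Q.verts}.ncard ≤ B) {γ : ℝ → ℂ} {L : ℝ}
    (hγ : ContinuousOn γ (Set.Icc 0 1)) (hΩ : ∀ t ∈ Set.Icc (0 : ℝ) 1, γ t ∈ Ω)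
    (hV : ∀ t ∈ Set.Icc (0 : ℝ) 1, ∀ Q ∈ N, γ t ∉ Q.verts)
    (hL : ∀ s ∈ Set.Icc (0 : ℝ) 1, ∀ t ∈ Set.Icc (0 : ℝ) 1, dist (γ s) (γ t) ≤ L) {R R' : Cell}
    (hR : R ∈ N) (hR' : R' ∈ N) (h0 : γ 0 ∈ R.region) (h1' : γ 1 ∈ R'.region) :
    csize R ≤ ρ ^ (B + 1) * (ρ + 2) * (L + csize R') := by
  have hcl : ∀ Q ∈ N, IsClosed Q.region := fun Q hQ => (hN.isProper hQ).closed
  have hcov : ∀ t ∈ Set.Icc (0 : ℝ) 1, ∃ Q ∈ N, γ t ∈ Q.region := by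
    intro t ht
    simpa using hN.covers (hΩ t ht)
  have hL0 : 0 ≤ L := dist_nonneg.trans (hL 0 (by simp) 0 (by simp))
  have hpos := (hN.isProper hR').csize_pos
  have hρB : 1 ≤ ρ ^ B := one_le_pow₀ h1
  have hρ0 : 0 < ρ := by linarith
  have hpB : ρ ^ B ≤ ρ ^ (B + 1) := pow_le_pow_right₀ h1 (Nat.le_succ B)
  have hend : ∀ c, c ≤ ρ ^ (B + 1) → csize R ≤ c * csize R' →
      csize R ≤ ρ ^ (B + 1) * (ρ + 2) * (L + csize R') := by
    intro c hc h
    calc csize R ≤ c * csize R' := h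
      _ ≤ ρ ^ (B + 1) * csize R' := by gcongr
      _ ≤ ρ ^ (B + 1) * (ρ + 2) * (L + csize R') := by
        rw [mul_assoc]
        refine mul_le_mul_of_nonneg_left ?_ (by positivity)
        nlinarith
  -- Close to a vertex `v` of `R`, the path remains within `(ρ + 2) * L` of `v`. If it leaves the
  -- elements reachable around `v`, it crosses a side not at `v`, which bounds the size by this
  -- distance.
  by_cases hnear : ∃ v ∈ R.verts, dist (γ 0) v ≤ (ρ + 1) * L
  · obtain ⟨v, hv, hd⟩ := hnear
    by_contra! hlt
    have hG := mem_of_path hN.finite hcl zero_le_one hγ hcov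
      (G := {S | (starGraph N v).Reachable R S})
      (fun S hS => (csize_le_of_reachable hN h1 (hB v) hR hv hS).2.1)
      ⟨R, SimpleGraph.Reachable.refl R, h0⟩ ?_ hR' h1'
    · exact absurd (hend _ hpB (csize_le_of_reachable hN h1 (hB v) hR hv hG).1) (not_le.2 hlt)
    · intro t ht S hS S' hS' hne hm hm'
      obtain ⟨h2, h3, h4⟩ := csize_le_of_reachable hN h1 (hB v) hR hv hS
      obtain ⟨e, h5, h6, h7⟩ := exists_common_side hN (hV t ht) h3 hS' hne hm hm'
      by_cases hve : v ∈ e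
      · exact SimpleGraph.Reachable.trans hS
          (SimpleGraph.Adj.reachable ⟨hne, h3, hS', e, h5, h6, hve⟩)
      · exfalso
        have h8 := (hN.isProper h3).csize_le_dist (hN.aspect S h3) hρ0.le h4 h5 hve h7
        have h9 : dist v (γ t) ≤ (ρ + 2) * L := by
          have := dist_triangle v (γ 0) (γ t)
          rw [dist_comm] at hd
          linarith [hL 0 (by simp) t ht]
        have h10 : csize R ≤ ρ ^ (B + 1) * (ρ + 2) * L := by
          calc csize R ≤ ρ ^ B * csize S := h2
            _ ≤ ρ ^ B * (ρ * ((ρ + 2) * L)) := by gcongr; exact h8.trans (by gcongr)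
            _ = _ := by ring
        have h11 : 0 < ρ ^ (B + 1) * (ρ + 2) * csize R' := by positivity
        linarith
  -- Away from the vertices, the path leaves `R` through a side `e`. Reaching another side of an
  -- element at `e` would put it within `ρ * L` of an end of `e`, hence its start within `(ρ + 1) *
  -- L` of a vertex of `R`.
  · push Not at hnear
    by_cases hRR : R' = R
    · refine hend 1 (hρB.trans hpB) ?_
      rw [hRR, one_mul]
    have hex : ∃ t ∈ Set.Icc (0 : ℝ) 1, ∃ S ∈ N, R ≠ S ∧ γ t ∈ R.region ∧ γ t ∈ S.region := by
      by_contra! hcon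
      refine hRR (mem_of_path hN.finite hcl zero_le_one hγ hcov (G := {R}) (by simpa using hR)
        ⟨R, rfl, h0⟩ ?_ hR' h1')
      rintro t ht S rfl S' hS' hne hm hm'
      exact (hcon t ht S' hS' hne hm hm').elim
    obtain ⟨t₀, ht₀, S₀, hS₀, hne₀, hm₀, hm₀'⟩ := hex
    obtain ⟨e, heR, -, hye⟩ := exists_common_side hN (hV t₀ ht₀) hR hS₀ hne₀ hm₀ hm₀'
    have hsub : Set.Icc t₀ 1 ⊆ Set.Icc (0 : ℝ) 1 := Set.Icc_subset_Icc_left ht₀.1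
    have hG := mem_of_path hN.finite hcl ht₀.2 (hγ.mono hsub) (fun t ht => hcov t (hsub ht))
      (G := {S ∈ N | e ∈ S.sides}) (fun S hS => hS.1) ⟨R, ⟨hR, heR⟩, hm₀⟩ ?_ hR' h1'
    · refine hend ρ ?_ (csize_le_of_side hN h1 hR hR' heR hG.2)
      rw [pow_succ]
      exact le_mul_of_one_le_left hρ0.le hρB
    · rintro t ht S ⟨hS, heS⟩ S' hS' hne hm hm'
      obtain ⟨f, h5, h6, h7⟩ := exists_common_side hN (hV t (hsub ht)) hS hS' hne hm hm'
      by_cases hef : e = f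
      · exact ⟨hS', hef ▸ h6⟩
      · exfalso
        obtain ⟨v, hve, hvd⟩ := (hN.isProper hS).exists_vertex_near (hN.aspect S hS) h1 heS h5 hef
          hye h7
        have h8 := hnear v ⟨e, heR, hve⟩
        have h9 := dist_triangle (γ 0) (γ t₀) v
        have h10 := hL 0 (by simp) t₀ ht₀
        have h11 := mul_le_mul_of_nonneg_left (hL t₀ ht₀ t (hsub ht)) hρ0.le
        linarith

/-! ### Avoiding the vertices -/

/-- The bad translations `v - γ t` form a set of Hausdorff dimension at most one, so good ones are
dense in the plane. -/
lemma exists_shift {V : Set ℂ} (hV : V.Finite) {γ : ℝ → ℂ} {c : ℝ}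
    (hγ : ∀ s ∈ Set.Icc (0 : ℝ) 1, ∀ t ∈ Set.Icc (0 : ℝ) 1, dist (γ s) (γ t) ≤ c * |s - t|)
    {ε : ℝ} (hε : 0 < ε) : ∃ w : ℂ, ‖w‖ < ε ∧ ∀ t ∈ Set.Icc (0 : ℝ) 1, γ t + w ∉ V := by
  have hdim : dimH (⋃ v ∈ V, (fun t => v - γ t) '' Set.Icc 0 1) < Module.finrank ℝ ℂ := by
    rw [dimH_bUnion hV.countable, Complex.finrank_real_complex]
    refine lt_of_le_of_lt (b := 1) (iSup₂_le fun v _ => ?_) (by norm_num)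
    have hlip : LipschitzOnWith c.toNNReal (fun t => v - γ t) (Set.Icc 0 1) := by
      refine LipschitzOnWith.of_dist_le_mul fun s hs t ht => ?_
      rw [dist_sub_left]
      refine (hγ s hs t ht).trans ?_
      rw [Real.dist_eq]
      exact mul_le_mul_of_nonneg_right (Real.le_coe_toNNReal c) (abs_nonneg _)
    exact hlip.dimH_image_le.trans ((dimH_mono (Set.subset_univ _)).trans_eq Real.dimH_univ)
  obtain ⟨w, hw, hb⟩ := (dense_compl_of_dimH_lt_finrank hdim).exists_dist_lt 0 hε
  refine ⟨w, by rwa [dist_comm, dist_zero_right] at hb, fun t ht hmem => hw ?_⟩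
  exact Set.mem_biUnion hmem ⟨t, ht, by ring⟩

/-- The elements missing `p` have a closed union. A small translation of the path therefore ends in
elements that still contain the original end points. -/
lemma IsBoundedAspectMesh.exists_ball (hN : IsBoundedAspectMesh ρ Ω N) (p : ℂ) :
    ∃ ε > 0, ∀ Q ∈ N, ∀ q, dist q p < ε → q ∈ Q.region → p ∈ Q.region := by
  have hcl : IsClosed (⋃ Q ∈ {Q ∈ N | p ∉ Q.region}, Q.region) :=
    (hN.finite.subset fun Q hQ => hQ.1).isClosed_biUnion fun Q hQ => (hN.isProper hQ.1).closed
  have hp : p ∈ (⋃ Q ∈ {Q ∈ N | p ∉ Q.region}, Q.region)ᶜ := by simp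
  obtain ⟨ε, hε, hb⟩ := Metric.isOpen_iff.1 hcl.isOpen_compl p hp
  refine ⟨ε, hε, fun Q hQ q hq hqQ => ?_⟩
  by_contra hpQ
  exact hb hq (Set.mem_biUnion (show Q ∈ {Q ∈ N | p ∉ Q.region} from ⟨hQ, hpQ⟩) hqQ)

lemma IsProper.finite_verts {Q : Cell} (hQ : IsProper Q) : Q.verts.Finite := by
  have : Q.verts = ⋃ e ∈ Q.sides, {v | v ∈ e} := by ext v; simp [Cell.verts]
  rw [this]
  refine hQ.finite.biUnion fun e _ => ?_
  induction e with
  | _ a b => simp [Set.ofPred_or]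

lemma IsBoundedAspectMesh.exists_csize_le (hN : IsBoundedAspectMesh ρ Ω N) (h1 : 1 ≤ ρ) {B : ℕ}
    (hB : ∀ v, {Q ∈ N | v ∈ Q.verts}.ncard ≤ B) {Λ : ℝ} (hΛ : 0 ≤ Λ) (hΩ : IsQuasiconvexDomain Λ Ω)
    {σ : ℂ → ℝ} (hσ : ∀ p ∈ Ω, 0 < σ p) (hob : ObeysSize Ω σ N) {x y : ℂ} (hx : x ∈ interior Ω)
    (hy : y ∈ Ω) : ∃ R ∈ N, x ∈ R.region ∧
      csize R ≤ ρ ^ (B + 1) * (ρ + 2) * (Λ + 1) * (dist x y + σ y) := by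
  obtain ⟨εx, hεx, hballx⟩ := hN.exists_ball x
  obtain ⟨εy, hεy, hbally⟩ := hN.exists_ball y
  have hσy := hσ y hy
  obtain ⟨y', hy', hyy⟩ := Metric.mem_closure_iff.1 (hΩ.subset_closure hy) (min (εy / 2) (σ y))
    (by positivity)
  obtain ⟨hyy1, hyy2⟩ := lt_min_iff.1 hyy
  obtain ⟨γ, hγ0, hγ1, hγin, hγL⟩ := hΩ.path x hx y' hy'
  have hcont : ContinuousOn γ (Set.Icc 0 1) := by
    have hlip : LipschitzOnWith (Λ * dist x y').toNNReal γ (Set.Icc 0 1) := by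
      refine LipschitzOnWith.of_dist_le_mul fun s hs t ht => (hγL s hs t ht).trans ?_
      rw [Real.dist_eq]
      exact mul_le_mul_of_nonneg_right (Real.le_coe_toNNReal _) (abs_nonneg _)
    exact hlip.continuousOn
  obtain ⟨δ, hδ, hthick⟩ := (isCompact_Icc.image_of_continuousOn hcont).exists_thickening_subset_open
    isOpen_interior (Set.image_subset_iff.2 hγin)
  have hVfin : (⋃ Q ∈ N, Q.verts).Finite :=
    hN.finite.biUnion fun Q hQ => (hN.isProper hQ).finite_verts
  obtain ⟨w, hw, hwV⟩ := exists_shift hVfin hγL (ε := min δ (min εx (εy / 2))) (by positivity)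
  obtain ⟨hw1, hw2, hw3⟩ : ‖w‖ < δ ∧ ‖w‖ < εx ∧ ‖w‖ < εy / 2 := by
    simpa [lt_min_iff] using hw
  have hin : ∀ t ∈ Set.Icc (0 : ℝ) 1, γ t + w ∈ Ω := fun t ht =>
    interior_subset (hthick (Metric.mem_thickening_iff.2
      ⟨γ t, ⟨t, ht, rfl⟩, by simpa [dist_eq_norm] using hw1⟩))
  obtain ⟨R, hR, hxR⟩ : ∃ Q ∈ N, γ 0 + w ∈ Q.region := by simpa using hN.covers (hin 0 (by simp))
  obtain ⟨R', hR', hyR⟩ : ∃ Q ∈ N, γ 1 + w ∈ Q.region := by simpa using hN.covers (hin 1 (by simp))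
  refine ⟨R, hR, hballx R hR _ (by rw [hγ0]; simpa [dist_eq_norm] using hw2) hxR, ?_⟩
  have hyR' : y ∈ R'.region := by
    refine hbally R' hR' _ ?_ hyR
    rw [hγ1]
    have h2 : dist (y' + w) y' = ‖w‖ := by simp [dist_eq_norm]
    have h3 := dist_triangle (y' + w) y' y
    rw [dist_comm y' y] at h3
    linarith
  have hcs : csize R' ≤ σ y := by
    obtain ⟨e, he, h⟩ := (hN.isProper hR').exists_edgeLength_eq
    rw [← h]
    exact hob R' hR' y ⟨hyR', hy⟩ e he
  have hmain := csize_le_of_path (L := Λ * dist x y') hN h1 hB (γ := fun t => γ t + w)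
    (hcont.add continuousOn_const) hin
    (fun t ht Q hQ hm => hwV t ht (Set.mem_biUnion hQ hm))
    (fun s hs t ht => by
      rw [dist_add_right]
      refine (hγL s hs t ht).trans (mul_le_of_le_one_right (by positivity) ?_)
      rw [abs_le]
      constructor <;> linarith [hs.1, hs.2, ht.1, ht.2]) hR hR' hxR hyR
  refine hmain.trans ?_
  rw [mul_assoc _ (Λ + 1)]
  refine mul_le_mul_of_nonneg_left ?_ (by positivity)
  have h4 := dist_triangle x y y'
  have h5 : Λ * dist x y' ≤ Λ * (dist x y + σ y) := mul_le_mul_of_nonneg_left (by linarith) hΛ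
  have h6 : 0 ≤ dist x y := dist_nonneg
  linarith

/-- The elements of a mesh of bounded aspect ratio that obeys `σ` are not larger than the local
feature size. -/
lemma exists_csize_bound {ρ Λ : ℝ} (h1 : 1 ≤ ρ) (hΛ : 0 ≤ Λ) : ∃ A : ℝ, 1 ≤ A ∧
    ∀ (Ω : Set ℂ) (σ : ℂ → ℝ) (N : Set Cell), IsQuasiconvexDomain Λ Ω → (∀ p ∈ Ω, 0 < σ p) →
      IsBoundedAspectMesh ρ Ω N → ObeysSize Ω σ N → ∀ x ∈ interior Ω,
        ∃ R ∈ N, x ∈ R.region ∧ csize R ≤ A * localFeatureSize Ω σ x := by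
  obtain ⟨B, hB⟩ := exists_degree_bound h1
  have hA : 1 ≤ ρ ^ (B + 1) * (ρ + 2) * (Λ + 1) := by
    have : 1 ≤ ρ ^ (B + 1) := one_le_pow₀ h1
    exact one_le_mul_of_one_le_of_one_le (one_le_mul_of_one_le_of_one_le this (by linarith))
      (by linarith)
  refine ⟨_, hA, fun Ω σ N hΩ hσ hN hob x hx => ?_⟩
  have hcov : {Q ∈ N | x ∈ Q.region}.Nonempty := by
    obtain ⟨Q, hQ, hxQ⟩ : ∃ Q ∈ N, x ∈ Q.region := by simpa using hN.covers (interior_subset hx)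
    exact ⟨Q, hQ, hxQ⟩
  -- The element found for `y` may depend on `y`; the smallest element at `x` works for all `y` at
  -- once.
  obtain ⟨R, ⟨hR, hxR⟩, hmin⟩ := Set.exists_min_image _ csize
    (hN.finite.subset fun Q (hQ : Q ∈ {Q ∈ N | x ∈ Q.region}) => hQ.1) hcov
  refine ⟨R, hR, hxR, ?_⟩
  rw [← div_le_iff₀' (by linarith)]
  refine le_localFeatureSize ⟨x, interior_subset hx⟩ fun y hy => ?_
  rw [div_le_iff₀' (by linarith)]
  obtain ⟨R', hR', hxR', hle⟩ := hN.exists_csize_le h1 (hB Ω N hN) hΛ hΩ hσ hob hx hy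
  exact (hmin R' ⟨hR', hxR'⟩).trans hle

end

section

variable {z u : ℂ} {N : Set Cell} {ρ : ℝ} {Ω : Set ℂ} {σ : ℂ → ℝ}

/-! ### Charging the cells of the diamond-kite mesh to edges -/

/-- The edge `f` of `N` is a longest side of an element that contains a point of `Ω` near the node
`(k, e)` at which the local feature size is comparable to `sl u k`. -/
def Charges (Ω : Set ℂ) (σ : ℂ → ℝ) (N : Set Cell) (A H : ℝ) (z u : ℂ) (k : ℕ) (e : Eis)
    (f : Sym2 ℂ) : Prop :=
  ∃ R ∈ N, f ∈ R.sides ∧ edgeLength f = csize R ∧ ∃ x ∈ R.region ∩ Ω,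
    csize R ≤ A * localFeatureSize Ω σ x ∧ sl u k ≤ 18 * localFeatureSize Ω σ x ∧
    localFeatureSize Ω σ x ≤ H * sl u k ∧ dist x (pt z u k e) ≤ 3 * sl u k

lemma sl_add_two_mul (k m : ℕ) : sl u k = 3 ^ m * sl u (k + 2 * m) := by
  induction m with
  | zero => simp
  | succ m ih => rw [ih, sl_two (k + 2 * m), pow_succ, mul_assoc]; rfl

/-- Two levels make a factor 3, so comparable edge lengths mean a bounded difference of levels. -/
lemma lt_add_of_sl_le (hu : u ≠ 0) {P : ℝ} {m : ℕ} (hm : P < 3 ^ m) {j k : ℕ}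
    (h : sl u j ≤ P * sl u k) : k < j + 2 * m := by
  by_contra! hle
  have h1 := sl_antitone hu hle
  have h2 := sl_pos hu k
  rw [sl_add_two_mul j m] at h
  have h3 : P * sl u k < 3 ^ m * sl u k := mul_lt_mul_of_pos_right hm h2
  have h4 : (3 : ℝ) ^ m * sl u k ≤ 3 ^ m * sl u (j + 2 * m) := by gcongr
  linarith

lemma finite_isU : {w : Eis | IsU w}.Finite := by
  refine (Set.toFinite ({(1, 0), (0, 1), (-1, 1), (-1, 0), (0, -1), (1, -1)} : Set Eis)).subset ?_
  rintro ⟨a, b⟩ h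
  simpa [IsU] using h

/-- An edge is charged by a bounded number of cells. -/
lemma exists_charges_bound {A : ℝ} (hA : 1 ≤ A) (H : ℝ) : ∃ n : ℕ,
    ∀ (Ω : Set ℂ) (σ : ℂ → ℝ) (N : Set Cell) (z u : ℂ), u ≠ 0 → (∀ p ∈ Ω, 0 < σ p) →
      (∀ Q ∈ N, IsProper Q) → ∀ f : Sym2 ℂ,
      {Q : ℕ × Eis × Eis | IsU Q.2.2 ∧ Charges Ω σ N A H z u Q.1 Q.2.1 f}.encard ≤ n := by
  classical
  -- A node is within `3 * sl u k` of `x`, and two elements with the side `f` have `x` and `x₀`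
  -- within `4 * edgeLength f ≤ 4 * A * H * sl u k`.
  obtain ⟨n, hn⟩ := exists_level_count (3 + 4 * A * H)
  -- The local feature sizes at `x` and `x₀` differ by a factor of at most `1 + 4 * A`; with 18 and
  -- `H` this bounds the ratio of the two edge lengths.
  obtain ⟨m, hm⟩ := pow_unbounded_of_one_lt (18 * (1 + 4 * A) * H) (by norm_num : (1 : ℝ) < 3)
  refine ⟨(4 * m + 1) * (n * {w : Eis | IsU w}.ncard), fun Ω σ N z u hu hσ hN f => ?_⟩
  rcases Set.eq_empty_or_nonempty
    {Q : ℕ × Eis × Eis | IsU Q.2.2 ∧ Charges Ω σ N A H z u Q.1 Q.2.1 f} with h0 | ⟨Q₀, -, h0⟩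
  · rw [h0]; simp
  obtain ⟨R₀, hR₀, hf₀, hlen₀, x₀, hx₀, hs₀, hl₀, hu₀, -⟩ := h0
  set k₀ := Q₀.1
  have hsub : {Q : ℕ × Eis × Eis | IsU Q.2.2 ∧ Charges Ω σ N A H z u Q.1 Q.2.1 f} ⊆
      ((Finset.Icc (k₀ - 2 * m) (k₀ + 2 * m)).biUnion fun k =>
        ((hn z u hu k x₀).1.toFinset ×ˢ finite_isU.toFinset).image fun p => (k, p.1, p.2) :
          Finset (ℕ × Eis × Eis)) := by
    rintro ⟨k, e, w⟩ ⟨hw, R, hR, hf, hlen, x, hx, hs, hl, hup, hd⟩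
    dsimp only at hw hs hl hup hd
    obtain ⟨v, hv⟩ : ∃ v, v ∈ f := by
      induction f with
      | _ a b => exact ⟨a, by simp⟩
    have hne : Ω.Nonempty := ⟨x, hx.2⟩
    have d1 := (hN R hR).dist_le hx.1 ⟨f, hf, hv⟩
    have d2 := (hN R₀ hR₀).dist_le hx₀.1 ⟨f, hf₀, hv⟩
    rw [← hlen] at d1 hs
    rw [← hlen₀] at d2 hs₀
    have d3 : dist x x₀ ≤ 4 * edgeLength f := by
      have := dist_triangle_right x x₀ v
      linarith
    have l1 := localFeatureSize_le_add hσ hne x x₀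
    have l2 := localFeatureSize_le_add hσ hne x₀ x
    rw [dist_comm] at l2
    have hspos := sl_pos hu k
    have hspos₀ := sl_pos hu k₀
    have c1 : sl u k ≤ 18 * (1 + 4 * A) * H * sl u k₀ := by
      calc sl u k ≤ 18 * localFeatureSize Ω σ x := hl
        _ ≤ 18 * ((1 + 4 * A) * localFeatureSize Ω σ x₀) := by linarith
        _ ≤ 18 * ((1 + 4 * A) * (H * sl u k₀)) := by gcongr
        _ = _ := by ring
    have c2 : sl u k₀ ≤ 18 * (1 + 4 * A) * H * sl u k := by
      calc sl u k₀ ≤ 18 * localFeatureSize Ω σ x₀ := hl₀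
        _ ≤ 18 * ((1 + 4 * A) * localFeatureSize Ω σ x) := by linarith
        _ ≤ 18 * ((1 + 4 * A) * (H * sl u k)) := by gcongr
        _ = _ := by ring
    have k1 := lt_add_of_sl_le hu hm c1
    have k2 := lt_add_of_sl_le hu hm c2
    have c3 : dist (pt z u k e) x₀ ≤ (3 + 4 * A * H) * sl u k := by
      have h1 := dist_triangle (pt z u k e) x x₀
      rw [dist_comm] at hd
      have h2 : A * localFeatureSize Ω σ x ≤ A * (H * sl u k) := by gcongr
      linarith
    simp only [Finset.coe_biUnion, Finset.coe_image, Set.mem_iUnion, Finset.mem_coe, Finset.mem_Icc,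
      exists_prop]
    refine ⟨k, ⟨by omega, by omega⟩, (e, w), ?_, rfl⟩
    simpa using ⟨c3, hw⟩
  refine (Set.encard_le_encard hsub).trans ?_
  rw [Set.encard_coe_eq_coe_finsetCard]
  norm_cast
  refine (Finset.card_biUnion_le_card_mul _ _ (n * {w : Eis | IsU w}.ncard) fun k _ => ?_).trans ?_
  · refine Finset.card_image_le.trans ?_
    rw [Finset.card_product, ← Set.ncard_eq_toFinset_card _ (hn z u hu k x₀).1,
      ← Set.ncard_eq_toFinset_card _ finite_isU]
    exact Nat.mul_le_mul_right _ (hn z u hu k x₀).2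
  · refine Nat.mul_le_mul_right _ ?_
    rw [Nat.card_Icc]
    omega

/-! ### A lower bound for the charged edges -/

/-- Were all points closer than this, the diameter would be at most half of itself, hence zero, and
the strict inequality would fail at `p`. -/
lemma exists_dist_ge_diam {S : Set ℂ} {p : ℂ} (hp : p ∈ S) :
    ∃ q ∈ S, Metric.diam S / 4 ≤ dist p q := by
  by_contra! hcon
  have h0 : 0 ≤ Metric.diam S := Metric.diam_nonneg
  have h1 : Metric.diam S ≤ Metric.diam S / 2 := by
    refine Metric.diam_le_of_forall_dist_le (by linarith) fun x hx y hy => ?_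
    have := dist_triangle_left x y p
    linarith [hcon x hx, hcon y hy]
  have h2 := hcon p hp
  rw [dist_self] at h2
  linarith

lemma finite_edgesOn (hfin : N.Finite) (hN : ∀ Q ∈ N, IsProper Q) : (edgesOn Ω N).Finite := by
  refine (hfin.biUnion fun Q hQ => (hN Q hQ).finite).subset ?_
  rintro f ⟨Q, hQ, -, hf⟩
  exact Set.mem_biUnion hQ hf

/-- If the elements of `N` at the points of `Ω` near `p` have longest sides in `E`, then
these are together as long as the distance from `p` to some other point. -/
lemma ofReal_le_tsum_edgeLength {Λ : ℝ} (hΩ : IsQuasiconvexDomain Λ Ω) (hN : ∀ Q ∈ N, IsProper Q)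
    {E : Set (Sym2 ℂ)} (hE : E.Countable) {p q : ℂ} (hp : p ∈ interior Ω) (hq : q ∈ interior Ω)
    {r : ℝ} (hr : r ≤ dist p q)
    (h : ∀ x ∈ interior Ω, dist p x ≤ r → ∃ R ∈ N, x ∈ R.region ∧ ∃ f ∈ E, f ∈ R.sides ∧
      edgeLength f = csize R) :
    ENNReal.ofReal r ≤ 4 * ∑' f : E, ENNReal.ofReal (edgeLength f) := by
  obtain ⟨γ, hγ0, hγ1, hγin, hγL⟩ := hΩ.path p hp q hq
  have hcont : ContinuousOn γ (Set.Icc 0 1) := by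
    have hlip : LipschitzOnWith (Λ * dist p q).toNNReal γ (Set.Icc 0 1) := by
      refine LipschitzOnWith.of_dist_le_mul fun s hs t ht => (hγL s hs t ht).trans ?_
      rw [Real.dist_eq]
      exact mul_le_mul_of_nonneg_right (Real.le_coe_toNNReal _) (abs_nonneg _)
    exact hlip.continuousOn
  have hex : ∀ f : Sym2 ℂ, ∃ v, v ∈ f := by
    intro f
    induction f with
    | _ a b => exact ⟨a, by simp⟩
  choose v hv using hex
  -- Along the path the distance to `p` takes every value in `[0, r]`. The element with longest side
  -- `f` accounts for an interval of length `4 * edgeLength f`, which gives the factor 4.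
  have hsub : Set.Icc 0 r ⊆ ⋃ f ∈ E, Metric.closedBall (dist p (v f)) (2 * edgeLength f) := by
    rintro a ⟨ha0, har⟩
    obtain ⟨t, ht, rfl⟩ := intermediate_value_Icc zero_le_one
      (by fun_prop : ContinuousOn (fun t => dist p (γ t)) (Set.Icc 0 1))
      (show a ∈ Set.Icc _ _ by
        rw [hγ0, hγ1, dist_self]; exact ⟨ha0, har.trans hr⟩)
    obtain ⟨R, hR, hxR, f, hfE, hfR, hlen⟩ := h _ (hγin t ht) har
    refine Set.mem_biUnion hfE ?_
    rw [Metric.mem_closedBall, hlen]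
    exact (dist_dist_dist_le_right _ _ _).trans ((hN R hR).dist_le hxR ⟨f, hfR, hv f⟩)
  calc ENNReal.ofReal r = MeasureTheory.volume (Set.Icc 0 r) := by rw [Real.volume_Icc, sub_zero]
    _ ≤ MeasureTheory.volume (⋃ f ∈ E, Metric.closedBall (dist p (v f)) (2 * edgeLength f)) :=
      MeasureTheory.measure_mono hsub
    _ ≤ ∑' f : E, MeasureTheory.volume
          (Metric.closedBall (dist p (v (f : Sym2 ℂ))) (2 * edgeLength f)) :=
      MeasureTheory.measure_biUnion_le _ hE _
    _ = 4 * ∑' f : E, ENNReal.ofReal (edgeLength f) := by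
      rw [← ENNReal.tsum_mul_left]
      refine tsum_congr fun f => ?_
      rw [Real.volume_closedBall, ← mul_assoc, ENNReal.ofReal_mul (by norm_num)]
      norm_num

/-- The edges charged by a cell are together at least as long as a fixed part of its sides. -/
lemma IsCell.ofReal_sl_le {A K Λ : ℝ} (hK1 : 1 ≤ K) (hu : u ≠ 0) {D : Set (ℕ × Eis)}
    (hfin : D.Finite) (hD : Down D) (hΩ : IsQuasiconvexDomain Λ Ω) (hσ : ∀ p ∈ Ω, 0 < σ p)
    (hdiam : ∃ q ∈ Ω, σ q ≤ K * Metric.diam Ω)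
    (hK : ∀ p ∈ Ω, localFeatureSize Ω σ p ≤ K * ‖u‖)
    (hM : IsDiamondKiteMeshFor (rhombille z u) Ω σ (mesh z u D)) (hN : ∀ Q ∈ N, IsProper Q)
    (hNfin : N.Finite) (hA : ∀ x ∈ interior Ω,
        ∃ R ∈ N, x ∈ R.region ∧ csize R ≤ A * localFeatureSize Ω σ x)
    {k : ℕ} {e w : Eis} (hc : IsCell D k e w) (hne : ((cellOf z u D k e w).region ∩ Ω).Nonempty) :
    ENNReal.ofReal (sl u k) ≤ ENNReal.ofReal (432 * (1 + K)) *
      ∑' f : {f ∈ edgesOn Ω N | Charges Ω σ N A (max K 14 + 1) z u k e f},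
        ENNReal.ofReal (edgeLength f) := by
  obtain ⟨p, hpQ, hpΩ⟩ := hne
  obtain ⟨q₀, hq₀, hσq⟩ := hdiam
  have hs := sl_pos hu k
  have hlfs : sl u k ≤ 9 * localFeatureSize Ω σ p := by
    rw [← div_le_iff₀' (by norm_num)]
    refine le_localFeatureSize ⟨p, hpΩ⟩ fun q hq => ?_
    rw [div_le_iff₀' (by norm_num)]
    exact hc.sl_le hu hfin hD hσ hM.obeys hpQ hq
  have hlfs' := hc.localFeatureSize_le hu hfin hD hσ hK hM hpQ hpΩ
  -- The assumption on the diameter enters here: a cell is not much larger than Ω, so a path inside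
  -- Ω can leave its neighbourhood.
  have hd : sl u k ≤ 9 * (1 + K) * Metric.diam Ω := by
    have h1 := DiamondKite.localFeatureSize_le hσ p hq₀
    have h2 := Metric.dist_le_diam_of_mem hΩ.bounded hpΩ hq₀
    linarith
  obtain ⟨q, hq, hpq⟩ := exists_dist_ge_diam hpΩ
  -- `108 = 9 * 12` makes the diameter at least `12 * r`. Some point is then `3 * r` away from `p`,
  -- and `r` remains after moving both ends into the interior.
  set r := sl u k / (108 * (1 + K)) with hr
  have hr0 : 0 < r := by positivity
  have hr1 : sl u k = 108 * (1 + K) * r := by rw [hr]; field_simp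
  have hr2 : 216 * r ≤ sl u k := by rw [hr1]; nlinarith
  obtain ⟨p', hp', hpp⟩ := Metric.mem_closure_iff.1 (hΩ.subset_closure hpΩ) r hr0
  obtain ⟨q', hq', hqq⟩ := Metric.mem_closure_iff.1 (hΩ.subset_closure hq) r hr0
  have hdiam3 : 12 * r ≤ Metric.diam Ω := by
    rw [hr1] at hd
    have : 9 * (1 + K) * (12 * r) ≤ 9 * (1 + K) * Metric.diam Ω := by linarith
    exact le_of_mul_le_mul_left this (by positivity)
  have hpq' : r ≤ dist p' q' := by
    have h1 := dist_triangle4 p p' q' q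
    rw [dist_comm q' q] at h1
    linarith
  have hneΩ : Ω.Nonempty := ⟨p, hpΩ⟩
  have key := ofReal_le_tsum_edgeLength (N := N) hΩ hN
    (E := {f ∈ edgesOn Ω N | Charges Ω σ N A (max K 14 + 1) z u k e f})
    ((finite_edgesOn hNfin hN).subset fun f hf => hf.1).countable hp' hq' hpq' ?_
  · calc ENNReal.ofReal (sl u k) = ENNReal.ofReal (108 * (1 + K)) * ENNReal.ofReal r := by
          rw [← ENNReal.ofReal_mul (by positivity), ← hr1]
      _ ≤ ENNReal.ofReal (108 * (1 + K)) * (4 * _) := by gcongr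
      _ = _ := by
        rw [← mul_assoc, show (4 : ℝ≥0∞) = ENNReal.ofReal 4 by norm_num,
          ← ENNReal.ofReal_mul (by positivity)]
        congr 2
        ring
  -- `x` is within `2 * r` of `p`, tiny compared to `sl u k`. The estimates at `p` survive with 9
  -- relaxed to 18, `max K 14` increased by 1, and 2 edge lengths relaxed to 3.
  · intro x hx hpx
    obtain ⟨R, hR, hxR, hcs⟩ := hA x hx
    obtain ⟨f, hf, hlen⟩ := (hN R hR).exists_edgeLength_eq
    have hxp : dist x p ≤ 2 * r := by
      have h1 := dist_triangle_left x p p'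
      rw [dist_comm p' p] at h1
      linarith
    have hxΩ := interior_subset hx
    refine ⟨R, hR, hxR, f, ⟨⟨R, hR, ⟨x, hxR, hxΩ⟩, hf⟩, R, hR, hf, hlen, x, ⟨hxR, hxΩ⟩, hcs,
      ?_, ?_, ?_⟩, hf, hlen⟩
    · have := localFeatureSize_le_add hσ hneΩ p x
      rw [dist_comm] at this
      linarith
    · have := localFeatureSize_le_add hσ hneΩ x p
      linarith
    · have h1 := dist_le_of_mem_rhombus hc.1 (cellOf_region_subset hpQ)
      have h2 := dist_triangle x p (pt z u k e)
      linarith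

/-! ### Summation over the cells -/

lemma tsum_le_encard_mul {α : Type*} (S : Set α) (g : α → ℝ≥0∞) {c : ℝ≥0∞}
    (h : ∀ x ∈ S, g x ≤ c) : ∑' x : S, g x ≤ S.encard * c :=
  (ENNReal.tsum_le_tsum fun x : S => h x x.2).trans_eq (ENNReal.tsum_set_const S c)

lemma tsum_sides_le (hu : u ≠ 0) {D : Set (ℕ × Eis)} {k : ℕ} {e w : Eis} (hc : IsCell D k e w) :
    ∑' f : (cellOf z u D k e w).sides, ENNReal.ofReal (edgeLength f) ≤
      4 * ENNReal.ofReal (sl u k) := by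
  refine (tsum_le_encard_mul _ (fun f => ENNReal.ofReal (edgeLength f)) fun f hf =>
    ENNReal.ofReal_le_ofReal ?_).trans (mul_le_mul_left ?_ _)
  · rcases edgeLength_side hc hf with h | h <;> rw [h]
    exact sl_antitone hu (Nat.le_succ k)
  · have : (cellOf z u D k e w).sides.encard ≤ 4 := by
      unfold cellOf convexQuad
      refine (Set.encard_insert_le _ _).trans ?_
      refine (add_le_add_left (Set.encard_insert_le _ _) _).trans ?_
      refine (add_le_add_left (add_le_add_left (Set.encard_insert_le _ _) _) _).trans ?_
      rw [Set.encard_singleton]; norm_num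
    exact_mod_cast this

/-- Double counting: after exchanging the sums, each `g b` appears once for every `a` related to
`b`. -/
lemma tsum_tsum_le_of_encard_le {α β : Type*} {I : Set α} {E : Set β} {P : α → β → Prop} {n : ℕ}
    (hn : ∀ b ∈ E, {a ∈ I | P a b}.encard ≤ n) (g : β → ℝ≥0∞) :
    ∑' a : I, ∑' b : {b ∈ E | P a b}, g b ≤ n * ∑' b : E, g b := by
  classical
  have h1 : ∀ a : α, ∑' b : {b ∈ E | P a b}, g b = ∑' b : E, if P a b then g b else 0 := by
    intro a
    rw [tsum_subtype {b ∈ E | P a b} g, tsum_subtype E fun b => if P a b then g b else 0]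
    refine tsum_congr fun b => ?_
    by_cases h2 : b ∈ E <;> by_cases h3 : P a b <;> simp [Set.indicator, h2, h3]
  have h2 : ∀ b : β, ∑' a : I, (if P a b then g b else 0) = {a ∈ I | P a b}.encard * g b := by
    intro b
    rw [← ENNReal.tsum_set_const, tsum_subtype {a ∈ I | P a b} fun _ => g b,
      tsum_subtype I fun a => if P a b then g b else 0]
    refine tsum_congr fun a => ?_
    by_cases h2 : a ∈ I <;> by_cases h3 : P a b <;> simp [Set.indicator, h2, h3]
  simp only [h1]
  rw [ENNReal.tsum_comm, ← ENNReal.tsum_mul_left]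
  refine ENNReal.tsum_le_tsum fun b => ?_
  rw [h2]
  exact mul_le_mul_left (by exact_mod_cast hn b b.2) _

lemma totalEdgeLength_mesh_le {A K Λ : ℝ} (hK1 : 1 ≤ K) (hu : u ≠ 0) {D : Set (ℕ × Eis)}
    (hfin : D.Finite) (hD : Down D) (hΩ : IsQuasiconvexDomain Λ Ω) (hσ : ∀ p ∈ Ω, 0 < σ p)
    (hdiam : ∃ q ∈ Ω, σ q ≤ K * Metric.diam Ω)
    (hK : ∀ p ∈ Ω, localFeatureSize Ω σ p ≤ K * ‖u‖)
    (hM : IsDiamondKiteMeshFor (rhombille z u) Ω σ (mesh z u D)) (hN : ∀ Q ∈ N, IsProper Q)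
    (hNfin : N.Finite) (hA : ∀ x ∈ interior Ω,
        ∃ R ∈ N, x ∈ R.region ∧ csize R ≤ A * localFeatureSize Ω σ x) {n : ℕ}
    (hn : ∀ f : Sym2 ℂ, {Q : ℕ × Eis × Eis | IsU Q.2.2 ∧
      Charges Ω σ N A (max K 14 + 1) z u Q.1 Q.2.1 f}.encard ≤ n) :
    totalEdgeLength Ω (mesh z u D) ≤
      4 * ENNReal.ofReal (432 * (1 + K)) * n * totalEdgeLength Ω N := by
  -- Each cell is indexed from both ends of its lattice edge; the repetition only enlarges the upper
  -- bound, and `hn` counts these triples.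
  set I : Set (ℕ × Eis × Eis) := {Q | IsCell D Q.1 Q.2.1 Q.2.2 ∧
    ((cellOf z u D Q.1 Q.2.1 Q.2.2).region ∩ Ω).Nonempty} with hI
  have hsub : edgesOn Ω (mesh z u D) ⊆ ⋃ Q ∈ I, (cellOf z u D Q.1 Q.2.1 Q.2.2).sides := by
    rintro f ⟨_, ⟨k, e, w, hc, rfl⟩, hne, hf⟩
    exact Set.mem_biUnion (show (k, e, w) ∈ I from ⟨hc, hne⟩) hf
  calc totalEdgeLength Ω (mesh z u D)
      ≤ ∑' f : ⋃ Q ∈ I, (cellOf z u D Q.1 Q.2.1 Q.2.2).sides, ENNReal.ofReal (edgeLength f) :=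
        ENNReal.tsum_mono_subtype (fun f => ENNReal.ofReal (edgeLength f)) hsub
    _ ≤ ∑' Q : I, ∑' f : (cellOf z u D Q.1.1 Q.1.2.1 Q.1.2.2).sides,
          ENNReal.ofReal (edgeLength f) :=
        ENNReal.tsum_biUnion_le_tsum (fun f => ENNReal.ofReal (edgeLength f)) I _
    _ ≤ ∑' Q : I, 4 * (ENNReal.ofReal (432 * (1 + K)) *
          ∑' f : {f ∈ edgesOn Ω N | Charges Ω σ N A (max K 14 + 1) z u Q.1.1 Q.1.2.1 f},
            ENNReal.ofReal (edgeLength f)) := by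
        refine ENNReal.tsum_le_tsum fun Q => (tsum_sides_le hu Q.2.1).trans ?_
        gcongr
        exact Q.2.1.ofReal_sl_le hK1 hu hfin hD hΩ hσ hdiam hK hM hN hNfin hA Q.2.2
    _ ≤ _ := by
        rw [ENNReal.tsum_mul_left, ENNReal.tsum_mul_left, ← mul_assoc, mul_assoc _ (n : ℝ≥0∞)]
        gcongr
        refine tsum_tsum_le_of_encard_le (I := I) (E := edgesOn Ω N)
          (P := fun Q f => Charges Ω σ N A (max K 14 + 1) z u Q.1 Q.2.1 f) (fun f _ => ?_)
          fun f => ENNReal.ofReal (edgeLength f)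
        refine (Set.encard_le_encard ?_).trans (hn f)
        rintro Q ⟨hQ, hch⟩
        exact ⟨hQ.1.1, hch⟩

lemma IsQuasiconvexDomain.mono {Λ Λ' : ℝ} (h : Λ ≤ Λ') (hΩ : IsQuasiconvexDomain Λ Ω) :
    IsQuasiconvexDomain Λ' Ω where
  bounded := hΩ.bounded
  nonempty := hΩ.nonempty
  subset_closure := hΩ.subset_closure
  path p hp q hq := by
    obtain ⟨γ, h0, h1, h2, h3⟩ := hΩ.path p hp q hq
    exact ⟨γ, h0, h1, h2, fun s hs t ht => (h3 s hs t ht).trans (by gcongr)⟩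

lemma IsBoundedAspectMesh.mono {ρ' : ℝ} (h : ρ ≤ ρ') (hN : IsBoundedAspectMesh ρ Ω N) :
    IsBoundedAspectMesh ρ' Ω N where
  finite := hN.finite
  shape := hN.shape
  aspect Q hQ e he v hv f hf hvf := (hN.aspect Q hQ e he v hv f hf hvf).trans
    (mul_le_mul_of_nonneg_right h Metric.infDist_nonneg)
  edgeToEdge := hN.edgeToEdge
  covers := hN.covers

end

end DiamondKite

end

/-! ### Choice of the constants -/

open DiamondKite in
theorem mainTheorem2 (ρ Λ K : ℝ) :
    ∃ C : ℝ≥0, ∀ (Ω : Set ℂ) (σ : ℂ → ℝ) (z u : ℂ) (M N : Set DiamondKite.Cell),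
      DiamondKite.IsQuasiconvexDomain Λ Ω →
      (∀ p ∈ Ω, 0 < σ p) →
      (∃ q ∈ Ω, σ q ≤ K * Metric.diam Ω) →
      u ≠ 0 →
      (∀ p ∈ Ω, DiamondKite.localFeatureSize Ω σ p ≤ K * ‖u‖) →
      DiamondKite.IsDiamondKiteMeshFor (DiamondKite.rhombille z u) Ω σ M →
      DiamondKite.IsBoundedAspectMesh ρ Ω N →
      DiamondKite.ObeysSize Ω σ N →
      DiamondKite.totalEdgeLength Ω M ≤ C * DiamondKite.totalEdgeLength Ω N := by
  -- The hypotheses only weaken when the constants grow, so `1 ≤ ρ`, `0 ≤ Λ` and `1 ≤ K` may be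
  -- assumed.
  obtain ⟨A, hA1, hA⟩ := exists_csize_bound (le_max_right ρ 1) (le_max_right Λ 0)
  obtain ⟨n, hn⟩ := exists_charges_bound hA1 (max (max K 1) 14 + 1)
  refine ⟨4 * (432 * (1 + max K 1)).toNNReal * n, fun Ω σ z u M N hΩ hσ hdiam hu hK hM hN hob => ?_⟩
  obtain ⟨D, -, hfin, hD, rfl⟩ := exists_down_of_refines hu Set.finite_empty down_empty
    (by rw [mesh_empty]; exact hM.refines)
  have hΩ' := hΩ.mono (le_max_left Λ 0)
  have hN' := hN.mono (le_max_left ρ 1)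
  have hproper : ∀ Q ∈ N, IsProper Q := fun Q hQ => hN'.isProper hQ
  have hdiam' : ∃ q ∈ Ω, σ q ≤ max K 1 * Metric.diam Ω := hdiam.imp fun q hq => ⟨hq.1, hq.2.trans
    (mul_le_mul_of_nonneg_right (le_max_left _ _) Metric.diam_nonneg)⟩
  have hK' : ∀ p ∈ Ω, localFeatureSize Ω σ p ≤ max K 1 * ‖u‖ := fun p hp => (hK p hp).trans
    (mul_le_mul_of_nonneg_right (le_max_left _ _) (norm_nonneg _))
  have := totalEdgeLength_mesh_le (le_max_right K 1) hu hfin hD hΩ' hσ hdiam' hK' hM hproper hN.finite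
    (hA Ω σ N hΩ' hσ hN' hob) (hn Ω σ N z u hu hσ hproper)
  simpa [ENNReal.ofReal] using this
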